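/- Let $A$ be a discriminant form, i.e. a finite abelian group with a non-degenerate $\mathbb{Q}/\mathbb{Z}$-valued quadratic form $\lambda\mapsto\lambda^2/2$ and associated bilinear form $(\lambda,\mu)$. Its signature $\operatorname{sig}(A)\in\mathbb{Z}/8\mathbb{Z}$ is determined by Milgram's formula $\sum_{\lambda\in A}e(\lambda^2/2)=\sqrt{|A|}\,e(\operatorname{sig}(A)/8)$, where $e(z)=e^{2\pi i z}$. Let $k\in\frac12\mathbb{Z}$. Let $\widetilde{\mathrm{GL}}{}_2^+(\mathbb{R})$ be the group of pairs $(M,\phi)$ with $M=\begin{pmatrix}a&b\\c&d\end{pmatrix}\in\mathrm{GL}_2^+(\mathbb{R})$ and $\phi:\mathbb{H}\to\mathbb{C}$ holomorphic with $\phi(\tau)^2=c\tau+d$, with product $(M,\phi(\tau))(M',\phi'(\tau))=(MM',\phi(M'\tau)\phi'(\tau))$, and let $\tilde\Gamma$ be the inverse image of $\mathrm{SL}_2(\mathbb{Z})$. Let $\rho_A$ be the Weil representation of $\tilde\Gamma$ on $\mathbb{C}[A]=\bigoplus_\lambda\mathbb{C}\mathfrak e_\lambda$, determined by $$\rho_A\left(\begin{pmatrix}1&1\\0&1\end{pmatrix},1\right)\mathfrak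 e_\lambda=e(\lambda^2/2)\mathfrak e_\lambda,\qquad \rho_A\left(\begin{pmatrix}0&-1\\1&0\end{pmatrix},\sqrt\tau\right)\mathfrak e_\lambda=\frac{e(-\operatorname{sig}(A)/8)}{\sqrt{|A|}}\sum_{\mu\in A}e(-(\lambda,\mu))\mathfrak e_\mu .$$ Let $M_{k,A}$ be the space of holomorphic $f:\mathbb{H}\to\mathbb{C}[A]$ with $f(M\tau)=\phi(\tau)^{2k}\rho_A(M,\phi)f(\tau)$ for all $(M,\phi)\in\tilde\Gamma$ which are holomorphic at $\infty$, and let $S_{k,A}$ be the subspace of cusp forms. For a positive integer $m$ let $\alpha=\left(\begin{pmatrix}m^2&0\\0&1\end{pmatrix},1\right)$, put $\mathfrak e_\lambda\mid\alpha=\mathfrak e_{m\lambda}$ and $\mathfrak a\mid\gamma=\rho_A(\gamma)^{-1}\mathfrak a$ for $\gamma\in\tilde\Gamma$, and for $\delta=\gamma\alpha\gamma'\in\tilde\Gamma\alpha\tilde\Gamma$ put $\mathfrak a\mid\delta=\mathfrak a\mid\gamma\mid\alpha\mid\gamma'$. With a disjoint decomposition $\tilde\Gamma\alpha\tilde\Gamma=\bigcup_i\tilde\Gamma\delta_i$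 define, for $f=\sum_\lambda f_\lambda\otimes\mathfrak e_\lambda\in M_{k,A}$, $$f\mid T(m^2)^*=m^{k-2}\sum_i\sum_{\lambda\in A}(f_\lambda\mid_k\delta_i)\otimes(\mathfrak e_\lambda\mid\delta_i),\qquad (f_\lambda\mid_k(M,\phi))(\tau)=\det(M)^{k/2}\phi(\tau)^{-2k}f_\lambda(M\tau).$$ Then for every positive integer $m$ (not necessarily coprime to the level of $A$) the operator $T(m^2)^*$ is well defined: the action of $\delta$ does not depend on the choice of $\gamma,\gamma'$, the decomposition is finite, and $f\mid T(m^2)^*$ does not depend on the choice of the $\delta_i$. It is a linear endomorphism of $M_{k,A}$, takes cusp forms to cusp forms, and is self-adjoint with respect to the Petersson scalar product $$(f,g)=\int_{\mathrm{SL}_2(\mathbb{Z})\backslash\mathbb{H}}\sum_{\lambda\in A} f_\lambda(\tau)\overline{g_\lambda(\tau)}\,y^k\,\frac{dx\,dy}{y^2}\qquad(\tau=x+iy),$$ that is, for $f,g\in M_{k,A}$ at least one of which is a cusp form, $(f\mid T(m^2)^*,g)$ and $(f,g\mid T(m^2)^*)$ converge and are equal. Moreover, if $m,n$ are coprime positive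 integers, then $T(m^2)^*T(n^2)^*=T(m^2n^2)^*$. -/

import Mathlib

open UpperHalfPlane MeasureTheory Manifold
open scoped MatrixGroups ComplexConjugate

noncomputable section

namespace WeilHecke

/-! ### The metaplectic cover of `GL₂⁺(ℝ)` -/

/-- Elements of the metaplectic two-fold cover of `GL₂⁺(ℝ)`: pairs `(M, φ)` of a matrix
`M = (a, b; c, d)` of positive determinant and a holomorphic `φ : ℍ → ℂ` such that
`φ(τ)² = cτ + d`. -/
@[ext]
structure MetaGL where
  mat : GL (Fin 2) ℝ
  det_pos : 0 < mat.det.val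
  phi : ℍ → ℂ
  holo : MDifferentiable 𝓘(ℂ) 𝓘(ℂ) phi
  sq : ∀ τ : ℍ, phi τ ^ 2 = denom mat τ

namespace MetaGL

theorem phi_ne_zero (g : MetaGL) (τ : ℍ) : g.phi τ ≠ 0 := by
  intro h
  have h2 := g.sq τ
  rw [h] at h2
  exact denom_ne_zero g.mat τ (by simpa using h2.symm)

theorem inv_det_pos (g : MetaGL) : 0 < (g.mat⁻¹).det.val := by
  rw [map_inv, Units.val_inv_eq_inv_val]
  exact inv_pos.mpr g.det_pos

/-- The product `(M, φ) (M', φ') = (M M', φ(M' τ) φ'(τ))`. -/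
instance : Mul MetaGL where
  mul g h :=
    { mat := g.mat * h.mat
      det_pos := by
        rw [map_mul, Units.val_mul]
        exact mul_pos g.det_pos h.det_pos
      phi := fun τ => g.phi (h.mat • τ) * h.phi τ
      holo := (g.holo.comp (mdifferentiable_smul h.det_pos)).mul h.holo
      sq := fun τ => by
        rw [mul_pow, g.sq, h.sq, coe_smul_of_det_pos h.det_pos]
        exact (denom_cocycle g.mat h.mat (z := (τ : ℂ)) τ.im_ne_zero).symm }

instance : One MetaGL where
  one :=
    { mat := 1
      det_pos := by simp
      phi := fun _ => 1
      holo := mdifferentiable_const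
      sq := fun τ => by simp }

instance : Inv MetaGL where
  inv g :=
    { mat := g.mat⁻¹
      det_pos := g.inv_det_pos
      phi := fun τ => (g.phi (g.mat⁻¹ • τ))⁻¹
      holo := by
        have h1 : MDifferentiable 𝓘(ℂ) 𝓘(ℂ) (fun τ : ℍ => g.phi (g.mat⁻¹ • τ)) :=
          g.holo.comp (mdifferentiable_smul g.inv_det_pos)
        intro τ
        exact MDifferentiableAt.comp (g := fun z : ℂ => z⁻¹) τ
          (differentiableAt_inv (phi_ne_zero g _)).mdifferentiableAt (h1 τ)
      sq := fun τ => by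
        have := denom_cocycle g.mat g.mat⁻¹ (z := (τ : ℂ)) τ.im_ne_zero
        rw [inv_pow, g.sq, coe_smul_of_det_pos g.inv_det_pos]
        rw [mul_inv_cancel, denom_one] at this
        exact inv_eq_of_mul_eq_one_right this.symm }

@[simp] theorem mul_mat (g h : MetaGL) : (g * h).mat = g.mat * h.mat := rfl
@[simp] theorem mul_phi (g h : MetaGL) (τ : ℍ) :
    (g * h).phi τ = g.phi (h.mat • τ) * h.phi τ := rfl
@[simp] theorem one_mat : (1 : MetaGL).mat = 1 := rfl
@[simp] theorem one_phi (τ : ℍ) : (1 : MetaGL).phi τ = 1 := rfl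
@[simp] theorem inv_mat (g : MetaGL) : (g⁻¹).mat = g.mat⁻¹ := rfl
@[simp] theorem inv_phi (g : MetaGL) (τ : ℍ) :
    (g⁻¹).phi τ = (g.phi (g.mat⁻¹ • τ))⁻¹ := rfl

instance : Group MetaGL where
  mul_assoc a b c := by
    ext1
    · simp [mul_assoc]
    · funext τ
      simp [mul_assoc, mul_smul]
  one_mul a := by
    ext1
    · simp
    · funext τ
      simp
  mul_one a := by
    ext1
    · simp
    · funext τ
      simp
  inv_mul_cancel a := by
    ext1
    · simp
    · funext τ
      simp [phi_ne_zero]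

/-- The covering map `(M, φ) ↦ M`. -/
def proj : MetaGL →* GL (Fin 2) ℝ where
  toFun g := g.mat
  map_one' := rfl
  map_mul' _ _ := rfl

/-- The action on the upper half plane through the covering map. -/
def act (g : MetaGL) (τ : ℍ) : ℍ := g.mat • τ

/-- The determinant `det (M, φ) = det M`. -/
def det (g : MetaGL) : ℝ := g.mat.det.val

end MetaGL

/-- The integral metaplectic group: the full inverse image of `SL₂(ℤ)`. -/
def Mp2Z : Subgroup MetaGL :=
  (Matrix.SpecialLinearGroup.mapGL (R := ℤ) (n := Fin 2) ℝ).range.comap MetaGL.proj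

/-- `T = ((1, 1; 0, 1), 1)`. -/
def mpT : Mp2Z :=
  ⟨{ mat := Matrix.SpecialLinearGroup.mapGL ℝ ModularGroup.T
     det_pos := by simp
     phi := fun _ => 1
     holo := mdifferentiable_const
     sq := fun τ => by simp [denom, Matrix.SpecialLinearGroup.mapGL_coe_matrix, ModularGroup.coe_T] },
    ⟨ModularGroup.T, rfl⟩⟩

/-- `S = ((0, -1; 1, 0), √τ)`, with the principal branch of the square root. -/
def mpS : Mp2Z :=
  ⟨{ mat := Matrix.SpecialLinearGroup.mapGL ℝ ModularGroup.S
     det_pos := by simp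
     phi := fun τ => (τ : ℂ) ^ (1 / 2 : ℂ)
     holo := fun τ => by
       have h : DifferentiableAt ℂ (fun z : ℂ => z ^ (1 / 2 : ℂ)) (τ : ℂ) :=
         (differentiableAt_id).cpow_const (Or.inr τ.im_ne_zero)
       exact h.mdifferentiableAt.comp τ (mdifferentiable_coe τ)
     sq := fun τ => by
       have h : ((τ : ℂ) ^ (1 / 2 : ℂ)) ^ 2 = (τ : ℂ) := by
         rw [one_div]
         exact Complex.cpow_nat_inv_pow (τ : ℂ) (n := 2) two_ne_zero
       rw [h]
       simp [denom, Matrix.SpecialLinearGroup.mapGL_coe_matrix, ModularGroup.coe_S] },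
    ⟨ModularGroup.S, rfl⟩⟩

/-! ### Discriminant forms and the Weil representation -/

/-- `e(x) = exp(2πix)` for `x ∈ ℚ/ℤ`. -/
def e : AddCircle (1 : ℚ) → ℂ :=
  Function.Periodic.lift (f := fun r : ℚ => Complex.exp (2 * Real.pi * Complex.I * (r : ℂ)))
    (c := (1 : ℚ)) (fun r => by
      push_cast
      rw [mul_add, mul_one, Complex.exp_add, Complex.exp_two_pi_mul_I, mul_one])

/-- A discriminant form: a finite abelian group `A` (finiteness is a separate instance) with a
non-degenerate `ℚ/ℤ`-valued quadratic form `q(x) = x²/2`.  The associated bilinear form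
`(x, y) = q(x + y) - q(x) - q(y)` is `QuadraticMap.polar q x y`. -/
structure DiscriminantForm (A : Type*) [AddCommGroup A] where
  q : QuadraticMap ℤ A (AddCircle (1 : ℚ))
  nondegenerate : ∀ x, (∀ y, QuadraticMap.polar q x y = 0) → x = 0

section Weil

variable {A : Type*} [AddCommGroup A] [Fintype A]

/-- The standard basis vector `𝔢_λ` of `ℂ[A]`, where `ℂ[A]` is realised as functions `A → ℂ`. -/
def basisVec (l : A) : A → ℂ := by
  classical exact Pi.single l 1

/-- The standard scalar product on `ℂ[A]`, antilinear in the second entry. -/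
def scalarProd (v w : A → ℂ) : ℂ := ∑ l, v l * conj (w l)

/-- `s` is the signature modulo `8` of the discriminant form, as determined by Milgram's formula
`∑_λ e(λ²/2) = √|A| e(s/8)`. -/
def IsSignature (D : DiscriminantForm A) (s : ZMod 8) : Prop :=
  ∑ l : A, e (D.q l) =
    (Real.sqrt (Fintype.card A) : ℂ) * Complex.exp (2 * Real.pi * Complex.I * ((s.val : ℂ) / 8))

/-- The signature `sig(A) ∈ ℤ/8ℤ` of a discriminant form. -/
def sig (D : DiscriminantForm A) : ZMod 8 := Classical.epsilon (IsSignature D)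

/-- `ρ` is a representation of the integral metaplectic group on `ℂ[A]` which is given on the
generators by `ρ(T) 𝔢_λ = e(λ²/2) 𝔢_λ` and
`ρ(S) 𝔢_λ = e(-sig(A)/8) / √|A| ∑_μ e(-(λ, μ)) 𝔢_μ`. -/
def IsWeilRep (D : DiscriminantForm A) (ρ : Mp2Z →* Module.End ℂ (A → ℂ)) : Prop :=
  (∀ l : A, ρ mpT (basisVec l) = e (D.q l) • basisVec l) ∧
  (∀ l : A, ρ mpS (basisVec l) =
    (Complex.exp (2 * Real.pi * Complex.I * (-((sig D).val : ℂ) / 8)) /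
        (Real.sqrt (Fintype.card A) : ℂ)) •
      ∑ m : A, e (-(QuadraticMap.polar D.q l m)) • basisVec m)

open Classical in
/-- The Weil representation `ρ_A`: the unique representation of the integral metaplectic group with
the prescribed values on the generators `T` and `S`. -/
def weilRep (D : DiscriminantForm A) : Mp2Z →* Module.End ℂ (A → ℂ) :=
  if h : ∃ ρ, IsWeilRep D ρ then h.choose else 1

/-! ### Modular forms of type `ρ_A`

The weight is `k = κ / 2` with `κ : ℤ`. -/

/-- The space `M_{k,A}`, `k = κ/2`: holomorphic `f : ℍ → ℂ[A]` such that
`f(Mτ) = φ(τ)^{2k} ρ_A(M, φ) f(τ)` for all `(M, φ)` in the integral metaplectic group, and which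
are holomorphic at the cusp `∞`. -/
def modularForms (D : DiscriminantForm A) (κ : ℤ) : Submodule ℂ (ℍ → A → ℂ) where
  carrier := {f | (∀ l, MDifferentiable 𝓘(ℂ) 𝓘(ℂ) (fun τ => f τ l)) ∧
    (∀ (g : Mp2Z) (τ : ℍ), f (g.1.act τ) = g.1.phi τ ^ κ • weilRep D g (f τ)) ∧
    (∀ l, IsBoundedAtImInfty (fun τ => f τ l))}
  zero_mem' := by
    refine ⟨fun l => mdifferentiable_const, fun g τ => by simp, fun l => ?_⟩
    exact Filter.const_boundedAtFilter _ (0 : ℂ)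
  add_mem' := by
    rintro f g ⟨hf1, hf2, hf3⟩ ⟨hg1, hg2, hg3⟩
    refine ⟨fun l => (hf1 l).add (hg1 l), fun x τ => ?_, fun l => (hf3 l).add (hg3 l)⟩
    simp only [Pi.add_apply, hf2, hg2, map_add, smul_add]
  smul_mem' := by
    rintro c f ⟨hf1, hf2, hf3⟩
    refine ⟨fun l => (hf1 l).const_smul c, fun x τ => ?_, fun l => (hf3 l).smul c⟩
    simp only [Pi.smul_apply, hf2, map_smul]
    rw [smul_comm]

/-- The subspace `S_{k,A}` of cusp forms: the modular forms that vanish at the cusp `∞`. -/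
def cuspForms (D : DiscriminantForm A) (κ : ℤ) : Submodule ℂ (ℍ → A → ℂ) where
  carrier := {f | f ∈ modularForms D κ ∧ ∀ l, IsZeroAtImInfty (fun τ => f τ l)}
  zero_mem' := ⟨Submodule.zero_mem _, fun _ => Filter.zero_zeroAtFilter _⟩
  add_mem' := by
    rintro f g ⟨hf1, hf2⟩ ⟨hg1, hg2⟩
    exact ⟨Submodule.add_mem _ hf1 hg1, fun l => (hf2 l).add (hg2 l)⟩
  smul_mem' := by
    rintro c f ⟨hf1, hf2⟩
    exact ⟨Submodule.smul_mem _ c hf1, fun l => (hf2 l).smul c⟩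

/-- The integrand `⟨f(τ), g(τ)⟩ y^k`, `k = κ/2`, of the Petersson scalar product. -/
def peterssonIntegrand (κ : ℤ) (f g : ℍ → A → ℂ) (τ : ℍ) : ℂ :=
  scalarProd (f τ) (g τ) * ((τ.im ^ ((κ : ℝ) / 2) : ℝ) : ℂ)

/-- Convergence of the Petersson scalar product.  The measure on `ℍ` is `dx dy / y²`, and the
quotient by `SL₂(ℤ)` is represented by the standard fundamental domain. -/
def PeterssonConverges (κ : ℤ) (f g : ℍ → A → ℂ) : Prop :=
  IntegrableOn (peterssonIntegrand κ f g) ModularGroup.fd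

/-- The Petersson scalar product `(f, g)` on the full modular group. -/
def peterssonProd (κ : ℤ) (f g : ℍ → A → ℂ) : ℂ :=
  ∫ τ in ModularGroup.fd, peterssonIntegrand κ f g τ

/-! ### The Hecke operators `T(m²)^*` -/

/-- `α = ((m², 0; 0, 1), 1)`. -/
def alpha (m : ℕ+) : MetaGL where
  mat := Matrix.GeneralLinearGroup.mkOfDetNeZero !![(m : ℝ) ^ 2, 0; 0, 1] (by simp)
  det_pos := by simp [Matrix.GeneralLinearGroup.mkOfDetNeZero]
  phi := fun _ => 1
  holo := mdifferentiable_const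
  sq := fun τ => by simp [denom, Matrix.GeneralLinearGroup.mkOfDetNeZero]

/-- The right action `𝔢_λ ∣ α = 𝔢_{mλ}` of `α = ((m², 0; 0, 1), 1)` on `ℂ[A]`. -/
def alphaAct (m : ℕ+) : Module.End ℂ (A → ℂ) :=
  ∑ l : A, (LinearMap.proj l : (A → ℂ) →ₗ[ℂ] ℂ).smulRight (basisVec ((m : ℕ) • l))

/-- The composite `𝔞 ↦ 𝔞 ∣ γ ∣ α ∣ γ'`, where `𝔞 ∣ γ = ρ_A(γ)⁻¹ 𝔞` for `γ` in the integral
metaplectic group. -/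
def tripleAct (D : DiscriminantForm A) (m : ℕ+) (γ γ' : Mp2Z) : Module.End ℂ (A → ℂ) :=
  weilRep D γ'⁻¹ ∘ₗ alphaAct m ∘ₗ weilRep D γ⁻¹

/-- The double coset of `α` with respect to the integral metaplectic group. -/
def doubleCoset (m : ℕ+) : Set MetaGL :=
  {δ | ∃ γ γ' : Mp2Z, δ = γ.1 * alpha m * γ'.1}

open Classical in
/-- The right action on `ℂ[A]` of `δ = γ α γ'` in the double coset of `α`:
`𝔞 ∣ δ = 𝔞 ∣ γ ∣ α ∣ γ'`. -/
def cosetAct (D : DiscriminantForm A) (m : ℕ+) (δ : MetaGL) : Module.End ℂ (A → ℂ) :=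
  if h : ∃ p : Mp2Z × Mp2Z, δ = p.1.1 * alpha m * p.2.1 then
    tripleAct D m h.choose.1 h.choose.2
  else 0

/-- For an endomorphism `L` of `ℂ[A]`, giving the right action of `δ = (M, φ)` on `ℂ[A]`, the
function `∑_λ (f_λ ∣_k δ) ⊗ (𝔢_λ ∣ δ)`, where
`(f_λ ∣_k δ)(τ) = det(M)^{k/2} φ(τ)^{-2k} f_λ(Mτ)` and `k = κ/2`. -/
def slash (κ : ℤ) (δ : MetaGL) (L : Module.End ℂ (A → ℂ)) (f : ℍ → A → ℂ) : ℍ → A → ℂ :=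
  fun τ => ∑ l : A,
    (((δ.det ^ ((κ : ℝ) / 4) : ℝ) : ℂ) * δ.phi τ ^ (-κ) * f (δ.act τ) l) • L (basisVec l)

/-- The set of left cosets of the integral metaplectic group in the double coset of `α`. -/
def leftCosets (m : ℕ+) : Set (Quotient (QuotientGroup.rightRel Mp2Z)) :=
  Quotient.mk (QuotientGroup.rightRel Mp2Z) '' doubleCoset m

/-- The Hecke operator `f ∣ T(m²)^* = m^{k-2} ∑_i ∑_λ (f_λ ∣_k δ_i) ⊗ (𝔢_λ ∣ δ_i)`, `k = κ/2`,
where the `δ_i` represent the left cosets of the integral metaplectic group in the double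
coset of `α`. -/
def hecke (D : DiscriminantForm A) (κ : ℤ) (m : ℕ+) (f : ℍ → A → ℂ) : ℍ → A → ℂ :=
  (((m : ℝ) ^ ((κ : ℝ) / 2 - 2) : ℝ) : ℂ) •
    ∑ᶠ c ∈ leftCosets m, slash κ c.out (cosetAct D m c.out) f

/-- `R` is a finite system of pairs `(γ, γ')` such that the elements `γ α γ'` represent each left
coset of the integral metaplectic group in the double coset of `α` exactly once. -/
def IsCosetSystem (m : ℕ+) (R : Finset (Mp2Z × Mp2Z)) : Prop :=
  ∀ δ ∈ doubleCoset m, ∃! p : Mp2Z × Mp2Z, p ∈ R ∧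
    ∃ γ : Mp2Z, δ = γ.1 * (p.1.1 * alpha m * p.2.1)

end Weil

end WeilHecke

end

open WeilHecke

/-!
The operators `T(m²)^*` are defined by the action of the double coset of `α = ((m², 0; 0, 1), 1)` on
`ℂ[A]`. Everything rests on one identity, `DiscriminantForm.intertwines_of_alphaRel`: if
`γα = αγ'` with `γ, γ'` in the integral metaplectic group, then `𝔢_λ ↦ 𝔢_{mλ}` intertwines `ρ_A(γ)`
and `ρ_A(γ')`, for every `m`, prime to the level or not. It says that `𝔞 ∣ γαγ'` depends only on the
product `γαγ'` (`cosetAct_eq`), and the properties of the operators follow formally from it and from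
the arithmetic of the double cosets.

*The representation.* The integral metaplectic group is presented by `S`, `T` with `S² = (ST)³` and
`S⁸ = 1` (`Mp2Z.exists_hom`, by ping-pong on the two halves of the upper half plane). The relations
hold for the Weil operators because the Gauss sum `G` of `A` satisfies `|G|² = |A|` and `G⁸ = |A|⁴`.
The second equality, which also yields the signature, holds because `-1` is a sum of four squares
modulo `2|A|`, so that quaternion multiplication turns four copies of the form into four copies of
its negative (`gauss_one_pow_eight`).

*The intertwining identity.* Both sides are compatible with orthogonal decompositions, so `A` may be
taken of order a power of a prime `p`. Let `γ = (a, b; c, d)` with `a > 0` prime to `p`. In the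
standard basis on one side and the Fourier basis on the other the matrix coefficients of `ρ_A(γ)`
are `ψ(γ) e(a⁻¹ (b λ²/2 + (μ, λ) - c μ²/2))` (`hasFormula_of_not_dvd`), by descent on `a` along `T`
and `S`. In this form it is visible that passing from `γ` to `γ' = (a, b/m²; m²c, d)` corresponds to
`𝔢_λ ↦ 𝔢_{mλ}`, as soon as `ψ(γ) = ψ(γ')`. For odd `p` the function `ψ` is a quadratic character of
`a` (`psi_of_odd_prime`). For `p = 2` it is made of a character of `a` modulo eight, of the Jacobi
symbol `(b/a)`, which ignores the square `m²`, and of a sign that records the choice of the square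
root `φ` (`psi_of_two`); quadratic reciprocity is what makes it satisfy the recursion. The
restriction on `a` is removed by multiplication with powers of `(1, 0; 1, 1)`.

*Hecke operators.* Left cosets are permuted by right multiplication, which gives the transformation
law, and each of them has an upper triangular representative, which controls the behaviour at the
cusp. For coprime `m`, `n` products of coset representatives are coset representatives for `mn`, and
the actions on `ℂ[A]` multiply (`mul_mem_doubleCoset_mul`).

*Self-adjointness.* For `δ` in the double coset let `δ* = ((m², 0; 0, m²), m) δ⁻¹`, again in the
double coset since `((m², 0; 0, m²), m) = S α S⁻¹ α`. The terms of the Hecke operator for `δ` and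
`δ*` are adjoint to each other pointwise (`peterssonIntegrand_heckeTerm`). Unfolding, four times the
sum over left cosets of integrals over the fundamental domain becomes a sum over the whole double coset
of integrals over the part of the fundamental domain that `δ` maps into the fundamental domain
(`hasSum_doubleCoset`), and there the substitution `τ ↦ δτ` interchanges `δ` and `δ*`. Convergence
follows from the exponential decay of cusp forms and the finite volume of the fundamental domain.
-/

noncomputable section

namespace WeilHecke

/-! ### The character `e` of `ℚ/ℤ` -/

theorem e_coe (r : ℚ) :
    e (r : AddCircle (1 : ℚ)) = Complex.exp (2 * Real.pi * Complex.I * (r : ℂ)) :=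
  rfl

@[simp] theorem e_zero : e 0 = 1 := by
  have := e_coe 0
  simpa using this

theorem e_add (x y : AddCircle (1 : ℚ)) : e (x + y) = e x * e y := by
  induction x using QuotientAddGroup.induction_on with | H x
  induction y using QuotientAddGroup.induction_on with | H y
  have h : ((x : AddCircle (1 : ℚ)) + (y : AddCircle (1 : ℚ))) =
      ((x + y : ℚ) : AddCircle (1 : ℚ)) :=
    rfl
  erw [h, e_coe, e_coe, e_coe]
  rw [← Complex.exp_add]
  push_cast
  ring_nf

theorem e_neg (x : AddCircle (1 : ℚ)) : e (-x) = (e x)⁻¹ := by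
  have := e_add x (-x)
  rw [add_neg_cancel, e_zero] at this
  exact (inv_eq_of_mul_eq_one_right this.symm).symm

theorem norm_e (x : AddCircle (1 : ℚ)) : ‖e x‖ = 1 := by
  induction x using QuotientAddGroup.induction_on with | H x
  erw [e_coe]
  rw [Complex.norm_exp]
  simp

theorem conj_e (x : AddCircle (1 : ℚ)) : conj (e x) = e (-x) := by
  rw [e_neg, ← Complex.inv_eq_conj (norm_e x)]

theorem e_eq_one_iff (x : AddCircle (1 : ℚ)) : e x = 1 ↔ x = 0 := by
  refine ⟨fun h => ?_, fun h => by rw [h, e_zero]⟩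
  induction x using QuotientAddGroup.induction_on with | H x
  erw [e_coe, Complex.exp_eq_one_iff] at h
  obtain ⟨n, hn⟩ := h
  have h2 : (x : ℂ) = n := by
    have : (2 * Real.pi * Complex.I : ℂ) ≠ 0 := Complex.two_pi_I_ne_zero
    rw [mul_comm] at hn
    exact mul_right_cancel₀ this hn
  have h3 : x = n := by exact_mod_cast h2
  rw [h3]
  refine (QuotientAddGroup.eq_zero_iff _).mpr ?_
  exact AddSubgroup.mem_zmultiples_iff.mpr ⟨n, by simp⟩

variable {A : Type*} [AddCommGroup A]

set_option linter.unusedSectionVars false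

/-! ### Gauss sums of discriminant forms -/

namespace DiscriminantForm

/-- The bilinear form `(x, y)` of a discriminant form. -/
def bil (D : DiscriminantForm A) (x y : A) : AddCircle (1 : ℚ) := QuadraticMap.polar D.q x y

variable (D : DiscriminantForm A)

theorem bil_comm (x y : A) : D.bil x y = D.bil y x := QuadraticMap.polar_comm _ _ _

theorem bil_add_left (x y z : A) : D.bil (x + y) z = D.bil x z + D.bil y z :=
  QuadraticMap.polar_add_left _ _ _ _

theorem bil_add_right (x y z : A) : D.bil x (y + z) = D.bil x y + D.bil x z :=
  QuadraticMap.polar_add_right _ _ _ _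

theorem bil_zsmul_left (k : ℤ) (x y : A) : D.bil (k • x) y = k • D.bil x y :=
  QuadraticMap.polar_smul_left _ _ _ _

theorem bil_zsmul_right (k : ℤ) (x y : A) : D.bil x (k • y) = k • D.bil x y :=
  QuadraticMap.polar_smul_right _ _ _ _

@[simp] theorem bil_zero_left (x : A) : D.bil 0 x = 0 := QuadraticMap.polar_zero_left _ _

@[simp] theorem bil_zero_right (x : A) : D.bil x 0 = 0 := QuadraticMap.polar_zero_right _ _

theorem bil_neg_left (x y : A) : D.bil (-x) y = -D.bil x y := QuadraticMap.polar_neg_left _ _ _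

theorem bil_neg_right (x y : A) : D.bil x (-y) = -D.bil x y := QuadraticMap.polar_neg_right _ _ _

theorem q_add (x y : A) : D.q (x + y) = D.q x + D.q y + D.bil x y := by
  simp [bil, QuadraticMap.polar]

theorem q_zsmul (k : ℤ) (x : A) : D.q (k • x) = (k * k) • D.q x := QuadraticMap.map_smul _ _ _

theorem q_neg (x : A) : D.q (-x) = D.q x := QuadraticMap.map_neg _ _

@[simp] theorem q_zero : D.q 0 = 0 := QuadraticMap.map_zero _

theorem bil_self (x : A) : D.bil x x = (2 : ℤ) • D.q x := by
  exact QuadraticMap.polar_self D.q x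

variable [Fintype A]

theorem card_zsmul (x : A) : (Fintype.card A : ℤ) • x = 0 := by
  rw [natCast_zsmul]; exact card_nsmul_eq_zero

theorem card_zsmul_bil (x y : A) : (Fintype.card A : ℤ) • D.bil x y = 0 := by
  rw [← bil_zsmul_left, card_zsmul, bil_zero_left]

theorem two_card_zsmul_q (x : A) : (2 * Fintype.card A : ℤ) • D.q x = 0 := by
  rw [mul_comm, mul_smul, ← bil_self, card_zsmul_bil]

/-- Orthogonality of the characters `μ ↦ e((x, μ))`. -/
theorem sum_e_bil [DecidableEq A] (x : A) :
    ∑ m : A, e (D.bil x m) = if x = 0 then (Fintype.card A : ℂ) else 0 := by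
  split_ifs with h
  · simp [h]
  · let χ : AddChar A ℂ :=
      { toFun := fun m => e (D.bil x m)
        map_zero_eq_one' := by simp
        map_add_eq_mul' := fun a b => by rw [bil_add_right, e_add] }
    refine AddChar.sum_eq_zero_of_ne_one (ψ := χ) fun hχ => h (D.nondegenerate x fun y => ?_)
    rw [← e_eq_one_iff]
    exact DFunLike.congr_fun hχ y

/-- The Gauss sum `∑_λ e(x λ²/2)` of the form scaled by the integer `x`. -/
def gauss (x : ℤ) : ℂ := ∑ l : A, e (x • D.q l)

theorem gauss_neg (x : ℤ) : D.gauss (-x) = conj (D.gauss x) := by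
  simp [gauss, conj_e, map_sum]

theorem zsmul_bil_of_zsmul_q {k : ℤ} (h : ∀ l : A, k • D.q l = D.q l) (a b : A) :
    k • D.bil a b = D.bil a b := by
  simp only [bil, QuadraticMap.polar, smul_sub, h]

/-- Completing the square in a Gauss sum. The integer `y` is inverse to `x` as far as the values of
the quadratic form are concerned. -/
theorem sum_e_complete_square (x y : ℤ) (h : ∀ l : A, (x * y) • D.q l = D.q l) (v : A) :
    ∑ k : A, e (x • D.q k + D.bil v k) = e (-(y • D.q v)) * D.gauss x := by
  have hb (a b : A) : x • y • D.bil a b = D.bil a b := by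
    rw [← mul_smul, D.zsmul_bil_of_zsmul_q h]
  rw [gauss, Finset.mul_sum, ← Equiv.sum_comp (Equiv.addRight (-(y • v)))]
  refine Finset.sum_congr rfl fun k _ => ?_
  rw [← e_add]
  congr 1
  have h2 : x • (y * y) • D.q v = y • D.q v := by
    rw [← mul_smul, ← mul_assoc, mul_comm, mul_smul, h]
  simp only [Equiv.coe_addRight, q_add, q_neg, q_zsmul, smul_add, bil_neg_right, bil_zsmul_right,
    bil_add_right, h2, bil_self, smul_neg, D.bil_comm k v, hb]
  rw [smul_comm y (2 : ℤ), two_zsmul]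
  abel

theorem gauss_mul_conj_one : D.gauss 1 * conj (D.gauss 1) = Fintype.card A := by
  classical
  rw [← gauss_neg, gauss, gauss, Finset.sum_mul_sum, Finset.sum_comm]
  have (j : A) : ∑ i : A, e ((1 : ℤ) • D.q i) * e ((-1 : ℤ) • D.q j) =
      ∑ i : A, e (D.q i) * e (D.bil i j) := by
    rw [← Equiv.sum_comp (Equiv.addRight j)]
    refine Finset.sum_congr rfl fun i _ => ?_
    rw [← e_add, ← e_add]
    congr 1
    simp only [Equiv.coe_addRight, q_add, one_zsmul]
    abel
  simp_rw [this]
  rw [Finset.sum_comm]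
  simp_rw [← Finset.mul_sum, sum_e_bil]
  simp

/-- The fourth power of a Gauss sum as a sum over quadruples. -/
theorem gauss_pow_four (x : ℤ) : D.gauss x ^ 4 =
    ∑ v : A × A × A × A, e (x • (D.q v.1 + D.q v.2.1 + D.q v.2.2.1 + D.q v.2.2.2)) := by
  simp only [Fintype.sum_prod_type, smul_add, e_add, ← Finset.mul_sum, ← Finset.sum_mul]
  simp only [gauss]
  ring

/-- The quaternion `a + bi + cj + dk` acting by left multiplication on quadruples. -/
def quatAct (a b c d : ℤ) (v : A × A × A × A) : A × A × A × A :=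
  (a • v.1 - b • v.2.1 - c • v.2.2.1 - d • v.2.2.2,
   b • v.1 + a • v.2.1 - d • v.2.2.1 + c • v.2.2.2,
   c • v.1 + d • v.2.1 + a • v.2.2.1 - b • v.2.2.2,
   d • v.1 - c • v.2.1 + b • v.2.2.1 + a • v.2.2.2)

theorem quatAct_conj (a b c d : ℤ) (v : A × A × A × A) :
    quatAct a (-b) (-c) (-d) (quatAct a b c d v) = (a ^ 2 + b ^ 2 + c ^ 2 + d ^ 2) • v := by
  obtain ⟨x, y, z, w⟩ := v
  simp only [quatAct, Prod.smul_mk]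
  ext <;> simp only [] <;> module

theorem q_quatAct (a b c d : ℤ) (v : A × A × A × A) :
    D.q (quatAct a b c d v).1 + D.q (quatAct a b c d v).2.1 + D.q (quatAct a b c d v).2.2.1 +
      D.q (quatAct a b c d v).2.2.2 =
    (a ^ 2 + b ^ 2 + c ^ 2 + d ^ 2) • (D.q v.1 + D.q v.2.1 + D.q v.2.2.1 + D.q v.2.2.2) := by
  obtain ⟨x, y, z, w⟩ := v
  simp only [quatAct, sub_eq_add_neg, q_add, q_neg, q_zsmul, bil_add_left, bil_neg_right,
    bil_zsmul_left, bil_zsmul_right, bil_neg_left]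
  module

/-- `G⁸ = |A|⁴`. As `-1` is a sum of four squares modulo `2|A|`, quaternion multiplication
identifies four copies of the form with four copies of its negative, so that `G⁴` is real. -/
theorem gauss_one_pow_eight : D.gauss 1 ^ 8 = (Fintype.card A : ℂ) ^ 4 := by
  have hn : 0 < Fintype.card A := Fintype.card_pos
  obtain ⟨a, b, c, d, h⟩ := Nat.sum_four_squares (2 * Fintype.card A - 1)
  have hz : (a : ℤ) ^ 2 + (b : ℤ) ^ 2 + (c : ℤ) ^ 2 + (d : ℤ) ^ 2 = 2 * Fintype.card A - 1 := by
    have : 1 ≤ 2 * Fintype.card A := by omega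
    zify [this] at h
    exact h
  have hinj : Function.Injective (quatAct (A := A) (a : ℤ) b c d) := by
    intro v w hvw
    have := congrArg (quatAct (a : ℤ) (-b) (-c) (-d)) hvw
    have hc (v : A × A × A × A) : (2 * (Fintype.card A : ℤ)) • v = 0 := by
      obtain ⟨x, y, z, w⟩ := v
      simp [mul_smul]
    rw [quatAct_conj, quatAct_conj, hz, sub_smul, sub_smul, hc, hc] at this
    simpa using this
  have hbij := Finite.injective_iff_bijective.mp hinj
  have h4 : D.gauss 1 ^ 4 = conj (D.gauss 1) ^ 4 := by
    rw [← gauss_neg, gauss_pow_four, gauss_pow_four, ← (Equiv.ofBijective _ hbij).sum_comp]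
    refine Finset.sum_congr rfl fun v _ => ?_
    congr 1
    simp only [Equiv.ofBijective_apply, q_quatAct, hz, sub_smul, one_smul, _root_.neg_smul]
    simp [smul_add, two_card_zsmul_q, -neg_add_rev]
  calc D.gauss 1 ^ 8 = D.gauss 1 ^ 4 * D.gauss 1 ^ 4 := by ring
    _ = (D.gauss 1 * conj (D.gauss 1)) ^ 4 := by nth_rewrite 2 [h4]; ring
    _ = _ := by rw [gauss_mul_conj_one]

/-- If `u² + v²` is prime to `|A|` then two copies of the form are isometric to two copies of the
form scaled by `u² + v²`. -/
theorem gauss_sq_of_sum_two_squares (u v : ℤ)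
    (h : IsCoprime (u ^ 2 + v ^ 2) (Fintype.card A : ℤ)) :
    D.gauss (u ^ 2 + v ^ 2) ^ 2 = D.gauss 1 ^ 2 := by
  have key (x : ℤ) : D.gauss x ^ 2 = ∑ w : A × A, e (x • (D.q w.1 + D.q w.2)) := by
    simp only [Fintype.sum_prod_type, smul_add, e_add, ← Finset.mul_sum, ← Finset.sum_mul]
    simp only [gauss]
    ring
  let F : A × A → A × A := fun w => (u • w.1 - v • w.2, v • w.1 + u • w.2)
  have hinj : Function.Injective F := by
    rintro ⟨x, y⟩ ⟨x', y'⟩ hw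
    obtain ⟨r, s, hrs⟩ := h
    have cancel (z : A) : r • (u ^ 2 + v ^ 2) • z = z := by
      have h1 : (r * (u ^ 2 + v ^ 2) + s * (Fintype.card A : ℤ)) • z = z := by rw [hrs, one_smul]
      rwa [add_smul, mul_smul s, card_zsmul, smul_zero, add_zero, mul_smul] at h1
    have h1 : u • x - v • y = u • x' - v • y' := congrArg Prod.fst hw
    have h2 : v • x + u • y = v • x' + u • y' := congrArg Prod.snd hw
    have h3 : (u ^ 2 + v ^ 2) • x = (u ^ 2 + v ^ 2) • x' := by
      have : u • (u • x - v • y) + v • (v • x + u • y) =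
        u • (u • x' - v • y') + v • (v • x' + u • y') := by rw [h1, h2]
      convert this using 1 <;> module
    have h4 : (u ^ 2 + v ^ 2) • y = (u ^ 2 + v ^ 2) • y' := by
      have : u • (v • x + u • y) - v • (u • x - v • y) =
        u • (v • x' + u • y') - v • (u • x' - v • y') := by rw [h1, h2]
      convert this using 1 <;> module
    rw [← cancel x, ← cancel y, h3, h4, cancel, cancel]
  rw [key, key, eq_comm, ← (Equiv.ofBijective F (Finite.injective_iff_bijective.mp hinj)).sum_comp]
  refine Finset.sum_congr rfl fun w _ => ?_
  congr 1
  simp only [Equiv.ofBijective_apply, F, sub_eq_add_neg, q_add, q_neg, q_zsmul,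
    bil_neg_right, bil_zsmul_left, bil_zsmul_right]
  module

/-- Milgram's formula has a solution. -/
theorem isSignature_sig : IsSignature D (sig D) := by
  refine Classical.epsilon_spec (p := IsSignature D) ?_
  have hn : (0 : ℝ) < Fintype.card A := by exact_mod_cast Fintype.card_pos
  have hs : (Real.sqrt (Fintype.card A) : ℂ) ≠ 0 := by
    exact_mod_cast (Real.sqrt_pos.mpr hn).ne'
  have hs8 : (Real.sqrt (Fintype.card A) : ℂ) ^ 8 = (Fintype.card A : ℂ) ^ 4 := by
    have : Real.sqrt (Fintype.card A) ^ 2 = Fintype.card A := Real.sq_sqrt hn.le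
    have h2 : (Real.sqrt (Fintype.card A) : ℂ) ^ 2 = Fintype.card A := by exact_mod_cast this
    rw [← h2]; ring
  have h8 : (D.gauss 1 / (Real.sqrt (Fintype.card A) : ℂ)) ^ 8 = 1 := by
    rw [div_pow, gauss_one_pow_eight, hs8, div_self]
    rw [← hs8]
    exact pow_ne_zero _ hs
  obtain ⟨i, hi, h⟩ := (Complex.isPrimitiveRoot_exp 8 (by norm_num)).eq_pow_of_pow_eq_one h8
  refine ⟨(i : ZMod 8), ?_⟩
  have hval : ((i : ZMod 8).val : ℂ) = i := by rw [ZMod.val_natCast_of_lt hi]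
  rw [IsSignature, hval]
  have hG : D.gauss 1 = ∑ l : A, e (D.q l) := by simp [gauss]
  rw [← hG, eq_comm]
  rw [eq_div_iff hs] at h
  rw [← h, mul_comm, ← Complex.exp_nat_mul]
  congr 2
  push_cast
  ring

theorem sum_e_q_eq_gauss : ∑ l : A, e (D.q l) = D.gauss 1 := by simp [gauss]

/-- The scalar in the action of `S` is `conj G / |A|`. -/
theorem weil_scalar_eq :
    Complex.exp (2 * Real.pi * Complex.I * (-((sig D).val : ℂ) / 8)) /
      (Real.sqrt (Fintype.card A) : ℂ) = conj (D.gauss 1) / Fintype.card A := by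
  have h := D.isSignature_sig
  have hn : (0 : ℝ) < Fintype.card A := by exact_mod_cast Fintype.card_pos
  have hs : (Real.sqrt (Fintype.card A) : ℂ) ≠ 0 := by
    exact_mod_cast (Real.sqrt_pos.mpr hn).ne'
  have h2 : (Fintype.card A : ℂ) = (Real.sqrt (Fintype.card A) : ℂ) *
      (Real.sqrt (Fintype.card A) : ℂ) := by
    exact_mod_cast (Real.mul_self_sqrt hn.le).symm
  rw [IsSignature, sum_e_q_eq_gauss] at h
  rw [h, map_mul, Complex.conj_ofReal, ← Complex.exp_conj, h2, mul_div_mul_left _ _ hs]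
  generalize (sig D).val = k
  congr 2
  simp only [map_mul, map_ofNat, Complex.conj_ofReal, Complex.conj_I, map_div₀, map_natCast]
  ring

end DiscriminantForm

/-! ### A ping-pong criterion -/

section PingPong
open scoped Pointwise Function

/-- A homomorphism from a group generated by an element of order two and one of order three is
injective as soon as the two images play ping-pong. -/
theorem injective_of_ping_pong {Q G α : Type*} [Group Q] [Group G] [MulAction G α] (π : Q →* G)
    (x u : Q) (hx : x ^ 2 = 1) (hu : u ^ 3 = 1) (hgen : Subgroup.closure {x, u} = ⊤)
    (X Y : Set α) (hX : X.Nonempty) (hY : Y.Nonempty) (hXY : Disjoint X Y)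
    (h1 : ∀ a ∈ Y, π x • a ∈ X) (h2 : ∀ a ∈ X, π u • a ∈ Y) (h3 : ∀ a ∈ X, π u⁻¹ • a ∈ Y) :
    Function.Injective π := by
  let g : Bool → Q := fun b => if b then x else u
  let H : Bool → Type _ := fun b => Subgroup.zpowers (g b)
  let ι : ∀ b, H b →* Q := fun b => (Subgroup.zpowers (g b)).subtype
  let f : ∀ b, H b →* G := fun b => π.comp (ι b)
  have hu1 : u ≠ 1 := by
    rintro rfl
    obtain ⟨a, ha⟩ := hX
    have := h2 a ha
    rw [map_one, one_smul] at this
    exact hXY.le_bot ⟨ha, this⟩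
  have huu : u⁻¹ ≠ 1 := inv_ne_one.mpr hu1
  have huinv : u ≠ u⁻¹ := by
    intro h
    have h4 : u * u = 1 := by nth_rewrite 2 [h]; exact mul_inv_cancel u
    exact hu1 (by rw [pow_succ, pow_two, h4, one_mul] at hu; exact hu)
  have hmemx (y : Q) (hy : y ∈ Subgroup.zpowers x) : y = 1 ∨ y = x := by
    obtain ⟨k, rfl⟩ := Subgroup.mem_zpowers_iff.mp hy
    rcases Int.even_or_odd' k with ⟨j, rfl | rfl⟩
    · left; rw [zpow_mul]; simp [hx]
    · right; rw [zpow_add, zpow_mul]; simp [hx]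
  have hmemu (y : Q) (hy : y ∈ Subgroup.zpowers u) : y = 1 ∨ y = u ∨ y = u⁻¹ := by
    obtain ⟨k, rfl⟩ := Subgroup.mem_zpowers_iff.mp hy
    have h3' : u ^ (3 : ℤ) = 1 := by exact_mod_cast hu
    have h5 : u ^ k = u ^ (k % 3) := by
      conv_lhs => rw [← Int.emod_add_mul_ediv k 3, zpow_add, zpow_mul, h3', one_zpow, mul_one]
    have h6 : k % 3 = 0 ∨ k % 3 = 1 ∨ k % 3 = 2 := by omega
    rw [h5]
    rcases h6 with h | h | h <;> rw [h]
    · simp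
    · simp
    · right; right
      rw [eq_inv_iff_mul_eq_one]
      exact_mod_cast (pow_succ u 2).symm.trans hu
  have hcard : 3 ≤ Cardinal.mk (H false) := by
    have hi : Function.Injective (![⟨1, one_mem _⟩, ⟨u, Subgroup.mem_zpowers u⟩,
        ⟨u⁻¹, inv_mem (Subgroup.mem_zpowers u)⟩] : Fin 3 → Subgroup.zpowers u) := by
      intro i j h
      have h' := congrArg Subtype.val h
      fin_cases i <;> fin_cases j <;> simp_all [eq_comm]
    simpa using! Cardinal.lift_mk_le_lift_mk_of_injective hi
  have hinj : Function.Injective (Monoid.CoprodI.lift f) := by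
    refine Monoid.CoprodI.lift_injective_of_ping_pong f (Or.inr ⟨false, hcard⟩)
      (fun b => if b then X else Y) ?_ ?_ ?_
    · rintro (_ | _)
      · simpa using hY
      · simpa using hX
    · rintro (_ | _) (_ | _) h
      · exact absurd rfl h
      · simpa [Function.onFun] using hXY.symm
      · simpa [Function.onFun] using hXY
      · exact absurd rfl h
    · rintro (_ | _) (_ | _) h
      · exact absurd rfl h
      · rintro ⟨y, hy⟩ hne
        rintro _ ⟨a, ha, rfl⟩
        rcases hmemu y hy with rfl | rfl | rfl
        · exact absurd rfl hne
        · simpa using! h2 a (by simpa using ha)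
        · exact h3 a (by simpa using ha)
      · rintro ⟨y, hy⟩ hne
        rintro _ ⟨a, ha, rfl⟩
        rcases hmemx y hy with rfl | rfl
        · exact absurd rfl hne
        · simpa using! h1 a (by simpa using ha)
      · exact absurd rfl h
  have hcomp : Monoid.CoprodI.lift f = π.comp (Monoid.CoprodI.lift ι) := by
    ext b y
    simp [f]
  have hsurj : Function.Surjective (Monoid.CoprodI.lift ι) := by
    rw [← MonoidHom.range_eq_top, ← top_le_iff, ← hgen, Subgroup.closure_le]
    rintro y (rfl | rfl)
    · exact ⟨Monoid.CoprodI.of (i := true) ⟨y, Subgroup.mem_zpowers y⟩, by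
        simp only [Monoid.CoprodI.lift_of]; rfl⟩
    · exact ⟨Monoid.CoprodI.of (i := false) ⟨y, Subgroup.mem_zpowers y⟩, by
        simp only [Monoid.CoprodI.lift_of]; rfl⟩
  rw [hcomp] at hinj
  intro a b hab
  obtain ⟨a, rfl⟩ := hsurj a
  obtain ⟨b, rfl⟩ := hsurj b
  rw [hinj hab]

end PingPong

/-! ### The principal square root on the upper half plane -/

/-- The principal branch of the square root. -/
def csqrt (z : ℂ) : ℂ := z ^ (1 / 2 : ℂ)

theorem csqrt_sq (z : ℂ) : csqrt z ^ 2 = z := by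
  rw [csqrt, one_div]
  exact Complex.cpow_nat_inv_pow z (n := 2) two_ne_zero

theorem csqrt_eq {z : ℂ} (hz : z ≠ 0) : csqrt z =
    ((‖z‖ ^ (1 / 2 : ℝ) : ℝ) : ℂ) *
      (Complex.cos (z.arg / 2) + Complex.sin (z.arg / 2) * Complex.I) := by
  rw [csqrt, Complex.cpow_def_of_ne_zero hz, Complex.log,
    Real.rpow_def_of_pos (norm_pos_iff.mpr hz),
    ← Complex.exp_mul_I, Complex.ofReal_exp, ← Complex.exp_add]
  congr 1
  push_cast
  ring

theorem csqrt_re_pos {z : ℂ} (hz : 0 < z.im) : 0 < (csqrt z).re := by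
  have hz0 : z ≠ 0 := by rintro rfl; simp at hz
  have h1 := Complex.arg_nonneg_iff.mpr hz.le
  have h2 := Complex.arg_le_pi z
  have h3 : z.arg < Real.pi := by
    refine lt_of_le_of_ne h2 fun h => ?_
    exact hz.ne' (Complex.arg_eq_pi_iff.mp h).2
  rw [csqrt_eq hz0, Complex.re_ofReal_mul]
  have h4 : (z.arg / 2 : ℂ) = ((z.arg / 2 : ℝ) : ℂ) := by push_cast; rfl
  rw [h4, ← Complex.ofReal_cos, ← Complex.ofReal_sin]
  have : 0 < Real.cos (z.arg / 2) :=
    Real.cos_pos_of_mem_Ioo ⟨by linarith [Real.pi_pos], by linarith⟩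
  simp only [Complex.add_re, Complex.ofReal_re, Complex.mul_re, Complex.I_re, Complex.I_im,
    Complex.ofReal_im]
  have := Real.rpow_pos_of_pos (norm_pos_iff.mpr hz0) (1 / 2 : ℝ)
  simp
  positivity

theorem csqrt_im_pos {z : ℂ} (hz : 0 < z.im) : 0 < (csqrt z).im := by
  have h := csqrt_re_pos hz
  have h2 := congrArg Complex.im (csqrt_sq z)
  rw [pow_two, Complex.mul_im] at h2
  by_contra hneg
  nlinarith

/-- A complex number in the first quadrant is the principal square root of its square. -/
theorem eq_csqrt_of_sq_eq {w z : ℂ} (hz : 0 < z.im) (hw : w ^ 2 = z) (h : 0 < w.im ∨ 0 < w.re) :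
    w = csqrt z := by
  rcases sq_eq_sq_iff_eq_or_eq_neg.mp (hw.trans (csqrt_sq z).symm) with h1 | h1
  · exact h1
  · have h2 := csqrt_re_pos hz
    have h3 := csqrt_im_pos hz
    rw [h1] at h
    simp only [Complex.neg_im, Complex.neg_re] at h
    rcases h with h | h <;> linarith

theorem csqrt_mul {z w : ℂ} (hz : 0 < z.im) (hw : 0 < w.im) (hzw : 0 < (z * w).im) :
    csqrt z * csqrt w = csqrt (z * w) := by
  refine eq_csqrt_of_sq_eq hzw (by rw [mul_pow, csqrt_sq, csqrt_sq]) (Or.inl ?_)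
  rw [Complex.mul_im]
  have := csqrt_re_pos hz
  have := csqrt_re_pos hw
  have := csqrt_im_pos hz
  have := csqrt_im_pos hw
  positivity

/-! ### The structure of the integral metaplectic group -/

namespace MetaGL

/-- The action of the metaplectic group on the upper half plane as a permutation representation. -/
def toPerm : MetaGL →* Equiv.Perm ℍ := (MulAction.toPermHom (GL (Fin 2) ℝ) ℍ).comp proj

@[simp] theorem one_act (τ : ℍ) : (1 : MetaGL).act τ = τ := one_smul _ τ

theorem mul_act (g h : MetaGL) (τ : ℍ) : (g * h).act τ = g.act (h.act τ) := mul_smul _ _ τ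

theorem mul_phi_act (g h : MetaGL) (τ : ℍ) : (g * h).phi τ = g.phi (h.act τ) * h.phi τ := rfl

@[simp] theorem inv_act_act (g : MetaGL) (τ : ℍ) : g⁻¹.act (g.act τ) = τ := by
  rw [← mul_act, inv_mul_cancel, one_act]

@[simp] theorem act_inv_act (g : MetaGL) (τ : ℍ) : g.act (g⁻¹.act τ) = τ := by
  rw [← mul_act, mul_inv_cancel, one_act]

/-- Two lifts of a matrix agree up to a sign. -/
theorem phi_eq_or_eq_neg {g h : MetaGL} (hm : g.mat = h.mat) : g.phi = h.phi ∨ g.phi = -h.phi := by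
  have hg : Continuous g.phi := g.holo.continuous
  have hh : Continuous h.phi := h.holo.continuous
  have hc : IsPreconnected (Set.univ : Set ℍ) := isPreconnected_univ
  rcases hc.eq_or_eq_neg_of_sq_eq hg.continuousOn hh.continuousOn
    (fun τ _ => by simp only [Pi.pow_apply, g.sq, h.sq, hm])
    (fun {τ} _ => h.phi_ne_zero τ) with h1 | h1
  · exact Or.inl (funext fun τ => h1 (Set.mem_univ τ))
  · exact Or.inr (funext fun τ => h1 (Set.mem_univ τ))

/-- Two lifts of a matrix agree if they agree at one point. -/
theorem ext_of_phi_eq {g h : MetaGL} (hm : g.mat = h.mat) (τ : ℍ)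
    (hτ : g.phi τ = h.phi τ) : g = h := by
  ext1
  · exact hm
  · rcases phi_eq_or_eq_neg hm with h1 | h1
    · exact h1
    · have h2 := congrFun h1 τ
      rw [Pi.neg_apply, hτ] at h2
      exact absurd (self_eq_neg.mp h2) (h.phi_ne_zero τ)

end MetaGL

namespace Mp2Z
open Matrix.SpecialLinearGroup

/-- The projection of the integral metaplectic group to `SL₂(ℤ)`. -/
def sl : Mp2Z →* SL(2, ℤ) where
  toFun g := (show ∃ M : SL(2, ℤ), mapGL ℝ M = MetaGL.proj g.1 from g.2).choose
  map_one' := by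
    apply mapGL_injective (R := ℤ) (S := ℝ)
    rw [Exists.choose_spec (p := fun M : SL(2, ℤ) => mapGL ℝ M = MetaGL.proj (1 : Mp2Z).1), map_one]
    rfl
  map_mul' g h := by
    apply mapGL_injective (R := ℤ) (S := ℝ)
    rw [map_mul]
    rw [Exists.choose_spec (p := fun M : SL(2, ℤ) => mapGL ℝ M = MetaGL.proj (g * h : Mp2Z).1),
      Exists.choose_spec (p := fun M : SL(2, ℤ) => mapGL ℝ M = MetaGL.proj (g : Mp2Z).1),
      Exists.choose_spec (p := fun M : SL(2, ℤ) => mapGL ℝ M = MetaGL.proj (h : Mp2Z).1)]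
    rfl

theorem mapGL_sl (g : Mp2Z) : mapGL ℝ (sl g) = g.1.mat :=
  (show ∃ M : SL(2, ℤ), mapGL ℝ M = MetaGL.proj g.1 from g.2).choose_spec

theorem sl_eq {g : Mp2Z} {M : SL(2, ℤ)} (h : mapGL ℝ M = g.1.mat) : sl g = M :=
  mapGL_injective (R := ℤ) (S := ℝ) ((mapGL_sl g).trans h.symm)

theorem act_eq (g : Mp2Z) (τ : ℍ) : g.1.act τ = sl g • τ := by
  rw [MetaGL.act, ← mapGL_sl]; rfl

@[simp] theorem sl_mpT : sl mpT = ModularGroup.T := sl_eq rfl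

@[simp] theorem sl_mpS : sl mpS = ModularGroup.S := sl_eq rfl

theorem mpS_phi (τ : ℍ) : mpS.1.phi τ = csqrt τ := rfl

theorem mpT_phi (τ : ℍ) : mpT.1.phi τ = 1 := rfl

theorem phi_sq (g : Mp2Z) (τ : ℍ) : g.1.phi τ ^ 2 = (sl g 1 0 : ℂ) * τ + (sl g 1 1 : ℂ) := by
  rw [g.1.sq, ← mapGL_sl, denom]
  simp [mapGL_coe_matrix]

theorem eq_of_phi_eq {g h : Mp2Z} (hm : sl g = sl h) (τ : ℍ) (hτ : g.1.phi τ = h.1.phi τ) : g = h :=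
  Subtype.ext (MetaGL.ext_of_phi_eq (by rw [← mapGL_sl, ← mapGL_sl, hm]) τ hτ)

theorem act_of_sl_eq_neg_one {g : Mp2Z} (h : sl g = -1) (τ : ℍ) : g.1.act τ = τ := by
  have hm : g.1.mat = -1 := by
    rw [← mapGL_sl, h]
    ext i j
    simp [mapGL_coe_matrix]
  rw [MetaGL.act, hm, UpperHalfPlane.neg_smul, one_smul]

theorem S_mul_S : ModularGroup.S * ModularGroup.S = -1 := by
  decide

/-- The element `Z = S²` of order four, which lies over `-1`. -/
def mpZ : Mp2Z := mpS ^ 2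

@[simp] theorem sl_mpZ : sl mpZ = -1 := by
  rw [mpZ, map_pow, sl_mpS, pow_two, S_mul_S]

theorem mpZ_act (τ : ℍ) : mpZ.1.act τ = τ := act_of_sl_eq_neg_one sl_mpZ τ

theorem mpZ_sq_phi (τ : ℍ) : (mpZ ^ 2).1.phi τ = -1 := by
  have h : (mpZ ^ 2).1.phi τ = mpZ.1.phi (mpZ.1.act τ) * mpZ.1.phi τ := by
    rw [pow_two]; rfl
  rw [h, mpZ_act, ← pow_two, phi_sq, sl_mpZ]
  simp

theorem sl_mpZ_sq : sl (mpZ ^ 2) = 1 := by rw [map_pow, sl_mpZ]; simp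

theorem mpZ_sq_ne_one : mpZ ^ 2 ≠ 1 := by
  intro h
  have := mpZ_sq_phi UpperHalfPlane.I
  rw [h] at this
  change (1 : ℂ) = -1 at this
  norm_num at this

theorem mpZ_pow_four : mpZ ^ 4 = 1 := by
  refine eq_of_phi_eq ?_ UpperHalfPlane.I ?_
  · rw [map_pow, sl_mpZ, map_one]; decide
  · have : (mpZ ^ 4) = mpZ ^ 2 * mpZ ^ 2 := by rw [← pow_add]
    rw [this]
    change (mpZ ^ 2).1.phi _ * (mpZ ^ 2).1.phi _ = 1
    rw [mpZ_sq_phi, mpZ_sq_phi]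
    norm_num

theorem eq_one_or_of_sl_eq_one {g : Mp2Z} (h : sl g = 1) : g = 1 ∨ g = mpZ ^ 2 := by
  have h1 : g.1.phi UpperHalfPlane.I ^ 2 = 1 := by rw [phi_sq, h]; simp
  rcases sq_eq_one_iff.mp h1 with h2 | h2
  · exact Or.inl (eq_of_phi_eq (by rw [h, map_one]) UpperHalfPlane.I h2)
  · exact Or.inr (eq_of_phi_eq (by rw [h, sl_mpZ_sq]) UpperHalfPlane.I (by rw [h2, mpZ_sq_phi]))

theorem closure_mpS_mpT : Subgroup.closure {mpS, mpT} = ⊤ := by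
  rw [eq_top_iff]
  rintro g -
  have h : sl g ∈ (Subgroup.closure {mpS, mpT}).map sl := by
    rw [MonoidHom.map_closure, Set.image_pair, sl_mpS, sl_mpT,
      SpecialLinearGroup.SL2Z_generators]
    trivial
  obtain ⟨k, hk, hkg⟩ := h
  have hS : mpS ∈ Subgroup.closure {mpS, mpT} := Subgroup.subset_closure (by simp)
  have h1 : sl (g * k⁻¹) = 1 := by rw [map_mul, map_inv, hkg, mul_inv_cancel]
  have h2 : g * k⁻¹ ∈ Subgroup.closure {mpS, mpT} := by
    rcases eq_one_or_of_sl_eq_one h1 with h | h <;> rw [h]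
    · exact one_mem _
    · exact pow_mem (pow_mem hS _) _
  simpa using mul_mem h2 hk

theorem coe_S_act (τ : ℍ) : ((mpS.1.act τ : ℍ) : ℂ) = -1 / τ := by
  rw [act_eq, sl_mpS, modular_S_smul]
  change (-(τ : ℂ))⁻¹ = _
  rw [inv_neg, neg_div, one_div]

theorem coe_T_act (τ : ℍ) : ((mpT.1.act τ : ℍ) : ℂ) = τ + 1 := by
  rw [act_eq, sl_mpT, modular_T_smul]
  simp [add_comm]

/-- The braid relation in the metaplectic group. -/
theorem braid : mpS ^ 2 = (mpS * mpT) ^ 3 := by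
  have hsl : sl mpS = sl (mpT * mpS * mpT * mpS * mpT) := by
    simp only [map_mul, sl_mpS, sl_mpT]
    decide
  have key : mpS = mpT * mpS * mpT * mpS * mpT := by
    refine eq_of_phi_eq hsl UpperHalfPlane.I ?_
    have h : (mpT * mpS * mpT * mpS * mpT).1.phi UpperHalfPlane.I =
        csqrt (mpT.1.act (mpS.1.act (mpT.1.act UpperHalfPlane.I)) : ℍ) *
          csqrt (mpT.1.act UpperHalfPlane.I : ℍ) := by
      simp only [Subgroup.coe_mul, MetaGL.mul_phi_act, mpT_phi, mpS_phi, one_mul, mul_one]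
    have h0 : (UpperHalfPlane.I + 1 : ℂ) ≠ 0 := by
      intro h
      simpa using congrArg Complex.im h
    have hmul : ((mpT.1.act (mpS.1.act (mpT.1.act UpperHalfPlane.I)) : ℍ) : ℂ) *
        (mpT.1.act UpperHalfPlane.I : ℍ) = (UpperHalfPlane.I : ℍ) := by
      rw [coe_T_act, coe_S_act, coe_T_act]
      field_simp
      ring
    rw [h, csqrt_mul (UpperHalfPlane.im_pos _) (UpperHalfPlane.im_pos _), hmul, mpS_phi]
    rw [hmul]
    exact UpperHalfPlane.im_pos _
  calc mpS ^ 2 = mpS * mpS := pow_two _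
    _ = mpS * (mpT * mpS * mpT * mpS * mpT) := by rw [← key]
    _ = (mpS * mpT) ^ 3 := by simp only [pow_succ, pow_zero, one_mul, mul_assoc]

theorem re_S_act (τ : ℍ) : (mpS.1.act τ).re = -τ.re / Complex.normSq τ := by
  rw [← UpperHalfPlane.coe_re, coe_S_act, Complex.div_re]
  simp

theorem re_S_act_neg {τ : ℍ} (h : 0 < τ.re) : (mpS.1.act τ).re < 0 := by
  rw [re_S_act]
  exact div_neg_of_neg_of_pos (neg_neg_of_pos h) (UpperHalfPlane.normSq_pos τ)

theorem re_S_act_pos {τ : ℍ} (h : τ.re < 0) : 0 < (mpS.1.act τ).re := by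
  rw [re_S_act]
  exact div_pos (neg_pos_of_neg h) (UpperHalfPlane.normSq_pos τ)

theorem re_T_act (τ : ℍ) : (mpT.1.act τ).re = τ.re + 1 := by
  rw [← UpperHalfPlane.coe_re, coe_T_act]
  simp

theorem re_T_inv_act (τ : ℍ) : (mpT⁻¹.1.act τ).re = τ.re - 1 := by
  have := re_T_act (mpT⁻¹.1.act τ)
  have h : mpT.1.act (mpT⁻¹.1.act τ) = τ := mpT.1.act_inv_act τ
  rw [h] at this
  linarith

theorem mpS_inv_act (τ : ℍ) : mpS⁻¹.1.act τ = mpS.1.act τ := by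
  have h : mpS.1.act (mpS.1.act τ) = τ := by
    rw [← MetaGL.mul_act]
    exact (congrArg (fun g : Mp2Z => g.1.act τ) (pow_two mpS)).symm.trans (mpZ_act τ)
  conv_lhs => rw [← h]
  exact mpS.1.inv_act_act _

theorem toPerm_mpZ : MetaGL.toPerm mpZ.1 = 1 := Equiv.ext mpZ_act

/-- The integral metaplectic group is presented by the generators `S`, `T` with the relations
`S² = (ST)³` and `S⁸ = 1`: a pair of elements subject to these relations is the image of `(S, T)`
under a homomorphism. -/
theorem exists_hom {H : Type*} [Group H] (s t : H) (h1 : s ^ 2 = (s * t) ^ 3) (h2 : s ^ 8 = 1) :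
    ∃ f : Mp2Z →* H, f mpS = s ∧ f mpT = t := by
  -- the graph of the homomorphism; it is to be shown that it contains no `(1, h)` with `h ≠ 1`
  let P : Subgroup (Mp2Z × H) := Subgroup.closure {(mpS, s), (mpT, t)}
  let x : P := ⟨(mpS, s), Subgroup.subset_closure (by simp)⟩
  let y : P := ⟨(mpT, t), Subgroup.subset_closure (by simp)⟩
  have hxy : Subgroup.closure {x, y} = ⊤ := by
    have h := Subgroup.closure_closure_coe_preimage (k := {(mpS, s), (mpT, t)})
    rw [← h]
    congr 1
    ext p
    exact or_congr Subtype.ext_iff Subtype.ext_iff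
  let z : P := x ^ 2
  have hz3 : (x * y) ^ 3 = z := by
    apply Subtype.ext
    apply Prod.ext
    · exact braid.symm
    · exact h1.symm
  have hcx : x * z = z * x := (Commute.refl x).pow_right 2
  have hcy : y * z = z * y := by
    have hu : (x * y) * z = z * (x * y) := by
      rw [← hz3]; exact (Commute.refl (x * y)).pow_right 3
    have h3 : x * (y * z) = x * (z * y) := by
      rw [← mul_assoc, hu, ← mul_assoc, ← mul_assoc, hcx]
    exact mul_left_cancel h3
  have hcentral : z ∈ Subgroup.center P := by
    rw [Subgroup.mem_center_iff]
    intro g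
    have hg : g ∈ Subgroup.closure {x, y} := hxy ▸ Subgroup.mem_top g
    have hle : Subgroup.closure {x, y} ≤ Subgroup.centralizer {z} := by
      rw [Subgroup.closure_le]
      rintro w (rfl | rfl)
      · exact Subgroup.mem_centralizer_singleton_iff.mpr hcx
      · exact Subgroup.mem_centralizer_singleton_iff.mpr hcy
    exact Subgroup.mem_centralizer_singleton_iff.mp (hle hg)
  -- modulo the central element `z` over `Z`, the group is generated by elements of order two and
  -- three, which play ping-pong with the right and the left half of the upper half plane
  let N : Subgroup P := Subgroup.zpowers z
  have : N.Normal := ⟨fun n hn g => by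
    have hc : N ≤ Subgroup.center P := (Subgroup.zpowers_le).mpr hcentral
    have := Subgroup.mem_center_iff.mp (hc hn) g
    rw [this, mul_inv_cancel_right]
    exact hn⟩
  let π₀ : P →* Equiv.Perm ℍ :=
    (MetaGL.toPerm.comp Mp2Z.subtype).comp ((MonoidHom.fst Mp2Z H).comp P.subtype)
  have hπz : π₀ z = 1 := toPerm_mpZ
  have hN : N ≤ π₀.ker := by
    rw [Subgroup.zpowers_le]
    exact hπz
  let π : P ⧸ N →* Equiv.Perm ℍ := QuotientGroup.lift N π₀ hN
  have hπ : Function.Injective π := by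
    refine injective_of_ping_pong π (x : P ⧸ N) ((x * y : P) : P ⧸ N) ?_ ?_ ?_
      {τ : ℍ | 0 < τ.re} {τ : ℍ | τ.re < 0} ⟨⟨1 + Complex.I, by simp⟩, ?_⟩
      ⟨⟨-1 + Complex.I, by simp⟩, ?_⟩ ?_ ?_ ?_ ?_
    · rw [← QuotientGroup.mk_pow, QuotientGroup.eq_one_iff]
      exact Subgroup.mem_zpowers z
    · rw [← QuotientGroup.mk_pow, QuotientGroup.eq_one_iff, hz3]
      exact Subgroup.mem_zpowers z
    · have hmap : (Subgroup.closure {x, y}).map (QuotientGroup.mk' N) = ⊤ := by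
        rw [hxy]
        exact Subgroup.map_top_of_surjective _ (QuotientGroup.mk'_surjective N)
      rw [eq_top_iff, ← hmap, Subgroup.map_le_iff_le_comap, Subgroup.closure_le]
      have hx : (x : P ⧸ N) ∈ Subgroup.closure {(x : P ⧸ N), ((x * y : P) : P ⧸ N)} :=
        Subgroup.subset_closure (by simp)
      have hxy : ((x * y : P) : P ⧸ N) ∈ Subgroup.closure {(x : P ⧸ N), ((x * y : P) : P ⧸ N)} :=
        Subgroup.subset_closure (by simp)
      rintro w (rfl | rfl)
      · exact hx
      · have := mul_mem (inv_mem hx) hxy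
        rw [QuotientGroup.mk_mul, inv_mul_cancel_left] at this
        exact this
    · change 0 < (1 + Complex.I).re; simp
    · change (-1 + Complex.I).re < 0; simp
    · rw [Set.disjoint_left]
      exact fun a ha hb => lt_asymm (Set.mem_ofPred.mp ha) hb
    · exact fun a ha => re_S_act_pos ha
    · intro a ha
      have : π ((x * y : P) : P ⧸ N) • a = mpS.1.act (mpT.1.act a) := MetaGL.mul_act _ _ a
      rw [this]
      refine re_S_act_neg (τ := mpT.1.act a) ?_
      rw [re_T_act]
      exact add_pos ha one_pos
    · intro a ha
      have : π ((x * y : P) : P ⧸ N)⁻¹ • a = mpT⁻¹.1.act (mpS⁻¹.1.act a) := by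
        rw [← QuotientGroup.mk_inv, mul_inv_rev]
        exact MetaGL.mul_act _ _ a
      rw [this, Set.mem_ofPred, re_T_inv_act, mpS_inv_act]
      have := re_S_act_neg ha
      linarith
  have hker : ∀ h : H, ((1 : Mp2Z), h) ∈ P → h = 1 := by
    intro h hh
    have h3 : ((⟨(1, h), hh⟩ : P) : P ⧸ N) = 1 := by
      apply hπ
      rw [map_one]
      exact map_one (MetaGL.toPerm.comp Mp2Z.subtype)
    rw [QuotientGroup.eq_one_iff] at h3
    obtain ⟨k, hk⟩ := Subgroup.mem_zpowers_iff.mp h3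
    have hk1 : mpZ ^ k = 1 := congrArg (fun p : P => p.1.1) hk
    have hk2 : (s ^ 2) ^ k = h := congrArg (fun p : P => p.1.2) hk
    have hord : orderOf mpZ = 2 ^ 2 := orderOf_eq_prime_pow (by simpa using mpZ_sq_ne_one)
      (by simpa using mpZ_pow_four)
    obtain ⟨j, rfl⟩ := orderOf_dvd_iff_zpow_eq_one.mpr hk1
    rw [hord] at hk2
    rw [← hk2, zpow_mul]
    have : (s ^ 2) ^ ((2 ^ 2 : ℕ) : ℤ) = 1 := by
      rw [zpow_natCast, ← pow_mul]
      exact h2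
    rw [this, one_zpow]
  have hbij : Function.Bijective (Prod.fst ∘ P.subtype) := by
    constructor
    · rintro ⟨⟨a, b⟩, hp⟩ ⟨⟨a', b'⟩, hp'⟩ (rfl : a = a')
      have h3 : ((1 : Mp2Z), b * b'⁻¹) ∈ P := by
        simpa using mul_mem hp (inv_mem hp')
      have h4 := mul_inv_eq_one.mp (hker _ h3)
      simp [h4]
    · intro g
      have hg : g ∈ P.map (MonoidHom.fst Mp2Z H) := by
        rw [MonoidHom.map_closure, Set.image_pair]
        change g ∈ Subgroup.closure {mpS, mpT}
        rw [closure_mpS_mpT]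
        trivial
      obtain ⟨p, hp, hpg⟩ := hg
      exact ⟨⟨p, hp⟩, hpg⟩
  obtain ⟨f, hf⟩ := Subgroup.exists_eq_graph hbij
  refine ⟨f, ?_, ?_⟩
  · have : (mpS, s) ∈ f.graph := hf ▸ x.2
    exact MonoidHom.mem_graph.mp this
  · have : (mpT, t) ∈ f.graph := hf ▸ y.2
    exact MonoidHom.mem_graph.mp this

end Mp2Z

/-! ### Existence of the Weil representation -/

section Weil
variable {A : Type*} [AddCommGroup A] [Fintype A]
set_option linter.unusedSectionVars false

theorem basisVec_apply [DecidableEq A] (l k : A) : basisVec l k = if k = l then 1 else 0 := by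
  have : (basisVec l : A → ℂ) = Pi.single l 1 := by
    unfold basisVec
    congr!
  rw [this, Pi.single_apply]

theorem sum_smul_basisVec (v : A → ℂ) : ∑ l, v l • basisVec l = v := by
  classical
  ext k
  simp [basisVec_apply]

theorem sum_smul_basisVec_apply (v : A → ℂ) (k : A) : (∑ l, v l • (basisVec l : A → ℂ)) k = v k :=
  congrFun (sum_smul_basisVec v) k

theorem end_ext {L L' : Module.End ℂ (A → ℂ)} (h : ∀ l : A, L (basisVec l) = L' (basisVec l)) :
    L = L' := by
  ext1 v
  rw [← sum_smul_basisVec v, map_sum, map_sum]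
  simp only [map_smul, h]

theorem end_apply (L : Module.End ℂ (A → ℂ)) (v : A → ℂ) :
    L v = ∑ l, v l • L (basisVec l) := by
  conv_lhs => rw [← sum_smul_basisVec v, map_sum]
  simp only [map_smul]

namespace DiscriminantForm
variable (D : DiscriminantForm A)

/-- The scalar in the action of `S`. -/
def sConst : ℂ := conj (D.gauss 1) / Fintype.card A

theorem card_ne_zero : (Fintype.card A : ℂ) ≠ 0 := Nat.cast_ne_zero.mpr Fintype.card_ne_zero

theorem sConst_mul_gauss : D.sConst * D.gauss 1 = 1 := by
  rw [sConst, div_mul_eq_mul_div, mul_comm, gauss_mul_conj_one, div_self card_ne_zero]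

theorem sConst_mul_conj : D.sConst * conj D.sConst * Fintype.card A = 1 := by
  have h := D.gauss_mul_conj_one
  have hn := card_ne_zero (A := A)
  rw [sConst, map_div₀, map_natCast, Complex.conj_conj]
  field_simp
  rw [mul_comm, h]

theorem sConst_pow_eight : D.sConst ^ 8 * (Fintype.card A : ℂ) ^ 4 = 1 := by
  have h := D.gauss_one_pow_eight
  have h2 := congrArg (· ^ 8) D.sConst_mul_gauss
  simpa [mul_pow, h] using h2

/-- The operator `𝔢_λ ↦ e(x λ²/2) 𝔢_λ`. -/
def tOp (x : ℤ) : Module.End ℂ (A → ℂ) where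
  toFun v l := e (x • D.q l) * v l
  map_add' v w := by ext; simp [mul_add]
  map_smul' c v := by ext; simp [mul_left_comm]

/-- The operator `𝔢_λ ↦ c ∑_μ e(-(λ, μ)) 𝔢_μ` with `c = e(-sig(A)/8)/√|A|`. -/
def sOp : Module.End ℂ (A → ℂ) where
  toFun v m := D.sConst * ∑ l, e (-D.bil l m) * v l
  map_add' v w := by ext; simp [mul_add, Finset.sum_add_distrib]
  map_smul' c v := by
    ext
    simp only [Pi.smul_apply, smul_eq_mul, RingHom.id_apply, Finset.mul_sum]
    exact Finset.sum_congr rfl fun _ _ => by ring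

theorem tOp_apply (x : ℤ) (v : A → ℂ) (l : A) : D.tOp x v l = e (x • D.q l) * v l := rfl

theorem sOp_apply (v : A → ℂ) (m : A) : D.sOp v m = D.sConst * ∑ l, e (-D.bil l m) * v l := rfl

theorem tOp_basisVec (x : ℤ) (l : A) : D.tOp x (basisVec l) = e (x • D.q l) • basisVec l := by
  classical
  ext k
  by_cases h : k = l <;> simp [tOp_apply, basisVec_apply, h]

theorem sOp_basisVec (l : A) : D.sOp (basisVec l) =
    D.sConst • ∑ m, e (-D.bil l m) • (basisVec m : A → ℂ) := by
  classical
  ext k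
  rw [Pi.smul_apply, sum_smul_basisVec_apply (fun m => e (-D.bil l m)), sOp_apply]
  simp [basisVec_apply]

theorem tOp_mul (x y : ℤ) : D.tOp x * D.tOp y = D.tOp (x + y) := by
  ext1 v; ext l
  simp only [Module.End.mul_apply, tOp_apply, add_smul, e_add, mul_assoc]

theorem tOp_zero : D.tOp 0 = 1 := by
  ext1 v; ext l
  simp [tOp_apply]

theorem sOp_sOp_apply (v : A → ℂ) (m : A) :
    D.sOp (D.sOp v) m = D.sConst ^ 2 * Fintype.card A * v (-m) := by
  classical
  have h (l : A) : ∑ k, e (-D.bil k m) * e (-D.bil l k) =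
      if l = -m then (Fintype.card A : ℂ) else 0 := by
    have : ∀ k, e (-D.bil k m) * e (-D.bil l k) = e (D.bil (-(l + m)) k) := fun k => by
      rw [← e_add]
      congr 1
      rw [bil_neg_left, bil_add_left, D.bil_comm k m]
      abel
    simp_rw [this]
    rw [sum_e_bil]
    simp only [neg_eq_zero, add_eq_zero_iff_eq_neg]
  calc D.sOp (D.sOp v) m
      = D.sConst ^ 2 * ∑ k, ∑ l, e (-D.bil k m) * e (-D.bil l k) * v l := by
        rw [sOp_apply, pow_two, mul_assoc, Finset.mul_sum, Finset.mul_sum, Finset.mul_sum]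
        refine Finset.sum_congr rfl fun k _ => ?_
        rw [sOp_apply]
        simp only [Finset.mul_sum]
        exact Finset.sum_congr rfl fun l _ => by ring
    _ = D.sConst ^ 2 * ∑ l, (if l = -m then (Fintype.card A : ℂ) else 0) * v l := by
        rw [Finset.sum_comm]
        simp_rw [← Finset.sum_mul, h]
    _ = _ := by simp [mul_assoc]

theorem sOp_pow_eight : D.sOp ^ 8 = 1 := by
  have h4 (v : A → ℂ) : (D.sOp ^ 4) v = (D.sConst ^ 2 * Fintype.card A) ^ 2 • v := by
    ext m
    change D.sOp (D.sOp (D.sOp (D.sOp v))) m = _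
    rw [sOp_sOp_apply, sOp_sOp_apply, neg_neg, Pi.smul_apply, smul_eq_mul]
    ring
  have h8 : D.sOp ^ 8 = D.sOp ^ 4 * D.sOp ^ 4 := by rw [← pow_add]
  ext1 v
  rw [h8, Module.End.mul_apply, h4, h4, smul_smul]
  have := D.sConst_pow_eight
  have h : (D.sConst ^ 2 * Fintype.card A) ^ 2 * (D.sConst ^ 2 * Fintype.card A) ^ 2 = 1 := by
    rw [← this]; ring
  rw [h, one_smul]
  rfl

/-- The braid relation for the operators, in the form `TSTST = S`. -/
theorem tOp_sOp_braid : D.tOp 1 * D.sOp * D.tOp 1 * D.sOp * D.tOp 1 = D.sOp := by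
  ext1 v; ext m
  have h (l : A) : e (D.q m) * ∑ k, e (-D.bil k m) * (e (D.q k) * e (-D.bil l k)) * e (D.q l) =
      D.gauss 1 * e (-D.bil l m) := by
    have h1 := D.sum_e_complete_square 1 1 (fun l => by simp) (-(l + m))
    have h2 : ∀ k, e (-D.bil k m) * (e (D.q k) * e (-D.bil l k)) * e (D.q l) =
        e (D.q l) * e ((1 : ℤ) • D.q k + D.bil (-(l + m)) k) := fun k => by
      rw [← e_add, ← e_add, ← e_add, ← e_add]
      congr 1
      rw [bil_neg_left, bil_add_left, D.bil_comm k m, one_zsmul]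
      abel
    rw [Finset.sum_congr rfl fun k _ => h2 k, ← Finset.mul_sum, h1, one_zsmul, q_neg, q_add,
      mul_comm (D.gauss 1), ← mul_assoc, ← mul_assoc, ← e_add, ← e_add]
    congr 2
    abel
  simp only [Module.End.mul_apply, tOp_apply, sOp_apply, one_zsmul]
  calc e (D.q m) * (D.sConst * ∑ k, e (-D.bil k m) * (e (D.q k) * (D.sConst *
        ∑ l, e (-D.bil l k) * (e (D.q l) * v l))))
      = D.sConst ^ 2 * ∑ k, ∑ l, e (D.q m) * (e (-D.bil k m) * (e (D.q k) * e (-D.bil l k)) *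
          e (D.q l)) * v l := by
        simp only [Finset.mul_sum]
        exact Finset.sum_congr rfl fun k _ => Finset.sum_congr rfl fun l _ => by ring
    _ = D.sConst ^ 2 * ∑ l, D.gauss 1 * e (-D.bil l m) * v l := by
        rw [Finset.sum_comm]
        simp_rw [← Finset.sum_mul, ← Finset.mul_sum, h]
    _ = D.sConst * (D.sConst * D.gauss 1) * ∑ l, e (-D.bil l m) * v l := by
        rw [Finset.mul_sum, Finset.mul_sum]
        exact Finset.sum_congr rfl fun l _ => by ring
    _ = _ := by rw [sConst_mul_gauss, mul_one]

theorem exists_isWeilRep : ∃ ρ, IsWeilRep D ρ := by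
  let s : (Module.End ℂ (A → ℂ))ˣ := Units.ofPowEqOne D.sOp 8 D.sOp_pow_eight (by norm_num)
  let t : (Module.End ℂ (A → ℂ))ˣ :=
    ⟨D.tOp 1, D.tOp (-1), by rw [tOp_mul]; exact D.tOp_zero, by rw [tOp_mul]; exact D.tOp_zero⟩
  have hb : t * s * t * s * t = s := Units.ext D.tOp_sOp_braid
  have h1 : s ^ 2 = (s * t) ^ 3 := by
    calc s ^ 2 = s * s := pow_two _
      _ = s * (t * s * t * s * t) := by rw [hb]
      _ = (s * t) ^ 3 := by simp only [pow_succ, pow_zero, one_mul, mul_assoc]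
  have h2 : s ^ 8 = 1 := Units.ext D.sOp_pow_eight
  obtain ⟨f, hfS, hfT⟩ := Mp2Z.exists_hom s t h1 h2
  refine ⟨(Units.coeHom _).comp f, fun l => ?_, fun l => ?_⟩
  · rw [MonoidHom.comp_apply, hfT]
    exact (D.tOp_basisVec 1 l).trans (by rw [one_zsmul])
  · rw [MonoidHom.comp_apply, hfS, weil_scalar_eq]
    exact D.sOp_basisVec l

theorem weilRep_spec : IsWeilRep D (weilRep D) := by
  have h := D.exists_isWeilRep
  rw [weilRep, dif_pos h]
  exact h.choose_spec

theorem weilRep_mpT : weilRep D mpT = D.tOp 1 :=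
  end_ext fun l => by rw [D.weilRep_spec.1, tOp_basisVec, one_zsmul]

theorem weilRep_mpS : weilRep D mpS = D.sOp :=
  end_ext fun l => by
    rw [D.weilRep_spec.2, weil_scalar_eq, sOp_basisVec]
    rfl

@[simp] theorem weilRep_inv_apply (g : Mp2Z) (v : A → ℂ) : weilRep D g⁻¹ (weilRep D g v) = v := by
  rw [← Module.End.mul_apply, ← map_mul, inv_mul_cancel, map_one, Module.End.one_apply]

@[simp] theorem weilRep_apply_inv (g : Mp2Z) (v : A → ℂ) : weilRep D g (weilRep D g⁻¹ v) = v := by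
  rw [← Module.End.mul_apply, ← map_mul, mul_inv_cancel, map_one, Module.End.one_apply]

/-- The elements of the metaplectic group with a multiplicative property hold everywhere as soon as
they hold for `S` and `T`. -/
theorem _root_.WeilHecke.Mp2Z.induction {p : Mp2Z → Prop} (hS : p mpS) (hT : p mpT)
    (hmul : ∀ g h, p g → p h → p (g * h)) (hinv : ∀ g, p g → p g⁻¹) (g : Mp2Z) : p g := by
  have hg : g ∈ Subgroup.closure {mpS, mpT} := Mp2Z.closure_mpS_mpT ▸ Subgroup.mem_top g
  induction hg using Subgroup.closure_induction with
  | mem x hx =>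
    rcases hx with rfl | rfl
    · exact hS
    · exact hT
  | one => simpa using hmul _ _ hS (hinv _ hS)
  | mul x y _ _ hx hy => exact hmul x y hx hy
  | inv x _ hx => exact hinv x hx

theorem scalarProd_sOp (v w : A → ℂ) : scalarProd (D.sOp v) (D.sOp w) = scalarProd v w := by
  classical
  have h (l k : A) : ∑ m, e (-D.bil l m) * e (D.bil k m) =
      if k = l then (Fintype.card A : ℂ) else 0 := by
    have : ∀ m, e (-D.bil l m) * e (D.bil k m) = e (D.bil (k + -l) m) := fun m => by
      rw [← e_add]
      congr 1
      rw [bil_add_left, bil_neg_left]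
      abel
    simp_rw [this]
    rw [sum_e_bil]
    simp only [← sub_eq_add_neg, sub_eq_zero]
  calc scalarProd (D.sOp v) (D.sOp w)
      = (D.sConst * conj D.sConst) * ∑ l, ∑ k, ∑ m, e (-D.bil l m) * e (D.bil k m) *
          (v l * conj (w k)) := by
        simp only [scalarProd, sOp_apply, map_mul, map_sum, conj_e, neg_neg]
        have h2 : ∀ m, D.sConst * (∑ l, e (-D.bil l m) * v l) *
            (conj D.sConst * ∑ k, e (D.bil k m) * conj (w k)) = ∑ l, ∑ k,
            (D.sConst * conj D.sConst) * (e (-D.bil l m) * e (D.bil k m) * (v l * conj (w k))) := by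
          intro m
          rw [mul_mul_mul_comm, Finset.sum_mul_sum, Finset.mul_sum]
          refine Finset.sum_congr rfl fun l _ => ?_
          rw [Finset.mul_sum]
          exact Finset.sum_congr rfl fun k _ => by ring
        simp_rw [h2]
        rw [Finset.sum_comm]
        simp only [Finset.mul_sum]
        refine Finset.sum_congr rfl fun l _ => ?_
        rw [Finset.sum_comm]
    _ = (D.sConst * conj D.sConst) * ∑ l, Fintype.card A * (v l * conj (w l)) := by
        simp_rw [← Finset.sum_mul, h]
        simp
    _ = scalarProd v w := by
        rw [← Finset.mul_sum, ← mul_assoc, sConst_mul_conj, one_mul, scalarProd]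

/-- The Weil representation is unitary. -/
theorem scalarProd_weilRep (g : Mp2Z) (v w : A → ℂ) :
    scalarProd (weilRep D g v) (weilRep D g w) = scalarProd v w := by
  revert v w
  refine Mp2Z.induction (p := fun g => ∀ v w, scalarProd (weilRep D g v) (weilRep D g w) =
    scalarProd v w) ?_ ?_ ?_ ?_ g
  · intro v w; rw [weilRep_mpS, scalarProd_sOp]
  · intro v w
    rw [weilRep_mpT]
    refine Finset.sum_congr rfl fun l _ => ?_
    have : e ((1 : ℤ) • D.q l) * conj (e ((1 : ℤ) • D.q l)) = 1 := by
      rw [conj_e, ← e_add, add_neg_cancel, e_zero]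
    rw [tOp_apply, tOp_apply, map_mul, mul_mul_mul_comm, this, one_mul]
  · intro g h hg hh v w
    rw [map_mul, Module.End.mul_apply, Module.End.mul_apply, hg, hh]
  · intro g hg v w
    rw [← hg, weilRep_apply_inv, weilRep_apply_inv]

end DiscriminantForm
end Weil

/-! ### Matrix entries of products in the integral metaplectic group -/

namespace Mp2Z

theorem sl_det (g : Mp2Z) : sl g 0 0 * sl g 1 1 - sl g 0 1 * sl g 1 0 = 1 := by
  have := (sl g).det_coe
  rwa [Matrix.det_fin_two] at this

theorem sl_mul_apply (g h : Mp2Z) (i j : Fin 2) :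
    sl (g * h) i j = sl g i 0 * sl h 0 j + sl g i 1 * sl h 1 j := by
  rw [map_mul, Matrix.SpecialLinearGroup.coe_mul, Matrix.mul_apply, Fin.sum_univ_two]

theorem sl_mpT_zpow (j : ℤ) : (sl (mpT ^ j)).1 = !![1, j; 0, 1] := by
  rw [map_zpow, sl_mpT, ModularGroup.coe_T_zpow]

theorem sl_mpS_val : (sl mpS).1 = !![0, -1; 1, 0] := by
  rw [sl_mpS, ModularGroup.coe_S]

theorem sl_mul_T (g : Mp2Z) (j : ℤ) : (sl (g * mpT ^ j)).1 =
    !![sl g 0 0, sl g 0 1 + j * sl g 0 0; sl g 1 0, sl g 1 1 + j * sl g 1 0] := by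
  ext i k
  have := sl_mul_apply g (mpT ^ j) i k
  rw [this, sl_mpT_zpow]
  fin_cases i <;> fin_cases k <;> simp <;> ring

theorem sl_mul_S (g : Mp2Z) : (sl (g * mpS)).1 =
    !![sl g 0 1, -sl g 0 0; sl g 1 1, -sl g 1 0] := by
  ext i k
  have := sl_mul_apply g mpS i k
  rw [this, sl_mpS_val]
  fin_cases i <;> fin_cases k <;> simp

/-- The element `L = S⁻¹T⁻¹S` over the lower triangular matrix `(1, 0; 1, 1)`. -/
def mpL : Mp2Z := mpS⁻¹ * mpT⁻¹ * mpS

theorem mpL_zpow (j : ℤ) : mpL ^ j = mpS⁻¹ * mpT ^ (-j) * mpS := by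
  have h : mpL = mpS⁻¹ * mpT⁻¹ * (mpS⁻¹)⁻¹ := by rw [inv_inv]; rfl
  rw [h, conj_zpow, inv_inv, inv_zpow, zpow_neg]

theorem mpS_mul_mpL_zpow (j : ℤ) : mpS * mpL ^ j = mpT ^ (-j) * mpS := by
  rw [mpL_zpow, mul_assoc, mul_inv_cancel_left]

theorem sl_mpL_zpow (j : ℤ) : (sl (mpL ^ j)).1 = !![1, 0; j, 1] := by
  have h : ModularGroup.S⁻¹ = -ModularGroup.S := by decide
  rw [mpL_zpow, map_mul, map_mul, map_inv, sl_mpS, h, Matrix.SpecialLinearGroup.coe_mul,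
    Matrix.SpecialLinearGroup.coe_mul, sl_mpT_zpow, Matrix.SpecialLinearGroup.coe_neg,
    ModularGroup.coe_S]
  ext i k
  fin_cases i <;> fin_cases k <;> simp [Matrix.mul_apply, Fin.sum_univ_two]

theorem sl_L_mul (g : Mp2Z) (j : ℤ) : (sl (mpL ^ j * g)).1 =
    !![sl g 0 0, sl g 0 1; sl g 1 0 + j * sl g 0 0, sl g 1 1 + j * sl g 0 1] := by
  ext i k
  have := sl_mul_apply (mpL ^ j) g i k
  rw [this, sl_mpL_zpow]
  fin_cases i <;> fin_cases k <;> simp <;> ring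

theorem sl_mul_L (g : Mp2Z) (j : ℤ) : (sl (g * mpL ^ j)).1 =
    !![sl g 0 0 + j * sl g 0 1, sl g 0 1; sl g 1 0 + j * sl g 1 1, sl g 1 1] := by
  ext i k
  have := sl_mul_apply g (mpL ^ j) i k
  rw [this, sl_mpL_zpow]
  fin_cases i <;> fin_cases k <;> simp <;> ring

/-- An element with upper left entry `1` is a product of powers of `L` and `T`, up to the
nontrivial element of the kernel of the covering. -/
theorem eq_of_apply_zero_zero_eq_one {g : Mp2Z} (h : sl g 0 0 = 1) :
    g = mpL ^ (sl g 1 0) * mpT ^ (sl g 0 1) ∨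
      g = mpL ^ (sl g 1 0) * mpT ^ (sl g 0 1) * mpZ ^ 2 := by
  have hd := sl_det g
  rw [h, one_mul] at hd
  have h1 : sl (mpL ^ (sl g 1 0) * mpT ^ (sl g 0 1)) = sl g := by
    apply Subtype.ext
    rw [sl_mul_T, sl_mpL_zpow]
    ext i k
    fin_cases i <;> fin_cases k <;> simp [h]
    linarith
  have h2 : sl ((mpL ^ (sl g 1 0) * mpT ^ (sl g 0 1))⁻¹ * g) = 1 := by
    rw [map_mul, map_inv, h1, inv_mul_cancel]
  rcases eq_one_or_of_sl_eq_one h2 with h3 | h3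
  · left; exact (inv_mul_eq_one.mp h3).symm
  · right; rw [← h3, mul_inv_cancel_left]

end Mp2Z

namespace DiscriminantForm
open Mp2Z
variable {A : Type*} [AddCommGroup A] [Fintype A] (D : DiscriminantForm A)
set_option linter.unusedSectionVars false

/-! ### Explicit matrix coefficients of the Weil representation -/

/-- The Fourier coefficient `∑_κ e((μ, κ)) v_κ`. -/
def fourier (m : A) : (A → ℂ) →ₗ[ℂ] ℂ where
  toFun v := ∑ k, e (D.bil m k) * v k
  map_add' v w := by simp [mul_add, Finset.sum_add_distrib]
  map_smul' c v := by simp [Finset.mul_sum, mul_left_comm]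

theorem fourier_apply (m : A) (v : A → ℂ) : D.fourier m v = ∑ k, e (D.bil m k) * v k := rfl

theorem fourier_basisVec (m l : A) : D.fourier m (basisVec l) = e (D.bil m l) := by
  classical
  simp [fourier_apply, basisVec_apply]

theorem sOp_apply_eq_fourier (v : A → ℂ) (m : A) : D.sOp v m = D.sConst * D.fourier (-m) v := by
  rw [sOp_apply, fourier_apply]
  congr 1
  refine Finset.sum_congr rfl fun k _ => ?_
  rw [bil_neg_left, D.bil_comm]

theorem sConst_ne_zero : D.sConst ≠ 0 := left_ne_zero_of_mul_eq_one D.sConst_mul_gauss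

theorem eq_of_fourier_eq {v w : A → ℂ} (h : ∀ m, D.fourier m v = D.fourier m w) : v = w := by
  have h1 : weilRep D mpS v = weilRep D mpS w := by
    rw [weilRep_mpS]
    ext m
    rw [sOp_apply_eq_fourier, sOp_apply_eq_fourier, h]
  rw [← D.weilRep_inv_apply mpS v, h1, weilRep_inv_apply]

theorem weilRep_mpT_zpow (j : ℤ) : weilRep D (mpT ^ j) = D.tOp j := by
  have hn (n : ℕ) : weilRep D (mpT ^ n) = D.tOp n := by
    induction n with
    | zero => rw [pow_zero, map_one, Nat.cast_zero, tOp_zero]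
    | succ n ih => rw [pow_succ, map_mul, ih, weilRep_mpT, tOp_mul, Nat.cast_succ]
  obtain ⟨n, rfl | rfl⟩ := j.eq_nat_or_neg
  · exact_mod_cast hn n
  · ext1 v
    have h : D.tOp n (D.tOp (-n) v) = v := by
      rw [← Module.End.mul_apply, tOp_mul, add_neg_cancel, tOp_zero, Module.End.one_apply]
    rw [zpow_neg, zpow_natCast]
    conv_lhs => rw [← h, ← hn, weilRep_inv_apply]

theorem fourier_weilRep_mpL (j : ℤ) (m : A) (v : A → ℂ) :
    D.fourier m (weilRep D (mpL ^ j) v) = e (-(j • D.q m)) * D.fourier m v := by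
  have h (w : A → ℂ) : D.sConst * D.fourier m w = weilRep D mpS w (-m) := by
    rw [weilRep_mpS, sOp_apply_eq_fourier, neg_neg]
  have h2 : weilRep D mpS (weilRep D (mpL ^ j) v) = D.tOp (-j) (weilRep D mpS v) := by
    rw [← Module.End.mul_apply, ← map_mul, mpS_mul_mpL_zpow, map_mul, weilRep_mpT_zpow,
      Module.End.mul_apply]
  apply mul_left_cancel₀ D.sConst_ne_zero
  rw [h, h2, tOp_apply, ← h, q_neg, _root_.neg_smul]
  ring

/-- The coefficient sum of `ρ(γ)𝔢_0`. -/
def psi (g : Mp2Z) : ℂ := D.fourier 0 (weilRep D g (basisVec 0))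

/-- The explicit formula for the matrix coefficients of `ρ(γ)`, `γ = (a, b; c, d)`, relative to the
basis `𝔢_λ` and the dual of the Fourier basis. Here `y` is any inverse of `a`. -/
def HasFormula (g : Mp2Z) : Prop :=
  ∀ y : ℤ, (∀ l : A, (sl g 0 0 * y) • D.q l = D.q l) → ∀ m l : A,
    D.fourier m (weilRep D g (basisVec l)) =
      D.psi g * e (y • (sl g 0 1 • D.q l + D.bil m l - sl g 1 0 • D.q m))

variable {D}

theorem hasFormula_of_eq {g : Mp2Z} (W : ℂ)
    (h : ∀ y : ℤ, (∀ l : A, (sl g 0 0 * y) • D.q l = D.q l) →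
    ∀ m l : A, D.fourier m (weilRep D g (basisVec l)) =
      W * e (y • (sl g 0 1 • D.q l + D.bil m l - sl g 1 0 • D.q m)))
    (hy : ∃ y : ℤ, ∀ l : A, (sl g 0 0 * y) • D.q l = D.q l) : D.HasFormula g ∧ D.psi g = W := by
  obtain ⟨y, hy⟩ := hy
  have hW : D.psi g = W := by rw [psi, h y hy]; simp
  exact ⟨fun y hy m l => by rw [h y hy, hW], hW⟩

theorem psi_mul_T (g : Mp2Z) (j : ℤ) : D.psi (g * mpT ^ j) = D.psi g := by
  rw [psi, map_mul, Module.End.mul_apply, weilRep_mpT_zpow, tOp_basisVec]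
  simp [psi]

theorem psi_L_mul (g : Mp2Z) (j : ℤ) : D.psi (mpL ^ j * g) = D.psi g := by
  rw [psi, map_mul, Module.End.mul_apply, fourier_weilRep_mpL]
  simp [psi]

theorem HasFormula.mul_T {g : Mp2Z} (h : D.HasFormula g) (j : ℤ) : D.HasFormula (g * mpT ^ j) := by
  intro y hy m l
  rw [psi_mul_T, sl_mul_T] at *
  simp only [Matrix.of_apply, Matrix.cons_val', Matrix.cons_val_zero, Matrix.cons_val_one,
    Matrix.cons_val_fin_one] at *
  rw [map_mul, Module.End.mul_apply, weilRep_mpT_zpow, tOp_basisVec, map_smul, map_smul, h y hy,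
    smul_eq_mul, mul_left_comm, ← e_add]
  congr 2
  have h1 : y • (j * sl g 0 0) • D.q l = j • D.q l := by
    rw [← mul_smul, mul_left_comm, mul_smul, mul_comm y, hy]
  rw [add_smul, smul_sub, smul_add, smul_sub, smul_add, smul_add, h1]
  abel

theorem HasFormula.L_mul {g : Mp2Z} (h : D.HasFormula g) (j : ℤ) : D.HasFormula (mpL ^ j * g) := by
  intro y hy m l
  rw [psi_L_mul, sl_L_mul] at *
  simp only [Matrix.of_apply, Matrix.cons_val', Matrix.cons_val_zero, Matrix.cons_val_one,
    Matrix.cons_val_fin_one] at *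
  rw [map_mul, Module.End.mul_apply, fourier_weilRep_mpL, h y hy, mul_left_comm, ← e_add]
  congr 2
  have h1 : y • (j * sl g 0 0) • D.q m = j • D.q m := by
    rw [← mul_smul, mul_left_comm, mul_smul, mul_comm y, hy]
  rw [add_smul, smul_sub, smul_add, smul_sub, smul_add, smul_add, h1]
  abel

theorem hasFormula_one : D.HasFormula 1 := by
  refine (hasFormula_of_eq 1 ?_ ⟨1, by simp⟩).1
  intro y hy m l
  have hy' : ∀ l : A, y • D.q l = D.q l := by simpa using hy
  simp only [map_one, Module.End.one_apply, fourier_basisVec, Matrix.SpecialLinearGroup.coe_one,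
    Matrix.one_apply_ne (show (0 : Fin 2) ≠ 1 by decide),
    Matrix.one_apply_ne (show (1 : Fin 2) ≠ 0 by decide), zero_smul, zero_add, sub_zero, one_mul]
  rw [D.zsmul_bil_of_zsmul_q hy']

theorem psi_one : D.psi 1 = 1 := by
  rw [psi, map_one, Module.End.one_apply, fourier_basisVec]; simp

theorem weilRep_mpZ_sq : weilRep D (mpZ ^ 2) = (D.sConst ^ 2 * Fintype.card A) ^ 2 • 1 := by
  ext1 v
  ext m
  rw [mpZ, ← pow_mul, map_pow, weilRep_mpS]
  change D.sOp (D.sOp (D.sOp (D.sOp v))) m = (D.sConst ^ 2 * Fintype.card A) ^ 2 • v m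
  rw [sOp_sOp_apply, sOp_sOp_apply, neg_neg, smul_eq_mul]
  ring

theorem psi_mul_mpZ_sq (g : Mp2Z) :
    D.psi (g * mpZ ^ 2) = (D.sConst ^ 2 * Fintype.card A) ^ 2 * D.psi g := by
  rw [psi, map_mul, Module.End.mul_apply, weilRep_mpZ_sq, LinearMap.smul_apply,
    Module.End.one_apply, map_smul, map_smul, smul_eq_mul, psi]

theorem HasFormula.mul_mpZ_sq {g : Mp2Z} (h : D.HasFormula g) : D.HasFormula (g * mpZ ^ 2) := by
  intro y hy m l
  have hs : sl (g * mpZ ^ 2) = sl g := by rw [map_mul, sl_mpZ_sq, mul_one]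
  rw [hs] at hy ⊢
  rw [psi_mul_mpZ_sq, map_mul, Module.End.mul_apply, weilRep_mpZ_sq, LinearMap.smul_apply,
    Module.End.one_apply, map_smul, map_smul, smul_eq_mul, h y hy, mul_assoc]

/-- Right multiplication by `S`, by completing the square. -/
theorem HasFormula.mul_S {g : Mp2Z} (h : D.HasFormula g) {y z : ℤ}
    (hy : ∀ l : A, (sl g 0 0 * y) • D.q l = D.q l) (hz : ∀ l : A, (sl g 0 1 * z) • D.q l = D.q l) :
    D.HasFormula (g * mpS) ∧ D.psi (g * mpS) = D.sConst * D.gauss (y * sl g 0 1) * D.psi g := by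
  refine hasFormula_of_eq _ ?_ ⟨z, by rw [sl_mul_S]; simpa using hz⟩
  intro z hz m l
  rw [sl_mul_S] at *
  simp only [Matrix.of_apply, Matrix.cons_val', Matrix.cons_val_zero, Matrix.cons_val_one,
    Matrix.cons_val_fin_one] at *
  have hdet := sl_det g
  set a := sl g 0 0
  set b := sl g 0 1
  set c := sl g 1 0
  set d := sl g 1 1
  have hyb (u v : A) : (a * y) • D.bil u v = D.bil u v := D.zsmul_bil_of_zsmul_q hy u v
  have hsq := D.sum_e_complete_square (y * b) (a * z) (fun l => by
    rw [show y * b * (a * z) = (a * y) * (b * z) by ring, mul_smul, hz, hy]) (y • m - l)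
  rw [map_mul, Module.End.mul_apply, weilRep_mpS, sOp_basisVec]
  simp only [map_smul, map_sum, smul_eq_mul]
  calc D.sConst * ∑ k, e (-D.bil l k) * D.fourier m (weilRep D g (basisVec k))
      = D.sConst * ∑ k, D.psi g * e (-((y * c) • D.q m)) *
          e ((y * b) • D.q k + D.bil (y • m - l) k) := by
        congr 1
        refine Finset.sum_congr rfl fun k _ => ?_
        rw [h y hy, mul_left_comm, mul_assoc, ← e_add, ← e_add]
        congr 2
        rw [sub_eq_add_neg (y • m), bil_add_left, bil_neg_left, bil_zsmul_left, smul_sub, smul_add,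
          ← mul_smul, ← mul_smul]
        abel
    _ = D.sConst * D.gauss (y * b) * D.psi g *
          (e (-((y * c) • D.q m)) * e (-((a * z) • D.q (y • m - l)))) := by
        rw [← Finset.mul_sum, hsq]
        ring
    _ = _ := by
        rw [← e_add]
        congr 2
        have h1 : (a * z) • D.q (y • m - l) =
            (z * y) • D.q m - z • D.bil m l + (a * z) • D.q l := by
          rw [sub_eq_add_neg, q_add, q_neg, q_zsmul, bil_neg_right, bil_zsmul_left, smul_add,
            smul_add, smul_neg, ← mul_smul, ← mul_smul,
            show a * z * (y * y) = (z * y) * (a * y) by ring, mul_smul (z * y), hy,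
            show a * z * y = z * (a * y) by ring, mul_smul z (a * y), hyb]
          abel
        have h2 : (z * d) • D.q m = (z * y) • D.q m + (y * c) • D.q m := by
          have e1 : (z * d) • D.q m = (z * y + (y * c) * (b * z)) • D.q m := by
            conv_lhs => rw [← hy m, ← mul_smul]
            congr 1
            linear_combination (z * y) * hdet
          rw [e1, add_smul, mul_smul (y * c), hz]
        rw [h1]
        simp only [smul_sub, smul_add, _root_.neg_smul, smul_neg, ← mul_smul, h2]
        rw [mul_comm z a]
        abel

end DiscriminantForm

/-! ### Descent on the upper left entry -/

/-- One of the two residues of `b` modulo `a` of absolute value less than `|a|` is not divisible by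
`p`, as they differ by `±a`. -/
theorem exists_residue_not_dvd {p a b : ℤ} (hab : IsCoprime a b) (ha : ¬p ∣ a) (h1 : 1 < |a|) :
    ∃ j : ℤ, b + j * a ≠ 0 ∧ |b + j * a| < |a| ∧ ¬p ∣ b + j * a := by
  have ha0 : a ≠ 0 := by rintro rfl; simp at h1
  have hne : ∀ j, b + j * a ≠ 0 := by
    intro j hj
    have : IsCoprime a (b + j * a) := IsCoprime.add_mul_right_right hab j
    rw [hj, isCoprime_zero_right, Int.isUnit_iff_abs_eq] at this
    omega
  have hr0 := Int.emod_nonneg b ha0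
  have hr1 := Int.emod_lt_abs b ha0
  have hr : b + (-(b / a)) * a = b % a := by
    have := Int.emod_add_mul_ediv b a
    linarith
  by_cases hp : p ∣ b % a
  · rcases abs_cases a with ⟨h, -⟩ | ⟨h, -⟩
    · have e1 : b + (-(b / a) - 1) * a = b % a - a := by linarith
      have h2 := hne (-(b / a) - 1)
      refine ⟨-(b / a) - 1, h2, ?_, ?_⟩
      · have h3 := hne (-(b / a))
        rw [hr] at h3
        rw [e1, abs_lt]
        constructor <;> omega
      · rw [e1]
        intro hd
        exact ha ((Int.dvd_iff_dvd_of_dvd_sub hd).mp hp)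
    · have e1 : b + (-(b / a) + 1) * a = b % a + a := by linarith
      have h2 := hne (-(b / a) + 1)
      refine ⟨-(b / a) + 1, h2, ?_, ?_⟩
      · have h3 := hne (-(b / a))
        rw [hr] at h3
        rw [e1, abs_lt]
        constructor <;> omega
      · rw [e1]
        intro hd
        exact ha ((Int.dvd_add_right hp).mp hd)
  · refine ⟨-(b / a), hne _, ?_, ?_⟩
    · rw [hr, abs_of_nonneg hr0]; exact hr1
    · rw [hr]; exact hp

theorem Mp2Z.sl_mul_S_inv (g : Mp2Z) : (Mp2Z.sl (g * mpS⁻¹)).1 =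
    !![-Mp2Z.sl g 0 1, Mp2Z.sl g 0 0; -Mp2Z.sl g 1 1, Mp2Z.sl g 1 0] := by
  have this := Mp2Z.sl_mul_S (g * mpS⁻¹)
  rw [inv_mul_cancel_right] at this
  rw [this]
  ext i k
  fin_cases i <;> fin_cases k <;> simp

namespace DiscriminantForm
open Mp2Z
variable {A : Type*} [AddCommGroup A] [Fintype A] {D : DiscriminantForm A}
set_option linter.unusedSectionVars false

theorem isCoprime_top_row (g : Mp2Z) : IsCoprime (sl g 0 0) (sl g 0 1) := by
  have := sl_det g
  exact ⟨sl g 1 1, -sl g 1 0, by linarith⟩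

theorem exists_inverse {p : ℕ} (hp : p.Prime) (r : ℕ) {a : ℤ} (ha : ¬(p : ℤ) ∣ a) :
    ∃ y : ℤ, (p : ℤ) ^ r ∣ a * y - 1 := by
  have h1 : IsCoprime a ((p : ℤ) ^ r) :=
    (((Nat.prime_iff_prime_int.mp hp).coprime_iff_not_dvd.mpr ha).symm).pow_right
  obtain ⟨u, v, h⟩ := h1
  exact ⟨u, -v, by linarith⟩

theorem smul_q_of_dvd {N x : ℤ} (hN : ∀ l : A, N • D.q l = 0) (h : N ∣ x - 1) (l : A) :
    x • D.q l = D.q l := by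
  obtain ⟨t, ht⟩ := h
  rw [show x = t * N + 1 by linarith, add_smul, mul_smul, hN, smul_zero, zero_add, one_smul]

variable {p : ℕ} {r : ℕ}

theorem hasFormula_mul_S (hp : p.Prime) (hN : ∀ l : A, ((p : ℤ) ^ r) • D.q l = 0) {g : Mp2Z}
    (ha : ¬(p : ℤ) ∣ sl g 0 0) (hb : ¬(p : ℤ) ∣ sl g 0 1) (h : D.HasFormula g) :
    D.HasFormula (g * mpS) := by
  obtain ⟨y, hy⟩ := exists_inverse hp r ha
  obtain ⟨z, hz⟩ := exists_inverse hp r hb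
  exact (h.mul_S (smul_q_of_dvd hN hy) (smul_q_of_dvd hN hz)).1

/-- The explicit formula holds for a form of `p`-power level whenever `p` does not divide the upper
left entry. -/
theorem hasFormula_of_not_dvd (hp : p.Prime) (hN : ∀ l : A, ((p : ℤ) ^ r) • D.q l = 0) :
    ∀ g : Mp2Z, 0 < sl g 0 0 → ¬(p : ℤ) ∣ sl g 0 0 → D.HasFormula g := by
  have hS2 (g : Mp2Z) (ha : ¬(p : ℤ) ∣ sl g 0 0) (hb : ¬(p : ℤ) ∣ sl g 0 1)
      (h : D.HasFormula g) : D.HasFormula (g * mpS * mpS) := by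
    refine hasFormula_mul_S hp hN ?_ ?_ (hasFormula_mul_S hp hN ha hb h)
    · rw [sl_mul_S]; simpa using hb
    · rw [sl_mul_S]; simpa using ha
  have hZ (g : Mp2Z) (ha : ¬(p : ℤ) ∣ sl g 0 0) (hb : ¬(p : ℤ) ∣ sl g 0 1)
      (h : D.HasFormula g) : D.HasFormula (g * mpS⁻¹) := by
    have hs : g * mpS⁻¹ = g * mpS * mpS * mpS * mpZ ^ 2 := by
      have h8 : mpS ^ 2 * mpZ ^ 2 * mpS ^ 2 = 1 := by
        have := mpZ_pow_four
        rw [mpZ] at *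
        rw [← this]
        group
      have h9 : mpS * mpS * mpS * mpZ ^ 2 = mpS⁻¹ := by
        have hc : mpZ ^ 2 = mpS ^ 4 := by rw [mpZ, ← pow_mul]
        rw [hc] at h8 ⊢
        rw [eq_inv_iff_mul_eq_one, ← h8]
        simp only [pow_succ, pow_zero, one_mul, mul_assoc]
      rw [← h9]
      simp only [mul_assoc]
    rw [hs]
    refine HasFormula.mul_mpZ_sq (hasFormula_mul_S hp hN ?_ ?_ (hS2 g ha hb h))
    · rw [sl_mul_S, sl_mul_S]; simpa using ha
    · rw [sl_mul_S, sl_mul_S]; simpa using hb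
  have hone (g : Mp2Z) (h : sl g 0 0 = 1) : D.HasFormula g := by
    rcases eq_of_apply_zero_zero_eq_one h with h1 | h1 <;> rw [h1]
    · simpa using (hasFormula_one.L_mul (sl g 1 0)).mul_T (sl g 0 1)
    · simpa using ((hasFormula_one.L_mul (sl g 1 0)).mul_T (sl g 0 1)).mul_mpZ_sq
  have key : ∀ (n : ℕ) (g : Mp2Z), (sl g 0 0).natAbs ≤ n → 0 < sl g 0 0 → ¬(p : ℤ) ∣ sl g 0 0 →
      D.HasFormula g := by
    intro n
    induction n with
    | zero => intro g hg h0; omega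
    | succ n ih =>
      intro g hg ha0 ha
      by_cases h1 : sl g 0 0 = 1
      · exact hone g h1
      obtain ⟨j, hj0, hj1, hj2⟩ := exists_residue_not_dvd (isCoprime_top_row g) ha
        (by rw [abs_of_pos ha0]; omega)
      rw [abs_of_pos ha0] at hj1
      suffices h3 : D.HasFormula (g * mpT ^ j) by
        have := h3.mul_T (-j)
        rwa [mul_assoc, ← zpow_add, add_neg_cancel, zpow_zero, mul_one] at this
      have e00 : sl (g * mpT ^ j) 0 0 = sl g 0 0 := by rw [sl_mul_T]; simp
      have e01 : sl (g * mpT ^ j) 0 1 = sl g 0 1 + j * sl g 0 0 := by rw [sl_mul_T]; simp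
      rcases lt_or_gt_of_ne hj0 with hneg | hpos
      · rw [abs_of_neg hneg] at hj1
        have u00 : sl (g * mpT ^ j * mpS⁻¹) 0 0 = -(sl g 0 1 + j * sl g 0 0) := by
          rw [sl_mul_S_inv]; simp only [← e01]; simp
        have u01 : sl (g * mpT ^ j * mpS⁻¹) 0 1 = sl g 0 0 := by
          rw [sl_mul_S_inv]; simp only [← e00]; simp
        have h := hasFormula_mul_S hp hN (by rw [u00, dvd_neg]; exact hj2) (by rw [u01]; exact ha)
          (ih _ (by omega) (by omega) (by rw [u00, dvd_neg]; exact hj2))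
        rwa [inv_mul_cancel_right] at h
      · rw [abs_of_pos hpos] at hj1
        have u00 : sl (g * mpT ^ j * mpS) 0 0 = sl g 0 1 + j * sl g 0 0 := by
          rw [sl_mul_S]; simp only [← e01]; simp
        have u01 : sl (g * mpT ^ j * mpS) 0 1 = -sl g 0 0 := by
          rw [sl_mul_S]; simp only [← e00]; simp
        have h := hZ _ (by rw [u00]; exact hj2) (by rw [u01, dvd_neg]; exact ha)
          (ih _ (by omega) (by omega) (by rw [u00]; exact hj2))
        rwa [mul_inv_cancel_right] at h
  exact fun g => key _ g le_rfl

theorem psi_mul_S (hp : p.Prime) (hN : ∀ l : A, ((p : ℤ) ^ r) • D.q l = 0) {g : Mp2Z}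
    (ha0 : 0 < sl g 0 0) (ha : ¬(p : ℤ) ∣ sl g 0 0) (hb : ¬(p : ℤ) ∣ sl g 0 1) {y : ℤ}
    (hy : (p : ℤ) ^ r ∣ sl g 0 0 * y - 1) :
    D.psi (g * mpS) = D.sConst * D.gauss (y * sl g 0 1) * D.psi g := by
  obtain ⟨z, hz⟩ := exists_inverse hp r hb
  exact ((hasFormula_of_not_dvd hp hN g ha0 ha).mul_S (smul_q_of_dvd hN hy) (smul_q_of_dvd hN hz)).2

/-- The recursion satisfied by `psi` determines it on the elements with positive upper left entry
prime to `p`. -/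
theorem psi_eq_of_recursion (hp : p.Prime) (hN : ∀ l : A, ((p : ℤ) ^ r) • D.q l = 0)
    (F : Mp2Z → ℂ) (hG : ∀ x : ℤ, ¬(p : ℤ) ∣ x → D.gauss x ≠ 0)
    (hT : ∀ (g : Mp2Z) (j : ℤ), 0 < sl g 0 0 → ¬(p : ℤ) ∣ sl g 0 0 → F (g * mpT ^ j) = F g)
    (hS : ∀ g, 0 < sl g 0 0 → ¬(p : ℤ) ∣ sl g 0 0 → 0 < sl g 0 1 → ¬(p : ℤ) ∣ sl g 0 1 →
      ∃ y : ℤ, (p : ℤ) ^ r ∣ sl g 0 0 * y - 1 ∧ ¬(p : ℤ) ∣ y ∧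
        F (g * mpS) = D.sConst * D.gauss (y * sl g 0 1) * F g)
    (h1 : ∀ g, sl g 0 0 = 1 → F g = D.psi g) :
    ∀ g, 0 < sl g 0 0 → ¬(p : ℤ) ∣ sl g 0 0 → F g = D.psi g := by
  have hstep (g : Mp2Z) (ha : 0 < sl g 0 0) (ha' : ¬(p : ℤ) ∣ sl g 0 0) (hb : 0 < sl g 0 1)
      (hb' : ¬(p : ℤ) ∣ sl g 0 1) : F (g * mpS) = D.psi (g * mpS) ↔ F g = D.psi g := by
    obtain ⟨y, hy, hpy, hF⟩ := hS g ha ha' hb hb'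
    rw [hF, psi_mul_S hp hN ha ha' hb' hy]
    refine mul_right_inj' (mul_ne_zero D.sConst_ne_zero (hG _ ?_))
    intro hd
    rcases (Nat.prime_iff_prime_int.mp hp).dvd_or_dvd hd with h | h
    · exact hpy h
    · exact hb' h
  have key : ∀ (n : ℕ) (g : Mp2Z), (sl g 0 0).natAbs ≤ n → 0 < sl g 0 0 → ¬(p : ℤ) ∣ sl g 0 0 →
      F g = D.psi g := by
    intro n
    induction n with
    | zero => intro g hg h0; omega
    | succ n ih =>
      intro g hg ha0 ha
      by_cases hone : sl g 0 0 = 1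
      · exact h1 g hone
      obtain ⟨j, hj0, hj1, hj2⟩ := exists_residue_not_dvd (isCoprime_top_row g) ha
        (by rw [abs_of_pos ha0]; omega)
      rw [← hT g j ha0 ha, ← psi_mul_T g j]
      rw [abs_of_pos ha0] at hj1
      have e00 : sl (g * mpT ^ j) 0 0 = sl g 0 0 := by rw [sl_mul_T]; simp
      have e01 : sl (g * mpT ^ j) 0 1 = sl g 0 1 + j * sl g 0 0 := by rw [sl_mul_T]; simp
      rcases lt_or_gt_of_ne hj0 with hneg | hpos
      · -- for a negative entry descend along `S⁻¹`
        set u := g * mpT ^ j * mpS⁻¹ with hu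
        have hus : u * mpS = g * mpT ^ j := by rw [hu, inv_mul_cancel_right]
        have u00 : sl u 0 0 = -(sl g 0 1 + j * sl g 0 0) := by
          rw [hu, sl_mul_S_inv]; simp only [← e01]; simp
        have m00 : sl u 0 1 = sl g 0 0 := by
          rw [hu, sl_mul_S_inv]; simp only [← e00]; simp
        rw [abs_of_neg hneg] at hj1
        rw [← hus]
        refine (hstep u (by omega) (by rw [u00, dvd_neg]; exact hj2) (by omega)
          (by rw [m00]; exact ha)).mpr (ih u (by omega) (by omega)
            (by rw [u00, dvd_neg]; exact hj2))
      · rw [abs_of_pos hpos] at hj1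
        have m00 : sl (g * mpT ^ j * mpS) 0 0 = sl g 0 1 + j * sl g 0 0 := by
          rw [sl_mul_S]; simp only [← e01]; simp
        refine (hstep (g * mpT ^ j) (by omega) (by rw [e00]; exact ha) (by omega)
          (by rw [e01]; exact hj2)).mp (ih _ (by omega) (by omega) (by rw [m00]; exact hj2))
  exact fun g => key _ g le_rfl

end DiscriminantForm

/-! ### Conjugation by `α` -/

theorem alpha_mat_val (m : ℕ+) : (alpha m).mat.1 = !![(m : ℝ) ^ 2, 0; 0, 1] := rfl

theorem alpha_phi (m : ℕ+) (τ : ℍ) : (alpha m).phi τ = 1 := rfl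

theorem coe_alpha_act (m : ℕ+) (τ : ℍ) : ((alpha m).act τ : ℂ) = (m : ℂ) ^ 2 * τ := by
  rw [MetaGL.act, coe_smul_of_det_pos (alpha m).det_pos, num, denom, alpha_mat_val]
  simp

/-- The relation `γα = αγ'` between elements of the integral metaplectic group. -/
def AlphaRel (m : ℕ+) (g g' : Mp2Z) : Prop := g.1 * alpha m = alpha m * g'.1

namespace AlphaRel
variable {m : ℕ+} {g g' h h' : Mp2Z}

theorem mul (h1 : AlphaRel m g g') (h2 : AlphaRel m h h') : AlphaRel m (g * h) (g' * h') := by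
  rw [AlphaRel] at *
  rw [Subgroup.coe_mul, Subgroup.coe_mul, mul_assoc, h2, ← mul_assoc, h1, mul_assoc]

theorem inv (h1 : AlphaRel m g g') : AlphaRel m g⁻¹ g'⁻¹ := by
  rw [AlphaRel] at *
  rw [Subgroup.coe_inv, Subgroup.coe_inv, inv_mul_eq_iff_eq_mul, ← mul_assoc, h1,
    mul_inv_cancel_right]

theorem entries (h1 : AlphaRel m g g') : Mp2Z.sl g 0 0 = Mp2Z.sl g' 0 0 ∧
    Mp2Z.sl g 0 1 = (m : ℤ) ^ 2 * Mp2Z.sl g' 0 1 ∧ Mp2Z.sl g' 1 0 = (m : ℤ) ^ 2 * Mp2Z.sl g 1 0 ∧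
    Mp2Z.sl g 1 1 = Mp2Z.sl g' 1 1 := by
  have h2 : g.1.mat.1 * (alpha m).mat.1 = (alpha m).mat.1 * g'.1.mat.1 :=
    congrArg (fun x : MetaGL => x.mat.1) h1
  rw [← Mp2Z.mapGL_sl, ← Mp2Z.mapGL_sl, alpha_mat_val] at h2
  have hm : ((m : ℕ) : ℝ) ≠ 0 := by positivity
  have h00 := congrFun (congrFun h2 0) 0
  have h01 := congrFun (congrFun h2 0) 1
  have h10 := congrFun (congrFun h2 1) 0
  have h11 := congrFun (congrFun h2 1) 1
  simp [Matrix.mul_apply, Fin.sum_univ_two, Matrix.SpecialLinearGroup.mapGL_coe_matrix, mul_comm,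
    hm] at h00 h01 h10 h11
  refine ⟨h00, ?_, ?_, h11⟩
  · exact_mod_cast h01
  · exact_mod_cast h10.symm

theorem phi (h1 : AlphaRel m g g') (τ : ℍ) : g'.1.phi τ = g.1.phi ((alpha m).act τ) := by
  have := congrArg (fun x : MetaGL => x.phi τ) h1
  simp only [MetaGL.mul_phi_act, alpha_phi, one_mul, mul_one] at this
  exact this.symm

theorem exists_of_dvd (m : ℕ+) (g : Mp2Z) (hd : (m : ℤ) ^ 2 ∣ Mp2Z.sl g 0 1) :
    ∃ g', AlphaRel m g g' := by
  obtain ⟨t, ht⟩ := hd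
  have hdet := Mp2Z.sl_det g
  obtain ⟨M, hMv⟩ : ∃ M : SL(2, ℤ), M.1 =
      !![Mp2Z.sl g 0 0, t; (m : ℤ) ^ 2 * Mp2Z.sl g 1 0, Mp2Z.sl g 1 1] := by
    refine ⟨⟨_, ?_⟩, rfl⟩
    rw [Matrix.det_fin_two_of]
    rw [ht] at hdet
    linarith
  have hM : (alpha m)⁻¹ * g.1 * alpha m ∈ Mp2Z := by
    refine ⟨M, ?_⟩
    change _ = (alpha m).mat⁻¹ * g.1.mat * (alpha m).mat
    rw [mul_assoc, eq_inv_mul_iff_mul_eq, ← Mp2Z.mapGL_sl g]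
    apply Units.ext
    have ht' : (Mp2Z.sl g 0 1 : ℝ) = (m : ℝ) ^ 2 * t := by exact_mod_cast ht
    rw [Units.val_mul, Units.val_mul, alpha_mat_val, Matrix.SpecialLinearGroup.mapGL_coe_matrix,
      Matrix.SpecialLinearGroup.mapGL_coe_matrix]
    ext i j
    fin_cases i <;> fin_cases j <;>
      simp [Matrix.mul_apply, Fin.sum_univ_two, hMv, ht', mul_comm]
  exact ⟨⟨_, hM⟩, by simp [AlphaRel, mul_assoc]⟩

end AlphaRel

namespace DiscriminantForm
open Mp2Z
variable {A : Type*} [AddCommGroup A] [Fintype A] {D : DiscriminantForm A}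
set_option linter.unusedSectionVars false

/-! ### Gauss sums of forms of prime power order -/

theorem gauss_congr {N : ℤ} (hN : ∀ l : A, N • D.q l = 0) {x y : ℤ} (h : N ∣ x - y) :
    D.gauss x = D.gauss y := by
  obtain ⟨t, ht⟩ := h
  refine Finset.sum_congr rfl fun l _ => ?_
  rw [show x = t * N + y by linarith, add_smul, mul_smul, hN, smul_zero, zero_add]

theorem gauss_mul_sq {u : ℤ} (hu : IsCoprime u (Fintype.card A : ℤ)) (x : ℤ) :
    D.gauss (x * u ^ 2) = D.gauss x := by
  have hinj : Function.Injective (fun k : A => u • k) := by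
    obtain ⟨r, s, h⟩ := hu
    intro a b (hab : u • a = u • b)
    have key (z : A) : r • u • z = z := by
      rw [← mul_smul, show r * u = 1 - s * (Fintype.card A : ℤ) by linarith, sub_smul, one_smul,
        mul_smul, card_zsmul, smul_zero, sub_zero]
    rw [← key a, ← key b, hab]
  rw [gauss, gauss, ← (Equiv.ofBijective _ (Finite.injective_iff_bijective.mp hinj)).sum_comp
    (fun l => e (x • D.q l))]
  refine Finset.sum_congr rfl fun l _ => ?_
  rw [Equiv.ofBijective_apply, q_zsmul, ← mul_smul, pow_two]

theorem card_zsmul_q_of_odd (h : Odd (Fintype.card A)) (l : A) :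
    (Fintype.card A : ℤ) • D.q l = 0 := by
  obtain ⟨t, ht⟩ := h
  have h1 : ((Fintype.card A : ℤ) * Fintype.card A) • D.q l = 0 := by
    rw [← q_zsmul, card_zsmul, q_zero]
  have h2 := D.two_card_zsmul_q l
  have h3 : (Fintype.card A : ℤ) = Fintype.card A * Fintype.card A - t * (2 * Fintype.card A) := by
    rw [ht]; push_cast; ring
  rw [h3, sub_smul, h1, mul_smul, h2, smul_zero, sub_zero]

section OddPrime

variable {p k : ℕ}

/-- An integer congruent to one modulo an odd prime is a square modulo any power of the prime. -/
theorem exists_sq_of_dvd_sub_one (hp2 : p ≠ 2) (hp : p.Prime) (k : ℕ) {x : ℤ}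
    (h : (p : ℤ) ∣ x - 1) : ∃ u : ℤ, ¬(p : ℤ) ∣ u ∧ (p : ℤ) ^ k ∣ x - u ^ 2 := by
  have hodd : Odd (p ^ k) := (hp.odd_of_ne_two hp2).pow
  obtain ⟨t, ht⟩ := hodd
  have hx : ¬(p : ℤ) ∣ x := fun hd =>
    (Nat.prime_iff_prime_int.mp hp).not_dvd_one ((Int.dvd_iff_dvd_of_dvd_sub h).mp hd)
  refine ⟨x ^ (t + 1), fun hd => hx ((Nat.prime_iff_prime_int.mp hp).dvd_of_dvd_pow hd), ?_⟩
  have h1 : (p : ℤ) ^ (k + 1) ∣ x ^ p ^ k - 1 ^ p ^ k := dvd_sub_pow_of_dvd_sub h k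
  rw [one_pow, ht] at h1
  have h2 : (p : ℤ) ^ k ∣ x ^ (2 * t + 1) - 1 := (pow_dvd_pow _ (Nat.le_succ k)).trans h1
  have h3 : x - (x ^ (t + 1)) ^ 2 = -x * (x ^ (2 * t + 1) - 1) := by ring
  rw [h3]
  exact h2.mul_left _

theorem isCoprime_card (hp : p.Prime) (hA : Fintype.card A = p ^ k) {u : ℤ} (hu : ¬(p : ℤ) ∣ u) :
    IsCoprime u (Fintype.card A : ℤ) := by
  rw [hA, Nat.cast_pow]
  exact (((Nat.prime_iff_prime_int.mp hp).coprime_iff_not_dvd.mpr hu).symm).pow_right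

theorem gauss_mul_of_dvd_sub_one (hp2 : p ≠ 2) (hp : p.Prime) (hA : Fintype.card A = p ^ k) {z : ℤ}
    (hz : (p : ℤ) ∣ z - 1) (x : ℤ) : D.gauss (x * z) = D.gauss x := by
  obtain ⟨u, hu, hd⟩ := exists_sq_of_dvd_sub_one hp2 hp k hz
  rw [← gauss_mul_sq (isCoprime_card hp hA hu) x]
  refine gauss_congr (card_zsmul_q_of_odd ?_) ?_
  · rw [hA]; exact (hp.odd_of_ne_two hp2).pow
  · rw [hA, Nat.cast_pow, ← mul_sub]
    exact hd.mul_left _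

/-- Gauss sums of forms of odd prime power order only change by squares. -/
theorem gauss_mul_of_dvd_sub_sq (hp2 : p ≠ 2) (hp : p.Prime) (hA : Fintype.card A = p ^ k)
    {z v : ℤ} (hv : ¬(p : ℤ) ∣ v) (hz : (p : ℤ) ∣ z - v ^ 2) (x : ℤ) :
    D.gauss (x * z) = D.gauss x := by
  obtain ⟨w, hw⟩ := exists_inverse hp 1 hv
  rw [pow_one] at hw
  have hw' : ¬(p : ℤ) ∣ w := fun hd =>
    (Nat.prime_iff_prime_int.mp hp).not_dvd_one
      ((Int.dvd_iff_dvd_of_dvd_sub hw).mp (hd.mul_left v))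
  rw [← gauss_mul_sq (isCoprime_card hp hA hw') (x * z), mul_assoc]
  refine gauss_mul_of_dvd_sub_one hp2 hp hA ?_ x
  have h2 : z * w ^ 2 - 1 = (z - v ^ 2) * w ^ 2 + (v * w - 1) * (v * w + 1) := by ring
  rw [h2]
  exact dvd_add (hz.mul_right _) (hw.mul_right _)

/-- Every residue class modulo `p` is a sum of two squares. -/
theorem gauss_sq_of_not_dvd (hp2 : p ≠ 2) (hp : p.Prime) (hA : Fintype.card A = p ^ k) {x : ℤ}
    (hx : ¬(p : ℤ) ∣ x) : D.gauss x ^ 2 = D.gauss 1 ^ 2 := by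
  have : Fact p.Prime := ⟨hp⟩
  obtain ⟨a, b, hab⟩ := ZMod.sq_add_sq p (x : ZMod p)
  obtain ⟨u, rfl⟩ := ZMod.intCast_surjective a
  obtain ⟨v, rfl⟩ := ZMod.intCast_surjective b
  have h1 : (p : ℤ) ∣ x - (u ^ 2 + v ^ 2) := by
    rw [← ZMod.intCast_zmod_eq_zero_iff_dvd]
    push_cast
    rw [hab, sub_self]
  have h2 : ¬(p : ℤ) ∣ u ^ 2 + v ^ 2 := fun hd => hx ((Int.dvd_iff_dvd_of_dvd_sub h1).mpr hd)
  rw [← D.gauss_sq_of_sum_two_squares u v (isCoprime_card hp hA h2)]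
  obtain ⟨w, hw⟩ := exists_inverse hp 1 h2
  rw [pow_one] at hw
  have h3 : D.gauss ((u ^ 2 + v ^ 2) * (w * x)) = D.gauss (u ^ 2 + v ^ 2) := by
    refine gauss_mul_of_dvd_sub_one hp2 hp hA ?_ _
    have e1 : w * x - 1 = w * (x - (u ^ 2 + v ^ 2)) + ((u ^ 2 + v ^ 2) * w - 1) := by ring
    rw [e1]
    exact dvd_add (h1.mul_left _) hw
  have h4 : D.gauss (x * ((u ^ 2 + v ^ 2) * w)) = D.gauss x :=
    gauss_mul_of_dvd_sub_one hp2 hp hA hw _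
  rw [← h3, ← h4]
  congr 2
  ring

/-- The ratio `G(x)/G(1)`. For odd prime power order it is a quadratic character. -/
def gaussRatio (D : DiscriminantForm A) (x : ℤ) : ℂ := D.sConst * D.gauss x

theorem gaussRatio_one : D.gaussRatio 1 = 1 := D.sConst_mul_gauss

theorem gaussRatio_eq_one_or (hp2 : p ≠ 2) (hp : p.Prime) (hA : Fintype.card A = p ^ k) {x : ℤ}
    (hx : ¬(p : ℤ) ∣ x) : D.gaussRatio x = 1 ∨ D.gaussRatio x = -1 := by
  rw [← sq_eq_one_iff, gaussRatio, mul_pow, gauss_sq_of_not_dvd hp2 hp hA hx, ← mul_pow,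
    sConst_mul_gauss, one_pow]

theorem gaussRatio_mul (hp2 : p ≠ 2) (hp : p.Prime) (hA : Fintype.card A = p ^ k) {x y : ℤ}
    (hx : ¬(p : ℤ) ∣ x) (hy : ¬(p : ℤ) ∣ y) :
    D.gaussRatio (x * y) = D.gaussRatio x * D.gaussRatio y := by
  have : Fact p.Prime := ⟨hp⟩
  have hsq (z : ℤ) (hz : ¬(p : ℤ) ∣ z) (h : IsSquare (z : ZMod p)) (t : ℤ) :
      D.gaussRatio (t * z) = D.gaussRatio t := by
    obtain ⟨v, hv⟩ := h
    obtain ⟨v, rfl⟩ := ZMod.intCast_surjective v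
    have h1 : (p : ℤ) ∣ z - v ^ 2 := by
      rw [← ZMod.intCast_zmod_eq_zero_iff_dvd]
      push_cast
      rw [hv, pow_two, sub_self]
    have h2 : ¬(p : ℤ) ∣ v := fun hd =>
      hz ((Int.dvd_iff_dvd_of_dvd_sub h1).mpr (hd.trans (dvd_pow_self v two_ne_zero)))
    rw [gaussRatio, gauss_mul_of_dvd_sub_sq hp2 hp hA h2 h1, gaussRatio]
  have hsq1 (z : ℤ) (hz : ¬(p : ℤ) ∣ z) (h : IsSquare (z : ZMod p)) : D.gaussRatio z = 1 := by
    have := hsq z hz h 1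
    rwa [one_mul, gaussRatio_one] at this
  have hne (z : ℤ) (hz : ¬(p : ℤ) ∣ z) : (z : ZMod p) ≠ 0 :=
    fun h => hz ((ZMod.intCast_zmod_eq_zero_iff_dvd z p).mp h)
  by_cases h1 : IsSquare (y : ZMod p)
  · rw [hsq y hy h1, hsq1 y hy h1, mul_one]
  by_cases h2 : IsSquare (x : ZMod p)
  · rw [mul_comm x, hsq x hx h2, hsq1 x hx h2, one_mul]
  have hxy : ¬(p : ℤ) ∣ x * y := fun hd => by
    rcases (Nat.prime_iff_prime_int.mp hp).dvd_or_dvd hd with h | h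
    · exact hx h
    · exact hy h
  have h3 : IsSquare ((x * y : ℤ) : ZMod p) := by
    push_cast
    rw [← quadraticChar_neg_one_iff_not_isSquare] at h1 h2
    rw [← quadraticChar_one_iff_isSquare, map_mul, h1, h2]
    · norm_num
    · exact mul_ne_zero (hne x hx) (hne y hy)
  have h4 : D.gaussRatio x = D.gaussRatio y := by
    have e1 := hsq _ hxy h3 y
    rw [← e1, gaussRatio, gaussRatio, ← gauss_mul_sq (isCoprime_card hp hA hy) x]
    congr 2
    ring
  rw [hsq1 _ hxy h3, h4]
  rcases gaussRatio_eq_one_or (D := D) hp2 hp hA hy with h | h <;> rw [h] <;> norm_num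

theorem gaussRatio_neg_one : D.gaussRatio (-1) = D.sConst ^ 2 * Fintype.card A := by
  have hn := card_ne_zero (A := A)
  rw [gaussRatio, gauss_neg, pow_two, mul_assoc]
  congr 1
  rw [sConst]
  field_simp

/-- The function `psi` for forms of odd prime power order. -/
theorem psi_of_odd_prime (hp2 : p ≠ 2) (hp : p.Prime) (hA : Fintype.card A = p ^ k) {g : Mp2Z}
    (h0 : 0 < sl g 0 0) (h : ¬(p : ℤ) ∣ sl g 0 0) : D.psi g = D.gaussRatio (sl g 0 0) := by
  have hN : ∀ l : A, ((p : ℤ) ^ k) • D.q l = 0 := by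
    have := card_zsmul_q_of_odd (D := D) (by rw [hA]; exact (hp.odd_of_ne_two hp2).pow)
    rwa [hA, Nat.cast_pow] at this
  refine (psi_eq_of_recursion hp hN (fun g => D.gaussRatio (sl g 0 0)) ?_ ?_ ?_ ?_ g h0 h).symm
  · intro x hx h0
    rcases gaussRatio_eq_one_or (D := D) hp2 hp hA hx with h | h <;> simp [gaussRatio, h0] at h
  · intro g j _ _
    simp only [sl_mul_T]; simp
  · intro g h0 h hb0 hb
    obtain ⟨y, hy⟩ := exists_inverse hp (k + 1) h
    have hy1 : (p : ℤ) ∣ sl g 0 0 * y - 1 := (dvd_pow_self _ (Nat.succ_ne_zero k)).trans hy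
    have hy2 : ¬(p : ℤ) ∣ y := fun hd =>
      (Nat.prime_iff_prime_int.mp hp).not_dvd_one
        ((Int.dvd_iff_dvd_of_dvd_sub hy1).mp (hd.mul_left _))
    have hyk := (pow_dvd_pow (p : ℤ) (Nat.le_succ k)).trans hy
    refine ⟨y, hyk, hy2, ?_⟩
    have hyb : ¬(p : ℤ) ∣ y * sl g 0 1 := fun hd => by
      rcases (Nat.prime_iff_prime_int.mp hp).dvd_or_dvd hd with h | h
      · exact hy2 h
      · exact hb h
    have e1 : D.gaussRatio (sl (g * mpS) 0 0) = D.gaussRatio (y * sl g 0 1 * sl g 0 0) := by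
      rw [gaussRatio, gaussRatio]
      congr 1
      refine gauss_congr hN ?_
      simp only [sl_mul_S]
      simp only [Matrix.of_apply, Matrix.cons_val', Matrix.cons_val_zero, Matrix.cons_val_fin_one]
      have : sl g 0 1 - y * sl g 0 1 * sl g 0 0 = -sl g 0 1 * (sl g 0 0 * y - 1) := by ring
      rw [this]
      exact hyk.mul_left _
    rw [e1, gaussRatio_mul hp2 hp hA hyb h]
    rfl
  · intro g h1
    have hp1 : ¬(p : ℤ) ∣ -1 := by
      rw [dvd_neg]
      exact (Nat.prime_iff_prime_int.mp hp).not_dvd_one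
    have hz : (D.sConst ^ 2 * Fintype.card A) ^ 2 = 1 := by
      rw [← gaussRatio_neg_one]
      rcases gaussRatio_eq_one_or (D := D) hp2 hp hA hp1 with h | h <;> rw [h] <;> norm_num
    have hLT : D.psi (mpL ^ (sl g 1 0) * mpT ^ (sl g 0 1)) = 1 := by
      have := psi_L_mul (D := D) 1 (sl g 1 0)
      rw [mul_one, psi_one] at this
      rw [psi_mul_T, this]
    rw [h1, gaussRatio_one]
    rcases eq_of_apply_zero_zero_eq_one h1 with h2 | h2
    · rw [h2, hLT]
    · rw [h2, psi_mul_mpZ_sq, hLT, hz, mul_one]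

end OddPrime

end DiscriminantForm

/-! ### The sign of a metaplectic lift -/

theorem csqrt_sq_mul (m : ℕ+) {z : ℂ} (hz : 0 < z.im) : csqrt ((m : ℂ) ^ 2 * z) = m * csqrt z := by
  have hm : (0 : ℝ) < (m : ℕ) := by positivity
  symm
  refine eq_csqrt_of_sq_eq ?_ (by rw [mul_pow, csqrt_sq]) (Or.inl ?_)
  · rw [show ((m : ℂ) ^ 2 * z) = (((m : ℝ) ^ 2 : ℝ) : ℂ) * z by push_cast; rfl,
      Complex.im_ofReal_mul]
    positivity
  · have : ((m : ℂ) * csqrt z).im = (m : ℝ) * (csqrt z).im := by simp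
    rw [this]
    exact mul_pos hm (csqrt_im_pos hz)

namespace Mp2Z

/-- The ratio of `φ` and the principal branch of `√(cτ+d)`. It is a sign if `c > 0`. -/
def branchSign (g : Mp2Z) : ℂ :=
  g.1.phi UpperHalfPlane.I / csqrt ((sl g 1 0 : ℂ) * UpperHalfPlane.I + (sl g 1 1 : ℂ))

theorem im_affine_pos {c : ℤ} (hc : 0 < c) (d : ℂ) (hd : d.im = 0) (τ : ℍ) :
    0 < ((c : ℂ) * τ + d).im := by
  have : (0 : ℝ) < c := by exact_mod_cast hc
  simp [hd, mul_pos this τ.im_pos]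

theorem csqrt_ne_zero {z : ℂ} (hz : z ≠ 0) : csqrt z ≠ 0 := by
  intro h
  have := csqrt_sq z
  rw [h] at this
  exact hz (by simpa using this.symm)

theorem ne_zero_of_im_pos {z : ℂ} (hz : 0 < z.im) : z ≠ 0 := by rintro rfl; simp at hz

theorem exists_sign (g : Mp2Z) (hc : 0 < sl g 1 0) : ∃ ε : ℂ, (ε = 1 ∨ ε = -1) ∧
    ∀ τ : ℍ, g.1.phi τ = ε * csqrt ((sl g 1 0 : ℂ) * τ + (sl g 1 1 : ℂ)) := by
  have him (τ : ℍ) : 0 < ((sl g 1 0 : ℂ) * τ + (sl g 1 1 : ℂ)).im := im_affine_pos hc _ (by simp) τ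
  have hg : Continuous g.1.phi := g.1.holo.continuous
  have hh : Continuous (fun τ : ℍ => csqrt ((sl g 1 0 : ℂ) * τ + (sl g 1 1 : ℂ))) := by
    rw [continuous_iff_continuousAt]
    intro τ
    exact ContinuousAt.cpow (by fun_prop) continuousAt_const (Or.inr (him τ).ne')
  have := (isPreconnected_univ (α := ℍ)).eq_or_eq_neg_of_sq_eq hg.continuousOn hh.continuousOn
    (fun τ _ => by
      simp only [Pi.pow_apply]
      rw [phi_sq, csqrt_sq]) (fun {τ} _ => csqrt_ne_zero (ne_zero_of_im_pos (him τ)))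
  rcases this with h | h
  · exact ⟨1, Or.inl rfl, fun τ => by rw [h (Set.mem_univ τ), one_mul]⟩
  · exact ⟨-1, Or.inr rfl, fun τ => by rw [h (Set.mem_univ τ)]; simp⟩

theorem branchSign_eq {g : Mp2Z} (hc : 0 < sl g 1 0) {ε : ℂ} {τ : ℍ}
    (h : g.1.phi τ = ε * csqrt ((sl g 1 0 : ℂ) * τ + (sl g 1 1 : ℂ))) : branchSign g = ε := by
  obtain ⟨ε', -, h'⟩ := exists_sign g hc
  have hne (τ : ℍ) := csqrt_ne_zero (ne_zero_of_im_pos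
    (im_affine_pos hc (sl g 1 1 : ℂ) (by simp) τ))
  rw [branchSign, h', mul_div_cancel_right₀ _ (hne _)]
  exact mul_right_cancel₀ (hne τ) ((h' τ).symm.trans h)

theorem phi_eq_branchSign {g : Mp2Z} (hc : 0 < sl g 1 0) (τ : ℍ) :
    g.1.phi τ = branchSign g * csqrt ((sl g 1 0 : ℂ) * τ + (sl g 1 1 : ℂ)) := by
  obtain ⟨ε', -, h'⟩ := exists_sign g hc
  rw [branchSign_eq hc (h' τ), h']

theorem coe_mpT_zpow_act (j : ℤ) (τ : ℍ) : (((mpT ^ j).1.act τ : ℍ) : ℂ) = τ + j := by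
  rw [act_eq, map_zpow, sl_mpT, modular_T_zpow_smul]
  simp [add_comm]

theorem mpT_zpow_phi (j : ℤ) (τ : ℍ) : (mpT ^ j).1.phi τ = 1 := by
  have hn (n : ℕ) : ∀ τ, (mpT ^ n).1.phi τ = 1 := by
    induction n with
    | zero => intro τ; rfl
    | succ n ih =>
      intro τ
      rw [pow_succ, Subgroup.coe_mul, MetaGL.mul_phi_act, ih, mpT_phi, mul_one]
  obtain ⟨n, rfl | rfl⟩ := j.eq_nat_or_neg
  · rw [zpow_natCast]; exact hn n τ
  · have h2 : (mpT ^ n * mpT ^ (-(n : ℤ))).1.phi τ = 1 := by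
      rw [zpow_neg, zpow_natCast, mul_inv_cancel]; rfl
    rwa [Subgroup.coe_mul, MetaGL.mul_phi_act, hn, one_mul] at h2

theorem sl_S_mul (g : Mp2Z) : (sl (mpS * g)).1 =
    !![-sl g 1 0, -sl g 1 1; sl g 0 0, sl g 0 1] := by
  ext i k
  rw [sl_mul_apply mpS g i k, sl_mpS_val]
  fin_cases i <;> fin_cases k <;> simp

theorem sl_S_mul_one (g : Mp2Z) :
    sl (mpS * g) 1 0 = sl g 0 0 ∧ sl (mpS * g) 1 1 = sl g 0 1 := by
  rw [sl_S_mul]; simp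

/-- For `γ = (a, b; c, d)` with `a > 0`, the sign by which the canonical square root of `aτ+b`
differs from `√(γτ) φ(τ)`. -/
def topSign (g : Mp2Z) : ℂ := branchSign (mpS * g)

theorem topSign_spec {g : Mp2Z} (ha : 0 < sl g 0 0) (τ : ℍ) :
    (mpS * g).1.phi τ = topSign g * csqrt ((sl g 0 0 : ℂ) * τ + (sl g 0 1 : ℂ)) := by
  have := phi_eq_branchSign (g := mpS * g) (by rw [(sl_S_mul_one g).1]; exact ha) τ
  rwa [(sl_S_mul_one g).1, (sl_S_mul_one g).2] at this

theorem topSign_eq {g : Mp2Z} (ha : 0 < sl g 0 0) {ε : ℂ} {τ : ℍ}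
    (h : (mpS * g).1.phi τ = ε * csqrt ((sl g 0 0 : ℂ) * τ + (sl g 0 1 : ℂ))) :
    topSign g = ε :=
  branchSign_eq (by rw [(sl_S_mul_one g).1]; exact ha)
    (by rw [(sl_S_mul_one g).1, (sl_S_mul_one g).2]; exact h)

theorem topSign_mul_T {g : Mp2Z} (ha : 0 < sl g 0 0) (j : ℤ) :
    topSign (g * mpT ^ j) = topSign g := by
  have e00 : sl (g * mpT ^ j) 0 0 = sl g 0 0 := by rw [sl_mul_T]; simp
  have e01 : sl (g * mpT ^ j) 0 1 = sl g 0 1 + j * sl g 0 0 := by rw [sl_mul_T]; simp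
  refine topSign_eq (τ := UpperHalfPlane.I) (by rw [e00]; exact ha) ?_
  rw [← mul_assoc, Subgroup.coe_mul, MetaGL.mul_phi_act, topSign_spec ha, coe_mpT_zpow_act,
    mpT_zpow_phi, mul_one, e00, e01]
  push_cast
  ring_nf

/-- For `a, b > 0` the canonical square roots before and after multiplication by `S` are compatible:
`√(aS(τ)+b) √τ = √(bτ-a)`. -/
theorem topSign_mul_S {g : Mp2Z} (ha : 0 < sl g 0 0) (hb : 0 < sl g 0 1) :
    topSign (g * mpS) = topSign g := by
  have e00 : sl (g * mpS) 0 0 = sl g 0 1 := by rw [sl_mul_S]; simp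
  have e01 : sl (g * mpS) 0 1 = -sl g 0 0 := by rw [sl_mul_S]; simp
  refine topSign_eq (τ := UpperHalfPlane.I) (by rw [e00]; exact hb) ?_
  set τ := UpperHalfPlane.I
  have hτ : (τ : ℂ) ≠ 0 := τ.ne_zero
  have e : ((sl g 0 0 : ℂ) * ((mpS.1.act τ : ℍ) : ℂ) + (sl g 0 1 : ℂ)) * τ =
      (sl g 0 1 : ℂ) * τ + ((-sl g 0 0 : ℤ) : ℂ) := by
    rw [coe_S_act]; field_simp; push_cast; ring
  rw [← mul_assoc, Subgroup.coe_mul, MetaGL.mul_phi_act, topSign_spec ha, mpS_phi, mul_assoc,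
    csqrt_mul (im_affine_pos ha _ (by simp) _) τ.im_pos, e, e00, e01]
  rw [e]
  exact im_affine_pos hb _ (by simp) _

theorem topSign_mpL_zpow (j : ℤ) : topSign (mpL ^ j) = 1 := by
  have e00 : sl (mpL ^ j) 0 0 = 1 := by rw [sl_mpL_zpow]; simp
  have e01 : sl (mpL ^ j) 0 1 = 0 := by rw [sl_mpL_zpow]; simp
  refine topSign_eq (τ := UpperHalfPlane.I) (by rw [e00]; exact one_pos) ?_
  rw [mpS_mul_mpL_zpow, Subgroup.coe_mul, MetaGL.mul_phi_act, mpT_zpow_phi, mpS_phi, e00, e01]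
  simp

theorem topSign_mul_mpZ_sq {g : Mp2Z} (ha : 0 < sl g 0 0) :
    topSign (g * mpZ ^ 2) = -topSign g := by
  have e : sl (g * mpZ ^ 2) = sl g := by rw [map_mul, sl_mpZ_sq, mul_one]
  refine topSign_eq (τ := UpperHalfPlane.I) (by rw [e]; exact ha) ?_
  have h1 : (mpZ ^ 2).1.act UpperHalfPlane.I = UpperHalfPlane.I := by
    rw [act_eq, sl_mpZ_sq, one_smul]
  rw [← mul_assoc, Subgroup.coe_mul, MetaGL.mul_phi_act, h1, mpZ_sq_phi, topSign_spec ha, e]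
  ring

theorem topSign_of_alphaRel {m : ℕ+} {g g' : Mp2Z} (h : AlphaRel m g g') (ha : 0 < sl g 0 0) :
    topSign g' = topSign g := by
  obtain ⟨e00, e01, -, -⟩ := h.entries
  have hm : ((m : ℕ) : ℂ) ≠ 0 := by exact_mod_cast m.pos.ne'
  refine topSign_eq (τ := UpperHalfPlane.I) (by rw [← e00]; exact ha) ?_
  set τ := UpperHalfPlane.I
  have hact : (g.1.act ((alpha m).act τ) : ℂ) = (m : ℂ) ^ 2 * (g'.1.act τ : ℂ) := by
    rw [← coe_alpha_act, ← MetaGL.mul_act, ← MetaGL.mul_act, h]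
  have h1 : (mpS * g).1.phi ((alpha m).act τ) = m * (mpS * g').1.phi τ := by
    rw [Subgroup.coe_mul, Subgroup.coe_mul, MetaGL.mul_phi_act, MetaGL.mul_phi_act, h.phi, mpS_phi,
      mpS_phi, hact, csqrt_sq_mul m (g'.1.act τ).im_pos]
    ring
  rw [topSign_spec ha, coe_alpha_act] at h1
  have h2 : (sl g 0 0 : ℂ) * ((m : ℂ) ^ 2 * τ) + (sl g 0 1 : ℂ) =
      (m : ℂ) ^ 2 * ((sl g' 0 0 : ℂ) * τ + (sl g' 0 1 : ℂ)) := by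
    rw [e00, e01]; push_cast; ring
  rw [h2, csqrt_sq_mul m (im_affine_pos (e00 ▸ ha) _ (by simp) _)] at h1
  refine mul_left_cancel₀ hm (h1.symm.trans ?_)
  ring

end Mp2Z

/-! ### Forms of order a power of two -/

/-- An integer congruent to one modulo eight is a square modulo any power of two. -/
theorem exists_sq_of_eight_dvd_sub_one (k : ℕ) {x : ℤ} (h : 8 ∣ x - 1) :
    ∃ u : ℤ, Odd u ∧ 2 ^ (k + 3) ∣ x - u ^ 2 := by
  induction k with
  | zero => exact ⟨1, odd_one, by simpa using h⟩
  | succ k ih =>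
    obtain ⟨u, ⟨v, hv⟩, t, ht⟩ := ih
    rcases Int.even_or_odd' t with ⟨w, rfl | rfl⟩
    · exact ⟨u, ⟨v, hv⟩, w, by rw [ht]; ring⟩
    · refine ⟨u + 2 ^ (k + 2), ?_, w - v - 2 ^ k, ?_⟩
      · exact Odd.add_even ⟨v, hv⟩ ⟨2 ^ (k + 1), by ring⟩
      · have : x = u ^ 2 + 2 ^ (k + 3) * (2 * w + 1) := by linarith
        rw [this, hv]; ring

namespace DiscriminantForm
open Mp2Z
variable {A : Type*} [AddCommGroup A] [Fintype A] {D : DiscriminantForm A}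
set_option linter.unusedSectionVars false

/-- The eighth root of unity `e(sig(A)/8)`. -/
def zeta (D : DiscriminantForm A) : ℂ :=
  Complex.exp (2 * Real.pi * Complex.I * (((sig D).val : ℂ) / 8))

theorem gauss_one_eq_zeta : D.gauss 1 = (Real.sqrt (Fintype.card A) : ℂ) * D.zeta := by
  rw [← sum_e_q_eq_gauss]
  exact D.isSignature_sig

theorem zeta_pow_four : D.zeta ^ 4 = (-1) ^ (sig D).val := by
  rw [zeta, ← Complex.exp_nat_mul, ← Complex.exp_pi_mul_I, ← Complex.exp_nat_mul]
  congr 1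
  push_cast
  ring

theorem zeta_ne_zero : D.zeta ≠ 0 := Complex.exp_ne_zero _

theorem zeta_zpow_eight : D.zeta ^ (8 : ℤ) = 1 := by
  have : D.zeta ^ (8 : ℕ) = 1 := by
    rw [show 8 = 4 * 2 from rfl, pow_mul, zeta_pow_four, ← pow_mul, mul_comm, pow_mul]
    norm_num
  exact_mod_cast this

theorem zeta_zpow_congr {x y : ℤ} (h : 8 ∣ x - y) : D.zeta ^ x = D.zeta ^ y := by
  obtain ⟨t, ht⟩ := h
  rw [show x = y + 8 * t by linarith, zpow_add₀ zeta_ne_zero, zpow_mul, zeta_zpow_eight, one_zpow,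
    mul_one]

theorem conj_zeta : conj D.zeta = D.zeta⁻¹ := by
  rw [zeta, ← Complex.exp_conj, ← Complex.exp_neg]
  congr 1
  simp only [map_mul, map_div₀, Complex.conj_I, Complex.conj_ofReal, map_natCast, map_ofNat]
  ring

theorem sqrt_card_ne_zero : (Real.sqrt (Fintype.card A) : ℂ) ≠ 0 := by
  have : 0 < Real.sqrt (Fintype.card A) := by
    apply Real.sqrt_pos.mpr
    exact_mod_cast Fintype.card_pos
  exact_mod_cast this.ne'

/-- The quotient of `G(x)` by `√|A| e(x sig(A)/8)`. For order a power of two and odd `x` it is the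
value at `x` of a quadratic character modulo eight. -/
def evenRatio (D : DiscriminantForm A) (x : ℤ) : ℂ :=
  D.gauss x / ((Real.sqrt (Fintype.card A) : ℂ) * D.zeta ^ x)

theorem gauss_eq_evenRatio (x : ℤ) :
    D.gauss x = D.evenRatio x * ((Real.sqrt (Fintype.card A) : ℂ) * D.zeta ^ x) := by
  rw [evenRatio, div_mul_cancel₀]
  exact mul_ne_zero sqrt_card_ne_zero (zpow_ne_zero _ zeta_ne_zero)

theorem evenRatio_one : D.evenRatio 1 = 1 := by
  rw [evenRatio, gauss_one_eq_zeta, zpow_one]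
  exact div_self (mul_ne_zero sqrt_card_ne_zero zeta_ne_zero)

theorem evenRatio_neg (x : ℤ) : D.evenRatio (-x) = conj (D.evenRatio x) := by
  rw [evenRatio, evenRatio, gauss_neg, map_div₀, map_mul, map_zpow₀, conj_zeta, Complex.conj_ofReal,
    inv_zpow, zpow_neg]

theorem sConst_eq_zeta : D.sConst = (Real.sqrt (Fintype.card A) : ℂ)⁻¹ * D.zeta⁻¹ := by
  have := D.sConst_mul_gauss
  rw [gauss_one_eq_zeta] at this
  rw [← mul_inv]
  exact eq_inv_of_mul_eq_one_left this

section EvenPrime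
variable {k : ℕ}

theorem not_two_dvd_iff_odd {x : ℤ} : ¬((2 : ℕ) : ℤ) ∣ x ↔ Odd x := by
  rw [Nat.cast_ofNat, ← even_iff_two_dvd, Int.not_even_iff_odd]

theorem gauss_congr_eight (hA : Fintype.card A = 2 ^ k) {x y : ℤ} (hy : Odd y) (h : 8 ∣ x - y) :
    D.gauss x = D.gauss y := by
  have hN : ∀ l : A, ((2 : ℤ) ^ (k + 1)) • D.q l = 0 := by
    intro l
    have := D.two_card_zsmul_q l
    rwa [hA, Nat.cast_pow, Nat.cast_ofNat, ← pow_succ'] at this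
  obtain ⟨w, hw⟩ := exists_inverse Nat.prime_two (k + 3) (not_two_dvd_iff_odd.mpr hy)
  rw [Nat.cast_ofNat] at hw
  have h8 : 8 ∣ x * w - 1 := by
    have h1 : (8 : ℤ) ∣ y * w - 1 := (Dvd.intro_left (2 ^ k) (by ring)).trans hw
    have e1 : x * w - 1 = (x - y) * w + (y * w - 1) := by ring
    rw [e1]
    exact dvd_add (h.mul_right _) h1
  obtain ⟨u, hu, hu2⟩ := exists_sq_of_eight_dvd_sub_one k h8
  rw [← gauss_mul_sq (isCoprime_card Nat.prime_two hA (not_two_dvd_iff_odd.mpr hu)) y]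
  refine gauss_congr hN ?_
  have e2 : x - y * u ^ 2 = y * (x * w - u ^ 2) - x * (y * w - 1) := by ring
  rw [e2]
  have hk : (2 : ℤ) ^ (k + 1) ∣ 2 ^ (k + 3) := pow_dvd_pow _ (by omega)
  exact dvd_sub ((hk.trans hu2).mul_left _) ((hk.trans hw).mul_left _)

theorem evenRatio_congr (hA : Fintype.card A = 2 ^ k) {x y : ℤ} (hy : Odd y) (h : 8 ∣ x - y) :
    D.evenRatio x = D.evenRatio y := by
  rw [evenRatio, evenRatio, gauss_congr_eight hA hy h, zeta_zpow_congr h]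

/-- As `5 = 2² + 1²`, two copies of the form are isometric to two copies of its multiple by `5`. -/
theorem evenRatio_five (hA : Fintype.card A = 2 ^ k) :
    D.evenRatio 5 = 1 ∨ D.evenRatio 5 = -1 := by
  have h := D.gauss_sq_of_sum_two_squares 2 1
    (isCoprime_card Nat.prime_two hA (not_two_dvd_iff_odd.mpr (by decide)))
  norm_num at h
  rw [gauss_eq_evenRatio, gauss_one_eq_zeta, mul_pow] at h
  rw [← sq_eq_one_iff]
  have hz : D.zeta ^ (5 : ℤ) = D.zeta ^ (4 : ℕ) * D.zeta := by
    rw [← pow_succ]; norm_cast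
  have h4 : (D.zeta ^ 4) ^ 2 = 1 := by
    rw [zeta_pow_four, ← pow_mul, mul_comm, pow_mul]; norm_num
  have h5 : ((Real.sqrt (Fintype.card A) : ℂ) * D.zeta) ^ 2 ≠ 0 :=
    pow_ne_zero _ (mul_ne_zero sqrt_card_ne_zero zeta_ne_zero)
  refine mul_right_cancel₀ h5 ?_
  rw [hz] at h
  linear_combination h - D.evenRatio 5 ^ 2 * ((Real.sqrt (Fintype.card A) : ℂ) * D.zeta) ^ 2 * h4

theorem evenRatio_eq (hA : Fintype.card A = 2 ^ k) {x : ℤ} (hx : Odd x) :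
    D.evenRatio x = if x % 8 = 1 ∨ x % 8 = 7 then 1 else D.evenRatio 5 := by
  have h5 : conj (D.evenRatio 5) = D.evenRatio 5 := by
    rcases evenRatio_five (D := D) hA with h | h <;> rw [h] <;> simp
  have hx2 : x % 2 = 1 := Int.odd_iff.mp hx
  have h8 : x % 8 = 1 ∨ x % 8 = 3 ∨ x % 8 = 5 ∨ x % 8 = 7 := by omega
  rcases h8 with h | h | h | h
  · rw [evenRatio_congr hA odd_one (by omega), evenRatio_one]; simp [h]
  · rw [evenRatio_congr (y := -5) hA (by decide) (by omega), evenRatio_neg, h5]; simp [h]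
  · rw [evenRatio_congr (y := 5) hA (by decide) (by omega)]; simp [h]
  · rw [evenRatio_congr (y := -1) hA (by decide) (by omega), evenRatio_neg, evenRatio_one]; simp [h]

theorem evenRatio_eq_one_or (hA : Fintype.card A = 2 ^ k) {x : ℤ} (hx : Odd x) :
    D.evenRatio x = 1 ∨ D.evenRatio x = -1 := by
  rw [evenRatio_eq hA hx]
  split_ifs
  · exact Or.inl rfl
  · exact evenRatio_five hA

theorem evenRatio_mul (hA : Fintype.card A = 2 ^ k) {x y : ℤ} (hx : Odd x) (hy : Odd y) :
    D.evenRatio (x * y) = D.evenRatio x * D.evenRatio y := by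
  have h5 : D.evenRatio 5 * D.evenRatio 5 = 1 := by
    rcases evenRatio_five (D := D) hA with h | h <;> rw [h] <;> simp
  rw [evenRatio_eq hA hx, evenRatio_eq hA hy, evenRatio_eq hA (hx.mul hy), Int.mul_emod]
  have hx2 : x % 2 = 1 := Int.odd_iff.mp hx
  have hy2 : y % 2 = 1 := Int.odd_iff.mp hy
  have hx8 : x % 8 = 1 ∨ x % 8 = 3 ∨ x % 8 = 5 ∨ x % 8 = 7 := by omega
  have hy8 : y % 8 = 1 ∨ y % 8 = 3 ∨ y % 8 = 5 ∨ y % 8 = 7 := by omega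
  rcases hx8 with h | h | h | h <;> rcases hy8 with h' | h' | h' | h' <;>
    simp [h, h', h5]

theorem jacobiSym_reciprocity_neg {a b : ℕ} (ha : Odd a) (hb : Odd b) :
    jacobiSym (-a) b = (-1) ^ ((a + 1) / 2 * (b / 2)) * jacobiSym b a := by
  have ha2 := Nat.odd_iff.mp ha
  rw [jacobiSym.neg _ hb, jacobiSym.quadratic_reciprocity ha hb,
    ZMod.χ₄_eq_neg_one_pow (Nat.odd_iff.mp hb), ← mul_assoc, ← pow_add]
  congr 2
  rw [show (a + 1) / 2 = a / 2 + 1 by omega]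
  ring

/-- The function `psi` for forms of order a power of two: it involves the metaplectic sign, a
Jacobi symbol and the signature. -/
theorem psi_of_two (hA : Fintype.card A = 2 ^ k) {g : Mp2Z} (h0 : 0 < sl g 0 0)
    (h : Odd (sl g 0 0)) : D.psi g = D.evenRatio (sl g 0 0) *
      (topSign g * (jacobiSym (sl g 0 1) (sl g 0 0).toNat : ℂ)) ^ (sig D).val *
        D.zeta ^ (1 - sl g 0 0) := by
  have hN : ∀ l : A, (((2 : ℕ) : ℤ) ^ (k + 1)) • D.q l = 0 := by
    intro l
    have := D.two_card_zsmul_q l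
    rw [hA] at this
    rw [pow_succ']
    exact_mod_cast this
  refine (psi_eq_of_recursion Nat.prime_two hN (fun g => D.evenRatio (sl g 0 0) *
      (topSign g * (jacobiSym (sl g 0 1) (sl g 0 0).toNat : ℂ)) ^ (sig D).val *
        D.zeta ^ (1 - sl g 0 0)) ?_ ?_ ?_ ?_ g h0 (not_two_dvd_iff_odd.mpr h)).symm
  · intro x hx h0
    rw [gauss_eq_evenRatio] at h0
    have h1 := mul_ne_zero (sqrt_card_ne_zero (A := A)) (zpow_ne_zero x (zeta_ne_zero (D := D)))
    rcases evenRatio_eq_one_or (D := D) hA (not_two_dvd_iff_odd.mp hx) with h | h <;>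
      rw [h] at h0 <;> simp at h0 <;> simp [h0] at h1
  · intro g j h0 h
    have e00 : sl (g * mpT ^ j) 0 0 = sl g 0 0 := by rw [sl_mul_T]; simp
    have e01 : sl (g * mpT ^ j) 0 1 = sl g 0 1 + j * sl g 0 0 := by rw [sl_mul_T]; simp
    simp only [e00, e01, topSign_mul_T h0]
    congr 5
    refine jacobiSym.mod_left' ?_
    rw [Int.toNat_of_nonneg h0.le, Int.add_mul_emod_self_right]
  · intro g h0 h hb0 hb
    rw [not_two_dvd_iff_odd] at h hb
    have e00 : sl (g * mpS) 0 0 = sl g 0 1 := by rw [sl_mul_S]; simp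
    have e01 : sl (g * mpS) 0 1 = -sl g 0 0 := by rw [sl_mul_S]; simp
    obtain ⟨y, hy⟩ := exists_inverse Nat.prime_two (k + 1 + 3) (not_two_dvd_iff_odd.mpr h)
    have hy8 : 8 ∣ sl g 0 0 * y - 1 := by
      have : (8 : ℤ) ∣ ((2 : ℕ) : ℤ) ^ (k + 1 + 3) :=
        Dvd.intro_left (2 ^ (k + 1)) (by push_cast; ring)
      exact this.trans hy
    simp only [e00, e01, topSign_mul_S h0 hb0]
    generalize topSign g = ε
    generalize sl g 0 0 = a at *
    generalize sl g 0 1 = b at *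
    have hyodd : Odd y := by
      have h2 : ¬Even (a * y) := fun hh => by
        rw [even_iff_two_dvd] at hh; omega
      rw [Int.not_even_iff_odd, Int.odd_mul] at h2
      exact h2.2
    have hya : 8 ∣ y - a := by
      have ha8 : a % 8 = 1 ∨ a % 8 = 3 ∨ a % 8 = 5 ∨ a % 8 = 7 := by
        have := Int.odd_iff.mp h; omega
      have h2 : (a * y) % 8 = 1 := by omega
      have h3 : (a * a) % 8 = 1 := by
        rw [Int.mul_emod]; rcases ha8 with h | h | h | h <;> rw [h] <;> rfl
      have h4 : 8 ∣ a * (y - a) := by rw [mul_sub]; omega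
      refine (Int.isCoprime_iff_gcd_eq_one.mpr ?_ : IsCoprime 8 a).dvd_of_dvd_mul_left h4
      exact Int.isCoprime_iff_gcd_eq_one.mp
        (IsCoprime.pow_left (m := 3) (Int.isCoprime_two_left.mpr h) : IsCoprime ((2 : ℤ) ^ 3) a)
    refine ⟨y, (pow_dvd_pow _ (by omega)).trans hy, not_two_dvd_iff_odd.mpr hyodd, ?_⟩
    lift a to ℕ using h0.le
    lift b to ℕ using hb0.le
    have ha' : Odd a := by exact_mod_cast h
    have hb' : Odd b := by exact_mod_cast hb
    rw [Int.toNat_natCast, Int.toNat_natCast, jacobiSym_reciprocity_neg ha' hb', sConst_eq_zeta,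
      gauss_eq_evenRatio, evenRatio_congr hA (x := y * b) (y := a * b) (h.mul hb) (by
        rw [← sub_mul]; exact hya.mul_right _), evenRatio_mul hA h hb,
      zeta_zpow_congr (x := y * b) (y := a * b) (by rw [← sub_mul]; exact hya.mul_right _)]
    have hsq : D.evenRatio a * D.evenRatio a = 1 := by
      rcases evenRatio_eq_one_or (D := D) hA h with h | h <;> rw [h] <;> simp
    have hz : (((-1) ^ ((a + 1) / 2 * (b / 2)) : ℂ)) ^ (sig D).val * D.zeta ^ (1 - (b : ℤ)) =
        D.zeta⁻¹ * D.zeta ^ ((a : ℤ) * b) * D.zeta ^ (1 - (a : ℤ)) := by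
      rw [← pow_mul, mul_comm _ (sig D).val, pow_mul, ← zeta_pow_four, ← pow_mul, ← zpow_natCast,
        ← zpow_neg_one, ← zpow_add₀ zeta_ne_zero, ← zpow_add₀ zeta_ne_zero,
        ← zpow_add₀ zeta_ne_zero]
      congr 1
      obtain ⟨u, rfl⟩ := ha'
      obtain ⟨v, rfl⟩ := hb'
      rw [show (2 * u + 1 + 1) / 2 = u + 1 by omega, show (2 * v + 1) / 2 = v by omega]
      push_cast
      ring
    have hs := sqrt_card_ne_zero (A := A)
    push_cast
    rw [mul_pow, mul_pow, mul_pow]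
    field_simp
    linear_combination (D.evenRatio b * ε ^ (sig D).val *
      (jacobiSym b a : ℂ) ^ (sig D).val) * hz - (D.evenRatio b * ε ^ (sig D).val *
      (jacobiSym b a : ℂ) ^ (sig D).val * D.zeta⁻¹ * D.zeta ^ ((a : ℤ) * b) *
        D.zeta ^ (1 - (a : ℤ))) * hsq
  · intro g h1
    have hz : (D.sConst ^ 2 * Fintype.card A) ^ 2 = (-1) ^ (sig D).val := by
      have hs := sqrt_card_ne_zero (A := A)
      have hs2 : (Real.sqrt (Fintype.card A) : ℂ) ^ 2 = Fintype.card A := by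
        rw [← Complex.ofReal_pow, Real.sq_sqrt (Nat.cast_nonneg _)]; simp
      rw [sConst_eq_zeta, ← hs2]
      have e1 : (((Real.sqrt (Fintype.card A) : ℂ)⁻¹ * D.zeta⁻¹) ^ 2 *
          (Real.sqrt (Fintype.card A) : ℂ) ^ 2) ^ 2 = (D.zeta ^ 4)⁻¹ := by
        have := zeta_ne_zero (D := D)
        field_simp
      rw [e1, zeta_pow_four, ← inv_pow]
      norm_num
    have hLT : D.psi (mpL ^ (sl g 1 0) * mpT ^ (sl g 0 1)) = 1 := by
      have := psi_L_mul (D := D) 1 (sl g 1 0)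
      rw [mul_one, psi_one] at this
      rw [psi_mul_T, this]
    have hLT' : topSign (mpL ^ (sl g 1 0) * mpT ^ (sl g 0 1)) = 1 := by
      rw [topSign_mul_T, topSign_mpL_zpow]
      rw [sl_mpL_zpow]; simp
    simp only [h1, evenRatio_one, sub_self, zpow_zero, one_mul, mul_one, Int.toNat_one,
      jacobiSym.one_right, Int.cast_one]
    rcases eq_of_apply_zero_zero_eq_one h1 with h2 | h2
    · rw [h2, hLT, hLT', one_pow]
    · rw [h2, psi_mul_mpZ_sq, hLT, hz, mul_one, topSign_mul_mpZ_sq, hLT']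
      rw [sl_mul_T, sl_mpL_zpow]; simp

end EvenPrime

end DiscriminantForm

/-! ### The intertwining property of `𝔢_λ ↦ 𝔢_{mλ}` for forms of prime power order -/

section Alpha
variable {A : Type*} [AddCommGroup A] [Fintype A]

theorem alphaAct_basisVec (m : ℕ+) (l : A) :
    alphaAct m (basisVec l) = basisVec ((m : ℕ) • l) := by
  classical
  rw [alphaAct, LinearMap.sum_apply, Finset.sum_eq_single l]
  · simp [basisVec_apply]
  · intro b _ hb
    simp [basisVec_apply, hb]
  · simp

theorem alphaAct_apply [DecidableEq A] (m : ℕ+) (v : A → ℂ) (k : A) :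
    alphaAct m v k = ∑ l, if (m : ℕ) • l = k then v l else 0 := by
  rw [alphaAct, LinearMap.sum_apply, Finset.sum_apply]
  refine Finset.sum_congr rfl fun l _ => ?_
  rw [LinearMap.smulRight_apply, LinearMap.proj_apply, Pi.smul_apply, basisVec_apply]
  by_cases h : (m : ℕ) • l = k
  · simp [h]
  · simp [h, Ne.symm h]

end Alpha

namespace DiscriminantForm
open Mp2Z
variable {A : Type*} [AddCommGroup A] [Fintype A] {D : DiscriminantForm A}
set_option linter.unusedSectionVars false

theorem fourier_alphaAct (m : ℕ+) (k : A) (v : A → ℂ) :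
    D.fourier k (alphaAct m v) = D.fourier ((m : ℕ) • k) v := by
  have h : D.fourier k ∘ₗ alphaAct m = D.fourier ((m : ℕ) • k) := by
    ext1 v
    rw [← sum_smul_basisVec v, map_sum, map_sum]
    refine Finset.sum_congr rfl fun l _ => ?_
    rw [map_smul, map_smul, LinearMap.comp_apply, alphaAct_basisVec, fourier_basisVec,
      fourier_basisVec, ← natCast_zsmul, ← natCast_zsmul, bil_zsmul_left, bil_zsmul_right]
  exact LinearMap.congr_fun h v

/-- The linear map `𝔢_λ ↦ 𝔢_{mλ}` intertwines `ρ(γ)` and `ρ(γ')`. -/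
def Intertwines (D : DiscriminantForm A) (m : ℕ+) (g g' : Mp2Z) : Prop :=
  ∀ v, weilRep D g' (alphaAct m v) = alphaAct m (weilRep D g v)

theorem Intertwines.mul {m : ℕ+} {g g' h h' : Mp2Z} (h1 : D.Intertwines m g g')
    (h2 : D.Intertwines m h h') : D.Intertwines m (g * h) (g' * h') := fun v => by
  rw [map_mul, map_mul, Module.End.mul_apply, Module.End.mul_apply, h2, h1]

theorem Intertwines.inv {m : ℕ+} {g g' : Mp2Z} (h1 : D.Intertwines m g g') :
    D.Intertwines m g⁻¹ g'⁻¹ := fun v => by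
  have h := h1 (weilRep D g⁻¹ v)
  rw [weilRep_apply_inv] at h
  rw [← h, weilRep_inv_apply]

/-- The upper left entries agree, the upper right ones differ by the square `m²`, which the Jacobi
symbol ignores, and the metaplectic signs agree as well. -/
theorem psi_eq_of_alphaRel {p k : ℕ} (hp : p.Prime) (hA : Fintype.card A = p ^ k) {m : ℕ+}
    {g g' : Mp2Z} (h : AlphaRel m g g') (ha0 : 0 < sl g 0 0) (ha : ¬(p : ℤ) ∣ sl g 0 0) :
    D.psi g' = D.psi g := by
  have hent := h.entries
  by_cases hp2 : p = 2
  · subst hp2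
    have hodd := not_two_dvd_iff_odd.mp ha
    have hJ : jacobiSym (sl g 0 1) (sl g 0 0).toNat = jacobiSym (sl g' 0 1) (sl g 0 0).toNat := by
      rw [hent.2.1, jacobiSym.mul_left, jacobiSym.sq_one', one_mul]
      have hc : IsCoprime ((m : ℕ) : ℤ) (sl g 0 0) := by
        have h1 := isCoprime_top_row g
        rw [hent.2.1] at h1
        exact (IsCoprime.of_isCoprime_of_dvd_right h1
          (Dvd.intro_left ((m : ℤ) * sl g' 0 1) (by ring))).symm
      rw [Int.toNat_of_nonneg ha0.le]
      exact Int.isCoprime_iff_gcd_eq_one.mp hc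
    rw [psi_of_two hA ha0 hodd, psi_of_two hA (by rw [← hent.1]; exact ha0)
      (by rw [← hent.1]; exact hodd), topSign_of_alphaRel h ha0, ← hent.1, hJ]
  · rw [psi_of_odd_prime hp2 hp hA ha0 ha, psi_of_odd_prime hp2 hp hA (by rw [← hent.1]; exact ha0)
      (by rw [← hent.1]; exact ha), hent.1]

theorem card_sq_zsmul_q (l : A) : ((Fintype.card A : ℤ) ^ 2) • D.q l = 0 := by
  rw [pow_two, ← q_zsmul, card_zsmul, q_zero]

theorem intertwines_of_not_dvd {p k : ℕ} (hp : p.Prime) (hA : Fintype.card A = p ^ k) {m : ℕ+}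
    {g g' : Mp2Z} (h : AlphaRel m g g') (ha0 : 0 < sl g 0 0) (ha : ¬(p : ℤ) ∣ sl g 0 0) :
    D.Intertwines m g g' := by
  have hent := h.entries
  have hN : ∀ l : A, ((p : ℤ) ^ (k * 2)) • D.q l = 0 := by
    intro l
    have := D.card_sq_zsmul_q l
    rwa [hA, Nat.cast_pow, ← pow_mul] at this
  obtain ⟨y, hy⟩ := exists_inverse hp (k * 2) ha
  have hy' := smul_q_of_dvd hN hy
  have h1 : weilRep D g' ∘ₗ alphaAct m = alphaAct m ∘ₗ weilRep D g := by
    refine end_ext fun l => eq_of_fourier_eq (D := D) fun u => ?_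
    rw [LinearMap.comp_apply, LinearMap.comp_apply, fourier_alphaAct, alphaAct_basisVec,
      hasFormula_of_not_dvd hp hN g ha0 ha y hy',
      hasFormula_of_not_dvd hp hN g' (by rw [← hent.1]; exact ha0) (by rw [← hent.1]; exact ha) y
        (by rw [← hent.1]; exact hy'), psi_eq_of_alphaRel hp hA h ha0 ha]
    congr 2
    rw [hent.2.1, hent.2.2.1]
    simp only [← natCast_zsmul, bil_zsmul_left, bil_zsmul_right, q_zsmul, ← mul_smul]
    ring_nf
  exact fun v => LinearMap.congr_fun h1 v

/-- The intertwining property for forms of prime power order. An arbitrary `γ` is reduced to one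
with upper left entry positive and prime to `p` by multiplication with powers of `(1, 0; 1, 1)`. -/
theorem intertwines_of_prime_pow {p k : ℕ} (hp : p.Prime) (hA : Fintype.card A = p ^ k) {m : ℕ+}
    {g g' : Mp2Z} (h : AlphaRel m g g') : D.Intertwines m g g' := by
  have h1 (u u' : Mp2Z) (hu : AlphaRel m u u') (h00 : sl u 0 0 = 1) : D.Intertwines m u u' :=
    intertwines_of_not_dvd hp hA hu (by rw [h00]; exact one_pos)
      (by rw [h00]; exact (Nat.prime_iff_prime_int.mp hp).not_dvd_one)
  have key (g g' : Mp2Z) (h : AlphaRel m g g') (hb : sl g 0 1 ≠ 0) : D.Intertwines m g g' := by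
    -- `a + jb` for two consecutive `j` of large absolute value: not both are divisible by `p`
    obtain ⟨j, hj0, hj⟩ : ∃ j : ℤ, 0 < sl g 0 0 + j * sl g 0 1 ∧
        ¬(p : ℤ) ∣ sl g 0 0 + j * sl g 0 1 := by
      have hs : (sl g 0 1).sign * sl g 0 1 = |sl g 0 1| := Int.sign_mul_self_eq_abs _
      have hpos : 0 < |sl g 0 1| := abs_pos.mpr hb
      have hneg := neg_abs_le (sl g 0 0)
      have h0 : 0 < sl g 0 0 + ((|sl g 0 0| + 1) * (sl g 0 1).sign) * sl g 0 1 := by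
        rw [mul_assoc, hs]
        nlinarith [abs_nonneg (sl g 0 0)]
      by_cases hd : (p : ℤ) ∣ sl g 0 0 + ((|sl g 0 0| + 1) * (sl g 0 1).sign) * sl g 0 1
      · refine ⟨(|sl g 0 0| + 1) * (sl g 0 1).sign + (sl g 0 1).sign, ?_, ?_⟩
        · rw [add_mul, hs]; linarith
        · intro hd2
          rw [add_mul, hs, ← add_assoc, Int.dvd_add_right hd, dvd_abs] at hd2
          have hd3 := (Int.dvd_add_left (hd2.mul_left _)).mp hd
          exact (Nat.prime_iff_prime_int.mp hp).not_isUnit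
            ((isCoprime_top_row g).isUnit_of_dvd' hd3 hd2)
      · exact ⟨_, h0, hd⟩
    obtain ⟨u, hu⟩ := AlphaRel.exists_of_dvd m (mpL ^ j) (by rw [sl_mpL_zpow]; simp)
    have hL := h1 _ _ hu (by rw [sl_mpL_zpow]; simp)
    have e00 : sl (g * mpL ^ j) 0 0 = sl g 0 0 + j * sl g 0 1 := by rw [sl_mul_L]; simp
    have hg := intertwines_of_not_dvd (D := D) hp hA (h.mul hu) (by rw [e00]; exact hj0)
      (by rw [e00]; exact hj)
    simpa using hg.mul hL.inv
  by_cases hb : sl g 0 1 = 0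
  · have e01 : sl (g * mpT ^ ((m : ℤ) ^ 2)) 0 1 = sl g 0 1 + (m : ℤ) ^ 2 * sl g 0 0 := by
      rw [sl_mul_T]; simp
    obtain ⟨u, hu⟩ := AlphaRel.exists_of_dvd m (mpT ^ ((m : ℤ) ^ 2)) (by rw [sl_mpT_zpow]; simp)
    have hT := h1 _ _ hu (by rw [sl_mpT_zpow]; simp)
    have ha : sl g 0 0 ≠ 0 := by
      intro h0
      have := sl_det g
      rw [h0, hb] at this
      simp at this
    have hg := key _ _ (h.mul hu) (by
      rw [e01, hb, zero_add]
      exact mul_ne_zero (pow_ne_zero _ (by exact_mod_cast m.pos.ne')) ha)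
    simpa using hg.mul hT.inv
  · exact key g g' h hb

/-! ### Orthogonal decompositions -/

variable {A₁ A₂ : Type*} [AddCommGroup A₁] [Fintype A₁] [AddCommGroup A₂] [Fintype A₂]
  {D₁ : DiscriminantForm A₁} {D₂ : DiscriminantForm A₂}

/-- The vector `v ⊗ w` in `ℂ[A] = ℂ[A₁] ⊗ ℂ[A₂]`, for an isomorphism of `A₁ × A₂` with `A`. -/
def tens (f : A₁ × A₂ ≃+ A) (v : A₁ → ℂ) (w : A₂ → ℂ) : A → ℂ :=
  fun x => v (f.symm x).1 * w (f.symm x).2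

theorem tens_basisVec (f : A₁ × A₂ ≃+ A) (l : A₁ × A₂) :
    tens f (basisVec l.1) (basisVec l.2) = basisVec (f l) := by
  classical
  ext x
  obtain ⟨y, rfl⟩ := f.surjective x
  obtain ⟨l₁, l₂⟩ := l
  obtain ⟨y₁, y₂⟩ := y
  simp only [tens, AddEquiv.symm_apply_apply, basisVec_apply, f.injective.eq_iff, Prod.mk.injEq]
  by_cases h1 : y₁ = l₁ <;> by_cases h2 : y₂ = l₂ <;> simp [h1, h2]

theorem bil_of_q_add {f : A₁ × A₂ ≃+ A} (hq : ∀ x, D.q (f x) = D₁.q x.1 + D₂.q x.2)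
    (x y : A₁ × A₂) : D.bil (f x) (f y) = D₁.bil x.1 y.1 + D₂.bil x.2 y.2 := by
  have h1 := D.q_add (f x) (f y)
  rw [← map_add, hq, hq, hq, Prod.fst_add, Prod.snd_add, q_add, q_add] at h1
  have h2 : D.bil (f x) (f y) = (D₁.q x.1 + D₁.q y.1 + D₁.bil x.1 y.1 +
      (D₂.q x.2 + D₂.q y.2 + D₂.bil x.2 y.2)) - (D₁.q x.1 + D₂.q x.2 + (D₁.q y.1 + D₂.q y.2)) := by
    rw [h1]; abel
  rw [h2]
  abel

theorem sum_of_equiv (f : A₁ × A₂ ≃+ A) (F : A → ℂ) : ∑ x, F x = ∑ x, ∑ y, F (f (x, y)) := by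
  rw [← Fintype.sum_prod_type', ← f.toEquiv.sum_comp]
  rfl

theorem sConst_of_q_add {f : A₁ × A₂ ≃+ A} (hq : ∀ x, D.q (f x) = D₁.q x.1 + D₂.q x.2) :
    D.sConst = D₁.sConst * D₂.sConst := by
  have hg : D.gauss 1 = D₁.gauss 1 * D₂.gauss 1 := by
    rw [gauss, sum_of_equiv f, gauss, gauss, Finset.sum_mul_sum]
    simp only [one_zsmul, hq, e_add]
  have hc : Fintype.card A = Fintype.card A₁ * Fintype.card A₂ := by
    rw [← Fintype.card_prod]; exact Fintype.card_congr f.symm.toEquiv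
  rw [sConst, sConst, sConst, hg, hc, map_mul, Nat.cast_mul]
  ring

theorem weilRep_tens {f : A₁ × A₂ ≃+ A} (hq : ∀ x, D.q (f x) = D₁.q x.1 + D₂.q x.2) (g : Mp2Z)
    (v : A₁ → ℂ) (w : A₂ → ℂ) :
    weilRep D g (tens f v w) = tens f (weilRep D₁ g v) (weilRep D₂ g w) := by
  revert v w
  refine Mp2Z.induction (p := fun g => ∀ v w, weilRep D g (tens f v w) =
    tens f (weilRep D₁ g v) (weilRep D₂ g w)) ?_ ?_ ?_ ?_ g
  · intro v w
    ext x
    obtain ⟨y, rfl⟩ := f.surjective x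
    simp only [weilRep_mpS, sOp_apply, tens, AddEquiv.symm_apply_apply]
    rw [sum_of_equiv f, sConst_of_q_add hq, mul_mul_mul_comm, Finset.sum_mul_sum]
    congr 1
    refine Finset.sum_congr rfl fun a _ => Finset.sum_congr rfl fun b _ => ?_
    rw [bil_of_q_add hq, AddEquiv.symm_apply_apply, neg_add, e_add]
    ring
  · intro v w
    ext x
    obtain ⟨y, rfl⟩ := f.surjective x
    simp only [weilRep_mpT, tOp_apply, tens, AddEquiv.symm_apply_apply, one_zsmul, hq, e_add]
    ring
  · intro g h hg hh v w
    simp only [map_mul, Module.End.mul_apply, hh, hg]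
  · intro g hg v w
    have := hg (weilRep D₁ g⁻¹ v) (weilRep D₂ g⁻¹ w)
    rw [weilRep_apply_inv, weilRep_apply_inv] at this
    rw [← this, weilRep_inv_apply]

theorem alphaAct_tens (f : A₁ × A₂ ≃+ A) (m : ℕ+) (v : A₁ → ℂ) (w : A₂ → ℂ) :
    alphaAct m (tens f v w) = tens f (alphaAct m v) (alphaAct m w) := by
  classical
  ext x
  obtain ⟨y, rfl⟩ := f.surjective x
  obtain ⟨y₁, y₂⟩ := y
  simp only [alphaAct_apply, tens, AddEquiv.symm_apply_apply]
  rw [sum_of_equiv f, Finset.sum_mul_sum]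
  refine Finset.sum_congr rfl fun a _ => Finset.sum_congr rfl fun b _ => ?_
  rw [← map_nsmul, f.injective.eq_iff, AddEquiv.symm_apply_apply, Prod.smul_mk, Prod.mk.injEq]
  by_cases h1 : (m : ℕ) • a = y₁ <;> by_cases h2 : (m : ℕ) • b = y₂ <;> simp [h1, h2]

theorem Intertwines.of_equiv {f : A₁ × A₂ ≃+ A} (hq : ∀ x, D.q (f x) = D₁.q x.1 + D₂.q x.2)
    {m : ℕ+} {g g' : Mp2Z} (h1 : D₁.Intertwines m g g') (h2 : D₂.Intertwines m g g') :
    D.Intertwines m g g' := by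
  have h : weilRep D g' ∘ₗ alphaAct m = alphaAct m ∘ₗ weilRep D g := by
    refine end_ext fun l => ?_
    obtain ⟨y, rfl⟩ := f.surjective l
    rw [LinearMap.comp_apply, LinearMap.comp_apply, ← tens_basisVec, alphaAct_tens, weilRep_tens hq,
      weilRep_tens hq, alphaAct_tens, h1, h2]
  exact fun v => LinearMap.congr_fun h v

/-- The elements of `A` killed by `a`. -/
def torsion (A : Type*) [AddCommGroup A] (a : ℕ) : AddSubgroup A :=
  (zsmulAddGroupHom (a : ℤ) : A →+ A).ker

theorem mem_torsion {a : ℕ} {x : A} : x ∈ torsion A a ↔ (a : ℤ) • x = 0 := Iff.rfl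

/-- If `n` kills `x` and `n` is coprime to `k`, then `k x = 0` only for `x = 0`. -/
theorem eq_zero_of_coprime {a b : ℕ} (hab : a.Coprime b) {x : A} (ha : (a : ℤ) • x = 0)
    (hb : (b : ℤ) • x = 0) : x = 0 := by
  obtain ⟨u, v, h⟩ := Nat.isCoprime_iff_coprime.mpr hab
  rw [← one_zsmul x, ← h, add_smul, mul_smul, mul_smul, ha, hb, smul_zero, smul_zero, add_zero]

theorem coprime_card_torsion {a b : ℕ} (hab : a.Coprime b) [Fintype (torsion A a)] :
    (Fintype.card (torsion A a)).Coprime b := by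
  refine Nat.coprime_of_dvd fun p hp hpa hpb => ?_
  have : Fact p.Prime := ⟨hp⟩
  obtain ⟨x, hx⟩ := exists_prime_addOrderOf_dvd_card p hpa
  have h0 : (b : ℤ) • x = 0 := by
    obtain ⟨t, rfl⟩ := hpb
    have : p • x = 0 := by rw [← hx]; exact addOrderOf_nsmul_eq_zero x
    rw [natCast_zsmul, mul_comm, mul_nsmul', this, smul_zero]
  have h1 : (a : ℤ) • x = 0 := Subtype.ext x.2
  have h2 := eq_zero_of_coprime hab h1 h0
  rw [h2, addOrderOf_zero] at hx
  exact hp.one_lt.ne hx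

/-- The decomposition of a group of order `ab`, `a` and `b` coprime, into torsion subgroups. -/
def torsionEquiv {a b : ℕ} (hab : a.Coprime b) (hA : Fintype.card A = a * b) :
    torsion A a × torsion A b ≃+ A :=
  AddEquiv.ofBijective ((torsion A a).subtype.coprod (torsion A b).subtype) (by
    constructor
    · rw [injective_iff_map_eq_zero]
      rintro ⟨⟨x, hx⟩, ⟨y, hy⟩⟩ h
      have h' : x + y = 0 := h
      have hxy : x = -y := eq_neg_of_add_eq_zero_left h'
      have h2 : (b : ℤ) • x = 0 := by rw [hxy, smul_neg, mem_torsion.mp hy, neg_zero]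
      have hx0 := eq_zero_of_coprime hab hx h2
      have hy0 : y = 0 := by simpa [hx0] using h'
      simp [hx0, hy0]
    · intro z
      obtain ⟨u, v, h⟩ := Nat.isCoprime_iff_coprime.mpr hab
      have hz : ((a * b : ℕ) : ℤ) • z = 0 := by
        rw [← hA]
        exact DiscriminantForm.card_zsmul z
      push_cast at hz
      refine ⟨(⟨(v * b) • z, ?_⟩, ⟨(u * a) • z, ?_⟩), ?_⟩
      · rw [mem_torsion, ← mul_smul, show (a : ℤ) * (v * b) = v * (a * b) by ring, mul_smul, hz,
          smul_zero]
      · rw [mem_torsion, ← mul_smul, show (b : ℤ) * (u * a) = u * (a * b) by ring, mul_smul, hz,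
          smul_zero]
      · change (v * b) • z + (u * a) • z = z
        rw [← add_smul, add_comm, h, one_zsmul])

theorem torsionEquiv_apply {a b : ℕ} (hab : a.Coprime b) (hA : Fintype.card A = a * b)
    (x : torsion A a × torsion A b) : torsionEquiv hab hA x = (x.1 : A) + x.2 := rfl

theorem bil_torsion {a b : ℕ} (hab : a.Coprime b) {x y : A} (hx : (a : ℤ) • x = 0)
    (hy : (b : ℤ) • y = 0) : D.bil x y = 0 := by
  obtain ⟨u, v, h⟩ := Nat.isCoprime_iff_coprime.mpr hab
  have h1 : (a : ℤ) • D.bil x y = 0 := by rw [← bil_zsmul_left, hx, bil_zero_left]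
  have h2 : (b : ℤ) • D.bil x y = 0 := by rw [← bil_zsmul_right, hy, bil_zero_right]
  rw [← one_zsmul (D.bil x y), ← h, add_smul, mul_smul, mul_smul, h1, h2, smul_zero, smul_zero,
    add_zero]

/-- The restriction of a discriminant form to a torsion subgroup. -/
def restrictTorsion (D : DiscriminantForm A) {a b : ℕ} (hab : a.Coprime b)
    (hA : Fintype.card A = a * b) : DiscriminantForm (torsion A a) where
  q := D.q.comp (torsion A a).subtype.toIntLinearMap
  nondegenerate x hx := by
    refine Subtype.ext (D.nondegenerate x fun y => ?_)
    obtain ⟨z, rfl⟩ := (torsionEquiv hab hA).surjective y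
    have h1 : D.bil x z.1 = 0 := hx z.1
    have h2 : D.bil x z.2 = 0 := bil_torsion hab x.2 z.2.2
    change D.bil x _ = 0
    rw [torsionEquiv_apply, bil_add_right, h1, h2, add_zero]

theorem card_torsion {a b : ℕ} (hab : a.Coprime b) (hA : Fintype.card A = a * b)
    [Fintype (torsion A a)] [Fintype (torsion A b)] : Fintype.card (torsion A a) = a := by
  have hc : Fintype.card (torsion A a) * Fintype.card (torsion A b) = a * b := by
    rw [← hA, ← Fintype.card_prod]; exact Fintype.card_congr (torsionEquiv hab hA).toEquiv
  refine Nat.dvd_antisymm ?_ ?_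
  · exact (coprime_card_torsion hab).dvd_of_dvd_mul_right (hc ▸ Dvd.intro _ rfl)
  · exact (coprime_card_torsion hab.symm).symm.dvd_of_dvd_mul_right (hc.symm ▸ Dvd.intro _ rfl)

/-- If `γα = αγ'` then `𝔢_λ ↦ 𝔢_{mλ}` intertwines `ρ(γ)` and `ρ(γ')`. -/
theorem intertwines_of_alphaRel {m : ℕ+} {g g' : Mp2Z} (h : AlphaRel m g g') :
    D.Intertwines m g g' := by
  classical
  have key : ∀ n : ℕ, ∀ (A : Type _) [AddCommGroup A] [Fintype A] (D : DiscriminantForm A),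
      Fintype.card A = n → D.Intertwines m g g' := by
    intro n
    induction n using Nat.recOnPosPrimePosCoprime with
    | prime_pow p k hp hk => intro A _ _ D hA; exact intertwines_of_prime_pow hp hA h
    | zero => intro A _ _ D hA; exact absurd hA Fintype.card_ne_zero
    | one => intro A _ _ D hA; exact intertwines_of_prime_pow (k := 0) Nat.prime_two hA h
    | coprime a b ha hb hab iha ihb =>
      intro A _ _ D hA
      have hA' : Fintype.card A = b * a := by rw [hA, mul_comm]
      refine Intertwines.of_equiv (f := torsionEquiv hab hA) (D₁ := D.restrictTorsion hab hA)
        (D₂ := D.restrictTorsion hab.symm hA') (fun x => ?_)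
        (iha _ _ (card_torsion hab hA)) (ihb _ _ (card_torsion hab.symm hA'))
      rw [torsionEquiv_apply, q_add, bil_torsion hab x.1.2 x.2.2, add_zero]
      rfl
  exact key _ A D rfl

end DiscriminantForm

/-! ### The action of the double coset of `α` on `ℂ[A]` -/

section Cosets

theorem alpha_mem_doubleCoset (m : ℕ+) : alpha m ∈ doubleCoset m := ⟨1, 1, by simp⟩

theorem mul_mem_doubleCoset {m : ℕ+} {δ : MetaGL} (h : δ ∈ doubleCoset m) (g : Mp2Z) :
    g.1 * δ ∈ doubleCoset m := by
  obtain ⟨γ, γ', rfl⟩ := h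
  exact ⟨g * γ, γ', by rw [Subgroup.coe_mul]; simp only [mul_assoc]⟩

theorem doubleCoset_mul_mem {m : ℕ+} {δ : MetaGL} (h : δ ∈ doubleCoset m) (g : Mp2Z) :
    δ * g.1 ∈ doubleCoset m := by
  obtain ⟨γ, γ', rfl⟩ := h
  exact ⟨γ, γ' * g, by rw [Subgroup.coe_mul]; simp only [mul_assoc]⟩

variable {A : Type*} [AddCommGroup A] [Fintype A] (D : DiscriminantForm A)

/-- The action of `γαγ'` on `ℂ[A]` only depends on the product. -/
theorem tripleAct_congr {m : ℕ+} {γ₁ γ₁' γ₂ γ₂' : Mp2Z}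
    (h : γ₁.1 * alpha m * γ₁'.1 = γ₂.1 * alpha m * γ₂'.1) :
    tripleAct D m γ₁ γ₁' = tripleAct D m γ₂ γ₂' := by
  have hrel : AlphaRel m (γ₂⁻¹ * γ₁) (γ₂' * γ₁'⁻¹) := by
    rw [AlphaRel, Subgroup.coe_mul, Subgroup.coe_mul, Subgroup.coe_inv, Subgroup.coe_inv, mul_assoc,
      inv_mul_eq_iff_eq_mul, ← mul_assoc, ← mul_assoc, eq_mul_inv_iff_mul_eq]
    exact h
  ext1 v
  have h2 := D.intertwines_of_alphaRel hrel (weilRep D γ₁⁻¹ v)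
  simp only [map_mul, Module.End.mul_apply, DiscriminantForm.weilRep_apply_inv] at h2
  simp only [tripleAct, LinearMap.comp_apply, ← h2, DiscriminantForm.weilRep_inv_apply]

theorem cosetAct_eq (m : ℕ+) (γ γ' : Mp2Z) :
    cosetAct D m (γ.1 * alpha m * γ'.1) = tripleAct D m γ γ' := by
  have h : ∃ p : Mp2Z × Mp2Z, γ.1 * alpha m * γ'.1 = p.1.1 * alpha m * p.2.1 := ⟨(γ, γ'), rfl⟩
  rw [cosetAct, dif_pos h]
  exact tripleAct_congr D h.choose_spec.symm

theorem cosetAct_mul_left {m : ℕ+} {δ : MetaGL} (h : δ ∈ doubleCoset m) (g : Mp2Z) :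
    cosetAct D m (g.1 * δ) = cosetAct D m δ ∘ₗ weilRep D g⁻¹ := by
  obtain ⟨γ, γ', rfl⟩ := h
  have e1 : g.1 * (γ.1 * alpha m * γ'.1) = (g * γ).1 * alpha m * γ'.1 := by
    rw [Subgroup.coe_mul]; simp only [mul_assoc]
  rw [e1, cosetAct_eq, cosetAct_eq, tripleAct, tripleAct, mul_inv_rev, map_mul]
  rfl

theorem cosetAct_mul_right {m : ℕ+} {δ : MetaGL} (h : δ ∈ doubleCoset m) (g : Mp2Z) :
    cosetAct D m (δ * g.1) = weilRep D g⁻¹ ∘ₗ cosetAct D m δ := by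
  obtain ⟨γ, γ', rfl⟩ := h
  have e1 : γ.1 * alpha m * γ'.1 * g.1 = γ.1 * alpha m * (γ' * g).1 := by
    rw [Subgroup.coe_mul]; simp only [mul_assoc]
  rw [e1, cosetAct_eq, cosetAct_eq, tripleAct, tripleAct, mul_inv_rev, map_mul]
  rfl

/-! ### Left cosets in the double coset -/

/-- The class of `δ` modulo left multiplication by the integral metaplectic group. -/
abbrev leftClass (δ : MetaGL) : Quotient (QuotientGroup.rightRel Mp2Z) :=
  Quotient.mk (QuotientGroup.rightRel Mp2Z) δ

theorem leftClass_eq_iff {δ δ' : MetaGL} :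
    leftClass δ = leftClass δ' ↔ ∃ g : Mp2Z, δ' = g.1 * δ := by
  rw [Quotient.eq, QuotientGroup.rightRel_apply]
  constructor
  · intro h
    exact ⟨⟨_, h⟩, by simp⟩
  · rintro ⟨g, rfl⟩
    simp

theorem leftClass_mul (g : Mp2Z) (δ : MetaGL) : leftClass (g.1 * δ) = leftClass δ :=
  (leftClass_eq_iff.mpr ⟨g, rfl⟩).symm

theorem leftClass_mem {m : ℕ+} {δ : MetaGL} (h : δ ∈ doubleCoset m) : leftClass δ ∈ leftCosets m :=
  ⟨δ, h, rfl⟩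

theorem exists_out_eq (δ : MetaGL) : ∃ g : Mp2Z, (leftClass δ).out = g.1 * δ :=
  leftClass_eq_iff.mp (Quotient.out_eq (leftClass δ)).symm

theorem out_mem {m : ℕ+} {c : Quotient (QuotientGroup.rightRel Mp2Z)} (hc : c ∈ leftCosets m) :
    c.out ∈ doubleCoset m := by
  obtain ⟨δ, h, rfl⟩ := hc
  obtain ⟨g, hg⟩ := exists_out_eq δ
  exact hg ▸ mul_mem_doubleCoset h g

theorem exists_alphaRel_of_dvd (m : ℕ+) (g : Mp2Z) (hd : (m : ℤ) ^ 2 ∣ Mp2Z.sl g 1 0) :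
    ∃ g', AlphaRel m g' g := by
  obtain ⟨t, ht⟩ := hd
  have hdet := Mp2Z.sl_det g
  obtain ⟨M, hMv⟩ : ∃ M : SL(2, ℤ), M.1 =
      !![Mp2Z.sl g 0 0, (m : ℤ) ^ 2 * Mp2Z.sl g 0 1; t, Mp2Z.sl g 1 1] := by
    refine ⟨⟨_, ?_⟩, rfl⟩
    rw [Matrix.det_fin_two_of]
    rw [ht] at hdet
    linarith
  have hM : alpha m * g.1 * (alpha m)⁻¹ ∈ Mp2Z := by
    refine ⟨M, ?_⟩
    change _ = (alpha m).mat * g.1.mat * (alpha m).mat⁻¹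
    rw [eq_mul_inv_iff_mul_eq, ← Mp2Z.mapGL_sl g]
    apply Units.ext
    have ht' : (Mp2Z.sl g 1 0 : ℝ) = (m : ℝ) ^ 2 * t := by exact_mod_cast ht
    rw [Units.val_mul, Units.val_mul, alpha_mat_val, Matrix.SpecialLinearGroup.mapGL_coe_matrix,
      Matrix.SpecialLinearGroup.mapGL_coe_matrix]
    ext i j
    fin_cases i <;> fin_cases j <;>
      simp [Matrix.mul_apply, Fin.sum_univ_two, hMv, ht', mul_comm]
  exact ⟨⟨_, hM⟩, by simp [AlphaRel, mul_assoc]⟩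

/-- There are finitely many left cosets: the coset of `αγ` only depends on `γ` modulo `m²`. -/
theorem leftCosets_finite (m : ℕ+) : (leftCosets m).Finite := by
  have : NeZero ((m : ℕ) ^ 2) := ⟨pow_ne_zero _ m.pos.ne'⟩
  let G : Mp2Z → Matrix (Fin 2) (Fin 2) (ZMod ((m : ℕ) ^ 2)) :=
    fun g => (Mp2Z.sl g).1.map (Int.cast)
  have hF : Function.FactorsThrough (fun g : Mp2Z => leftClass (alpha m * g.1)) G := by
    intro g h hgh
    have h10 := congrFun (congrFun hgh 1) 0
    have h11 := congrFun (congrFun hgh 1) 1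
    simp only [G, Matrix.map_apply] at h10 h11
    obtain ⟨u, hu⟩ := exists_alphaRel_of_dvd m (h * g⁻¹) (by
      have e1 : Mp2Z.sl (h * g⁻¹) 1 0 =
          Mp2Z.sl h 1 0 * Mp2Z.sl g 1 1 - Mp2Z.sl h 1 1 * Mp2Z.sl g 1 0 := by
        rw [Mp2Z.sl_mul_apply, map_inv, Matrix.SpecialLinearGroup.coe_inv, Matrix.adjugate_fin_two]
        simp [sub_eq_add_neg]
      have h2 := (ZMod.intCast_zmod_eq_zero_iff_dvd (Mp2Z.sl (h * g⁻¹) 1 0) ((m : ℕ) ^ 2)).mp (by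
        rw [e1]
        push_cast
        rw [h10, h11]
        ring)
      exact_mod_cast h2)
    refine leftClass_eq_iff.mpr ⟨u, ?_⟩
    rw [← mul_assoc, hu, mul_assoc, Subgroup.coe_mul, Subgroup.coe_inv, inv_mul_cancel_right]
  have : Nonempty (Quotient (QuotientGroup.rightRel Mp2Z)) := ⟨leftClass 1⟩
  obtain ⟨E, hE⟩ := (Function.factorsThrough_iff _).mp hF
  refine (Set.finite_range E).subset ?_
  rintro _ ⟨_, ⟨γ, γ', rfl⟩, rfl⟩
  refine ⟨G γ', ?_⟩
  rw [mul_assoc]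
  exact (congrFun hE γ').symm.trans (leftClass_mul γ _).symm

/-- A function on the double coset which is invariant under left multiplication by the integral
metaplectic group may be summed over any system of representatives. -/
theorem finsum_leftCosets {ι E : Type*} [AddCommMonoid E] {m : ℕ+} (F : MetaGL → E)
    (hF : ∀ (g : Mp2Z), ∀ δ ∈ doubleCoset m, F (g.1 * δ) = F δ) (s : Finset ι) (r : ι → MetaGL)
    (hr : ∀ i ∈ s, r i ∈ doubleCoset m)
    (h : ∀ δ ∈ doubleCoset m, ∃! i, i ∈ s ∧ ∃ g : Mp2Z, δ = g.1 * r i) :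
    ∑ᶠ c ∈ leftCosets m, F c.out = ∑ i ∈ s, F (r i) := by
  rw [← finsum_mem_coe_finset]
  symm
  refine finsum_mem_eq_of_bijOn (fun i => leftClass (r i)) ⟨?_, ?_, ?_⟩ ?_
  · exact fun i hi => leftClass_mem (hr i hi)
  · intro i hi j hj hij
    obtain ⟨g, hg⟩ := leftClass_eq_iff.mp hij
    exact (h (r j) (hr j hj)).unique ⟨hi, g, hg⟩ ⟨hj, 1, by simp⟩
  · rintro _ ⟨δ, hδ, rfl⟩
    obtain ⟨i, ⟨hi, g, hg⟩, -⟩ := h δ hδ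
    exact ⟨i, hi, by rw [hg]; exact (leftClass_mul g _).symm⟩
  · intro i hi
    obtain ⟨g, hg⟩ := exists_out_eq (r i)
    rw [hg, hF g _ (hr i hi)]

theorem finsum_leftCosets_out {E : Type*} [AddCommMonoid E] {m : ℕ+} (F : MetaGL → E) :
    ∑ᶠ c ∈ leftCosets m, F c.out = ∑ c ∈ (leftCosets_finite m).toFinset, F c.out :=
  finsum_mem_eq_finite_toFinset_sum _ _

/-- Any choice of one element in each left coset may serve as a system of representatives. -/
theorem sum_out_eq_sum {E : Type*} [AddCommMonoid E] {m : ℕ+} (F : MetaGL → E)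
    (hF : ∀ (g : Mp2Z), ∀ δ ∈ doubleCoset m, F (g.1 * δ) = F δ)
    (r : Quotient (QuotientGroup.rightRel Mp2Z) → MetaGL)
    (hr : ∀ c ∈ leftCosets m, leftClass (r c) = c) :
    ∑ c ∈ (leftCosets_finite m).toFinset, F c.out =
      ∑ c ∈ (leftCosets_finite m).toFinset, F (r c) := by
  refine Finset.sum_congr rfl fun c hc => ?_
  have hc' := (Set.Finite.mem_toFinset _).mp hc
  obtain ⟨g, hg⟩ := leftClass_eq_iff.mp ((Quotient.out_eq c).trans (hr c hc').symm)
  rw [hg, hF g _ (out_mem hc')]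

/-- Invariance of sums over left cosets under right translation. -/
theorem sum_out_mul_right {E : Type*} [AddCommMonoid E] {m : ℕ+} (F : MetaGL → E)
    (hF : ∀ (g : Mp2Z), ∀ δ ∈ doubleCoset m, F (g.1 * δ) = F δ) (h : Mp2Z) :
    ∑ c ∈ (leftCosets_finite m).toFinset, F (c.out * h.1) =
      ∑ c ∈ (leftCosets_finite m).toFinset, F c.out := by
  rw [← finsum_leftCosets_out]
  symm
  refine finsum_leftCosets F hF _ (fun c => c.out * h.1) (fun c hc =>
    doubleCoset_mul_mem (out_mem ((Set.Finite.mem_toFinset _).mp hc)) h) ?_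
  intro δ hδ
  refine ⟨leftClass (δ * h⁻¹.1), ⟨(Set.Finite.mem_toFinset _).mpr
    (leftClass_mem (doubleCoset_mul_mem hδ h⁻¹)), ?_⟩, ?_⟩
  · obtain ⟨g, hg⟩ := exists_out_eq (δ * h⁻¹.1)
    refine ⟨g⁻¹, ?_⟩
    rw [hg]
    simp [mul_assoc]
  · rintro c ⟨-, g, rfl⟩
    rw [mul_assoc, mul_assoc, Subgroup.coe_inv, mul_inv_cancel, mul_one, leftClass_mul]
    exact (Quotient.out_eq c).symm

end Cosets

/-! ### The slash operators -/

section Slash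

variable {A : Type*} [AddCommGroup A] [Fintype A] (D : DiscriminantForm A) {κ : ℤ}

/-- The scalar factor `det(M)^{k/2} φ(τ)^{-2k}`. -/
def autFactor (κ : ℤ) (δ : MetaGL) (τ : ℍ) : ℂ :=
  ((δ.det ^ ((κ : ℝ) / 4) : ℝ) : ℂ) * δ.phi τ ^ (-κ)

theorem slash_apply (κ : ℤ) (δ : MetaGL) (L : Module.End ℂ (A → ℂ)) (f : ℍ → A → ℂ) (τ : ℍ) :
    slash κ δ L f τ = autFactor κ δ τ • L (f (δ.act τ)) := by
  rw [end_apply L (f (δ.act τ)), Finset.smul_sum]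
  refine Finset.sum_congr rfl fun l _ => ?_
  rw [smul_smul]
  rfl

theorem MetaGL.det_mul (g h : MetaGL) : (g * h).det = g.det * h.det := by
  simp [MetaGL.det]

theorem autFactor_mul (κ : ℤ) (g h : MetaGL) (τ : ℍ) :
    autFactor κ (g * h) τ = autFactor κ g (h.act τ) * autFactor κ h τ := by
  rw [autFactor, autFactor, autFactor, MetaGL.det_mul,
    Real.mul_rpow (x := g.det) (y := h.det) g.det_pos.le h.det_pos.le,
    MetaGL.mul_phi_act, mul_zpow]
  push_cast
  ring

theorem slash_slash (κ : ℤ) (δ δ' : MetaGL) (L L' : Module.End ℂ (A → ℂ)) (f : ℍ → A → ℂ) :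
    slash κ δ' L' (slash κ δ L f) = slash κ (δ * δ') (L' ∘ₗ L) f := by
  funext τ
  rw [slash_apply, slash_apply, slash_apply, autFactor_mul, map_smul, smul_smul, MetaGL.mul_act,
    mul_comm]
  rfl

theorem slash_add (κ : ℤ) (δ : MetaGL) (L : Module.End ℂ (A → ℂ)) (f g : ℍ → A → ℂ) :
    slash κ δ L (f + g) = slash κ δ L f + slash κ δ L g := by
  funext τ
  simp only [slash_apply, Pi.add_apply, map_add, smul_add]

theorem slash_smul (κ : ℤ) (δ : MetaGL) (L : Module.End ℂ (A → ℂ)) (c : ℂ) (f : ℍ → A → ℂ) :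
    slash κ δ L (c • f) = c • slash κ δ L f := by
  funext τ
  simp only [slash_apply, Pi.smul_apply, map_smul]
  rw [smul_comm]

theorem slash_sum {ι : Type*} (κ : ℤ) (δ : MetaGL) (L : Module.End ℂ (A → ℂ)) (s : Finset ι)
    (f : ι → ℍ → A → ℂ) : slash κ δ L (∑ i ∈ s, f i) = ∑ i ∈ s, slash κ δ L (f i) := by
  funext τ
  simp only [slash_apply, Finset.sum_apply, map_sum, Finset.smul_sum]

theorem Mp2Z.det_eq_one (g : Mp2Z) : g.1.det = 1 := by
  rw [MetaGL.det, ← Mp2Z.mapGL_sl]; simp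

theorem autFactor_mp2Z (g : Mp2Z) (τ : ℍ) : autFactor κ g.1 τ = g.1.phi τ ^ (-κ) := by
  rw [autFactor, Mp2Z.det_eq_one]; simp

/-- The transformation law of modular forms in terms of slash operators. -/
theorem slash_weilRep_iff {f : ℍ → A → ℂ} {g : Mp2Z} : slash κ g.1 (weilRep D g⁻¹) f = f ↔
    ∀ τ, f (g.1.act τ) = g.1.phi τ ^ κ • weilRep D g (f τ) := by
  rw [funext_iff]
  refine forall_congr' fun τ => ?_
  have hz : g.1.phi τ ^ κ ≠ 0 := zpow_ne_zero _ (g.1.phi_ne_zero τ)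
  rw [slash_apply, autFactor_mp2Z, zpow_neg]
  constructor
  · intro h
    rw [← h, map_smul, smul_smul, mul_inv_cancel₀ hz, one_smul, DiscriminantForm.weilRep_apply_inv]
  · intro h
    rw [h, map_smul, smul_smul, inv_mul_cancel₀ hz, one_smul, DiscriminantForm.weilRep_inv_apply]

/-- The summand `∑_λ (f_λ ∣_k δ) ⊗ (𝔢_λ ∣ δ)` of the Hecke operator. -/
def heckeTerm (D : DiscriminantForm A) (κ : ℤ) (m : ℕ+) (f : ℍ → A → ℂ) (δ : MetaGL) : ℍ → A → ℂ :=
  slash κ δ (cosetAct D m δ) f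

variable {D} {m : ℕ+} {f : ℍ → A → ℂ}

theorem heckeTerm_mul_left (hf : f ∈ modularForms D κ) (g : Mp2Z) (δ : MetaGL)
    (hδ : δ ∈ doubleCoset m) : heckeTerm D κ m f (g.1 * δ) = heckeTerm D κ m f δ := by
  rw [heckeTerm, cosetAct_mul_left D hδ, ← slash_slash, (slash_weilRep_iff D).mpr (hf.2.1 g),
    heckeTerm]

theorem slash_heckeTerm (g : Mp2Z) {δ : MetaGL} (hδ : δ ∈ doubleCoset m) :
    slash κ g.1 (weilRep D g⁻¹) (heckeTerm D κ m f δ) = heckeTerm D κ m f (δ * g.1) := by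
  rw [heckeTerm, slash_slash, ← cosetAct_mul_right D hδ, heckeTerm]

/-- The normalising factor `m^{k-2}`. -/
def heckeConst (κ : ℤ) (m : ℕ+) : ℂ := (((m : ℝ) ^ ((κ : ℝ) / 2 - 2) : ℝ) : ℂ)

theorem hecke_eq_sum (D : DiscriminantForm A) (κ : ℤ) (m : ℕ+) (f : ℍ → A → ℂ) :
    hecke D κ m f = heckeConst κ m •
      ∑ c ∈ (leftCosets_finite m).toFinset, heckeTerm D κ m f c.out := by
  rw [← finsum_leftCosets_out]
  rfl

theorem hecke_add (D : DiscriminantForm A) (κ : ℤ) (m : ℕ+) (f g : ℍ → A → ℂ) :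
    hecke D κ m (f + g) = hecke D κ m f + hecke D κ m g := by
  simp only [hecke_eq_sum, heckeTerm, slash_add, Finset.sum_add_distrib, smul_add]

theorem hecke_smul (D : DiscriminantForm A) (κ : ℤ) (m : ℕ+) (c : ℂ) (f : ℍ → A → ℂ) :
    hecke D κ m (c • f) = c • hecke D κ m f := by
  simp only [hecke_eq_sum, heckeTerm, slash_smul, ← Finset.smul_sum]
  rw [smul_comm]

theorem hecke_eq_sum_of_isCosetSystem {R : Finset (Mp2Z × Mp2Z)} (hR : IsCosetSystem m R)
    (hf : f ∈ modularForms D κ) : hecke D κ m f = heckeConst κ m •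
      ∑ p ∈ R, slash κ (p.1.1 * alpha m * p.2.1) (tripleAct D m p.1 p.2) f := by
  rw [hecke_eq_sum, ← finsum_leftCosets_out,
    finsum_leftCosets _ (heckeTerm_mul_left hf) R (fun p => p.1.1 * alpha m * p.2.1)
      (fun p _ => ⟨p.1, p.2, rfl⟩) hR]
  simp only [heckeTerm, cosetAct_eq]

theorem hecke_transform (hf : f ∈ modularForms D κ) (g : Mp2Z) (τ : ℍ) :
    hecke D κ m f (g.1.act τ) = g.1.phi τ ^ κ • weilRep D g (hecke D κ m f τ) := by
  revert τ
  rw [← slash_weilRep_iff, hecke_eq_sum, slash_smul, slash_sum,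
    ← sum_out_mul_right (heckeTerm D κ m f) (heckeTerm_mul_left hf) g]
  congr 1
  exact Finset.sum_congr rfl fun c hc =>
    slash_heckeTerm g (out_mem ((Set.Finite.mem_toFinset _).mp hc))

theorem mdifferentiable_fun_sum {ι : Type*} (s : Finset ι) (F : ι → ℍ → ℂ)
    (h : ∀ i ∈ s, MDifferentiable 𝓘(ℂ) 𝓘(ℂ) (F i)) :
    MDifferentiable 𝓘(ℂ) 𝓘(ℂ) (fun τ => ∑ i ∈ s, F i τ) := by
  classical
  induction s using Finset.induction_on with
  | empty => simpa using mdifferentiable_const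
  | insert i s hi ih =>
    simp only [Finset.sum_insert hi]
    exact (h i (Finset.mem_insert_self i s)).add
      (ih fun j hj => h j (Finset.mem_insert_of_mem hj))

theorem slash_mdifferentiable (hf : ∀ l, MDifferentiable 𝓘(ℂ) 𝓘(ℂ) (fun τ => f τ l)) (δ : MetaGL)
    (L : Module.End ℂ (A → ℂ)) (l : A) :
    MDifferentiable 𝓘(ℂ) 𝓘(ℂ) (fun τ => slash κ δ L f τ l) := by
  have h1 : (fun τ => slash κ δ L f τ l) = fun τ => autFactor κ δ τ *
      ∑ k, f (δ.act τ) k * L (basisVec k) l := by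
    funext τ
    rw [slash_apply, end_apply L, Pi.smul_apply, Finset.sum_apply]
    rfl
  rw [h1]
  have h2 : MDifferentiable 𝓘(ℂ) 𝓘(ℂ) (fun τ => autFactor κ δ τ) := by
    refine mdifferentiable_const.mul fun τ => ?_
    exact MDifferentiableAt.comp (g := fun z : ℂ => z ^ (-κ)) τ
      (differentiableAt_zpow.mpr (Or.inl (δ.phi_ne_zero τ))).mdifferentiableAt (δ.holo τ)
  refine h2.mul ?_
  refine mdifferentiable_fun_sum _ _ fun k _ => ?_
  exact ((hf k).comp (mdifferentiable_smul δ.det_pos)).mul mdifferentiable_const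

theorem hecke_mdifferentiable (hf : ∀ l, MDifferentiable 𝓘(ℂ) 𝓘(ℂ) (fun τ => f τ l)) (l : A) :
    MDifferentiable 𝓘(ℂ) 𝓘(ℂ) (fun τ => hecke D κ m f τ l) := by
  have h1 : (fun τ => hecke D κ m f τ l) = fun τ => heckeConst κ m *
      ∑ c ∈ (leftCosets_finite m).toFinset, heckeTerm D κ m f c.out τ l := by
    funext τ
    rw [hecke_eq_sum, Pi.smul_apply, Finset.sum_apply, Pi.smul_apply, Finset.sum_apply]
    rfl
  rw [h1]
  exact mdifferentiable_const.mul (mdifferentiable_fun_sum _ _ fun c _ =>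
    slash_mdifferentiable hf _ _ l)

end Slash

/-! ### Behaviour of Hecke operators at the cusp -/

theorem Mp2Z.exists_sl_eq (M : SL(2, ℤ)) : ∃ g : Mp2Z, Mp2Z.sl g = M := by
  have hM : M ∈ (Subgroup.closure {mpS, mpT}).map Mp2Z.sl := by
    rw [MonoidHom.map_closure, Set.image_pair, Mp2Z.sl_mpS, Mp2Z.sl_mpT,
      SpecialLinearGroup.SL2Z_generators]
    exact Subgroup.mem_top M
  obtain ⟨g, -, hg⟩ := hM
  exact ⟨g, hg⟩

theorem exists_int_entries {m : ℕ+} {δ : MetaGL} (h : δ ∈ doubleCoset m) :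
    ∃ N : Matrix (Fin 2) (Fin 2) ℤ, δ.mat.1 = N.map (Int.cast) := by
  obtain ⟨γ, γ', rfl⟩ := h
  refine ⟨(Mp2Z.sl γ).1 * !![(m : ℤ) ^ 2, 0; 0, 1] * (Mp2Z.sl γ').1, ?_⟩
  rw [MetaGL.mul_mat, MetaGL.mul_mat, Units.val_mul, Units.val_mul, ← Mp2Z.mapGL_sl,
    ← Mp2Z.mapGL_sl, Matrix.SpecialLinearGroup.mapGL_coe_matrix,
    Matrix.SpecialLinearGroup.mapGL_coe_matrix, alpha_mat_val]
  ext i j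
  fin_cases i <;> fin_cases j <;> simp [Matrix.mul_apply, Fin.sum_univ_two]

theorem exists_int_entries_inv {m : ℕ+} {δ : MetaGL} (h : δ ∈ doubleCoset m) :
    ∃ N : Matrix (Fin 2) (Fin 2) ℤ, (m : ℝ) ^ 2 • (δ⁻¹).mat.1 = N.map (Int.cast) := by
  obtain ⟨γ, γ', rfl⟩ := h
  refine ⟨(Mp2Z.sl γ'⁻¹).1 * !![1, 0; 0, (m : ℤ) ^ 2] * (Mp2Z.sl γ⁻¹).1, ?_⟩
  have hm : ((m : ℕ) : ℝ) ≠ 0 := by positivity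
  have ha : (m : ℝ) ^ 2 • ((alpha m)⁻¹).mat.1 = !![1, 0; 0, (m : ℝ) ^ 2] := by
    have h1 : (alpha m).mat⁻¹.1 = !![((m : ℝ) ^ 2)⁻¹, 0; 0, 1] := by
      have h2 : (alpha m).mat.1 * !![((m : ℝ) ^ 2)⁻¹, 0; 0, 1] = 1 := by
        rw [alpha_mat_val]
        ext i j
        fin_cases i <;> fin_cases j <;> simp [Matrix.mul_apply, Fin.sum_univ_two, hm]
      have h3 := Units.inv_mul_cancel_left (alpha m).mat !![((m : ℝ) ^ 2)⁻¹, 0; 0, 1]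
      rwa [h2, mul_one] at h3
    rw [MetaGL.inv_mat, h1]
    ext i j
    fin_cases i <;> fin_cases j <;> simp [hm]
  have e1 : (γ.1 * alpha m * γ'.1)⁻¹ = γ'⁻¹.1 * (alpha m)⁻¹ * γ⁻¹.1 := by
    simp [mul_assoc]
  rw [e1]
  generalize γ⁻¹ = u
  generalize γ'⁻¹ = v
  rw [MetaGL.mul_mat, MetaGL.mul_mat, Units.val_mul, Units.val_mul, ← Matrix.smul_mul,
    ← Matrix.mul_smul, ha, ← Mp2Z.mapGL_sl, ← Mp2Z.mapGL_sl,
    Matrix.SpecialLinearGroup.mapGL_coe_matrix, Matrix.SpecialLinearGroup.mapGL_coe_matrix]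
  ext i j
  fin_cases i <;> fin_cases j <;> simp [Matrix.mul_apply, Fin.sum_univ_two]

/-- Every left coset contains an upper triangular element. -/
theorem exists_upper_triangular {m : ℕ+} {δ : MetaGL} (h : δ ∈ doubleCoset m) :
    ∃ g : Mp2Z, (g.1 * δ).mat.1 1 0 = 0 := by
  obtain ⟨N, hN⟩ := exists_int_entries h
  have hdet : N.det ≠ 0 := by
    intro h0
    have h1 := δ.det_pos.ne'
    apply h1
    change δ.mat.1.det = 0
    rw [hN]
    have := (Int.castRingHom ℝ).map_det N
    rw [h0] at this
    simpa using this.symm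
  have hg : N 0 0 ≠ 0 ∨ N 1 0 ≠ 0 := by
    by_contra! hh
    rw [Matrix.det_fin_two, hh.1, hh.2] at hdet
    simp at hdet
  have hgcd : 0 < Int.gcd (N 0 0) (N 1 0) := Int.gcd_pos_iff.mpr hg
  obtain ⟨a', ha'⟩ := Int.gcd_dvd_left (a := N 0 0) (b := N 1 0)
  obtain ⟨c', hc'⟩ := Int.gcd_dvd_right (a := N 0 0) (b := N 1 0)
  have hg0 : (Int.gcd (N 0 0) (N 1 0) : ℤ) ≠ 0 := by exact_mod_cast hgcd.ne'
  have hb := Int.gcd_eq_gcd_ab (N 0 0) (N 1 0)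
  generalize Int.gcdA (N 0 0) (N 1 0) = u at hb
  generalize Int.gcdB (N 0 0) (N 1 0) = v at hb
  generalize (Int.gcd (N 0 0) (N 1 0) : ℤ) = g0 at ha' hc' hg0 hb
  have hcop : IsCoprime (-c') a' := by
    refine ⟨-v, u, mul_left_cancel₀ hg0 ?_⟩
    linear_combination -hb - u * ha' - v * hc'
  obtain ⟨M, -, hM⟩ := ModularGroup.bottom_row_surj (R := ℤ) (show ![-c', a'] ∈ _ from hcop)
  obtain ⟨g, rfl⟩ := Mp2Z.exists_sl_eq M
  refine ⟨g, ?_⟩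
  have h10 : Mp2Z.sl g 1 0 = -c' := congrFun hM 0
  have h11 : Mp2Z.sl g 1 1 = a' := congrFun hM 1
  rw [MetaGL.mul_mat, Units.val_mul, ← Mp2Z.mapGL_sl, Matrix.SpecialLinearGroup.mapGL_coe_matrix,
    hN, Matrix.mul_apply, Fin.sum_univ_two]
  simp only [Matrix.map_apply, Matrix.SpecialLinearGroup.map_apply_coe, RingHom.mapMatrix_apply,
    h10, h11, eq_intCast, algebraMap_int_eq, ha', hc']
  push_cast
  ring

section Cusp

variable {δ : MetaGL}

theorem denom_of_upper_triangular (h : δ.mat.1 1 0 = 0) (τ : ℍ) :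
    denom δ.mat τ = (δ.mat.1 1 1 : ℂ) := by
  rw [denom, h]; simp

theorem tendsto_act_atImInfty (h : δ.mat.1 1 0 = 0) :
    Filter.Tendsto δ.act atImInfty atImInfty := by
  rw [atImInfty, Filter.tendsto_comap_iff]
  have hne := δ.det_pos.ne'
  have hd : (δ.mat.1 1 1 : ℂ) ≠ 0 := by
    rw [← denom_of_upper_triangular h UpperHalfPlane.I]
    exact denom_ne_zero _ _
  have e1 : UpperHalfPlane.im ∘ δ.act =
      fun τ => (|δ.mat.det.val| / Complex.normSq (δ.mat.1 1 1 : ℂ)) * τ.im := by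
    funext τ
    rw [Function.comp_apply, MetaGL.act, im_smul_eq_div_normSq, denom_of_upper_triangular h]
    ring
  rw [e1]
  exact (Filter.tendsto_comap).const_mul_atTop
    (div_pos (abs_pos.mpr hne) (Complex.normSq_pos.mpr hd))

theorem norm_autFactor_of_upper_triangular (h : δ.mat.1 1 0 = 0) (κ : ℤ) (τ : ℍ) :
    ‖autFactor κ δ τ‖ = ‖autFactor κ δ UpperHalfPlane.I‖ := by
  have hn (τ : ℍ) : ‖δ.phi τ‖ ^ 2 = ‖(δ.mat.1 1 1 : ℂ)‖ := by
    rw [← norm_pow, δ.sq, denom_of_upper_triangular h]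
  have h2 : ‖δ.phi τ‖ = ‖δ.phi UpperHalfPlane.I‖ := by
    rw [← sq_eq_sq₀ (norm_nonneg _) (norm_nonneg _), hn, hn]
  rw [autFactor, autFactor, norm_mul, norm_mul, norm_zpow, norm_zpow, h2]

variable {A : Type*} [AddCommGroup A] [Fintype A] {κ : ℤ} {f : ℍ → A → ℂ}

theorem slash_apply_apply (L : Module.End ℂ (A → ℂ)) (τ : ℍ) (l : A) :
    slash κ δ L f τ l = ∑ k, f (δ.act τ) k * (autFactor κ δ τ * L (basisVec k) l) := by
  rw [slash_apply, end_apply L, Pi.smul_apply, Finset.sum_apply, smul_eq_mul, Finset.mul_sum]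
  refine Finset.sum_congr rfl fun k _ => ?_
  rw [Pi.smul_apply, smul_eq_mul]
  ring

theorem isBounded_const_factor (h : δ.mat.1 1 0 = 0) (z : ℂ) :
    Filter.BoundedAtFilter atImInfty (fun τ => autFactor κ δ τ * z) := by
  refine Asymptotics.IsBigO.of_bound (‖autFactor κ δ UpperHalfPlane.I‖ * ‖z‖)
    (Filter.Eventually.of_forall fun τ => ?_)
  rw [norm_mul, norm_autFactor_of_upper_triangular h]
  simp

theorem isBoundedAtImInfty_fun_sum {ι : Type*} (s : Finset ι) (F : ι → ℍ → ℂ)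
    (h : ∀ i ∈ s, IsBoundedAtImInfty (F i)) : IsBoundedAtImInfty (fun τ => ∑ i ∈ s, F i τ) := by
  have := Asymptotics.IsBigO.sum (g := (1 : ℍ → ℝ)) (l := atImInfty) h
  rwa [Finset.sum_fn] at this

theorem slash_isBoundedAtImInfty (h : δ.mat.1 1 0 = 0) (L : Module.End ℂ (A → ℂ))
    (hf : ∀ l, IsBoundedAtImInfty (fun τ => f τ l)) (l : A) :
    IsBoundedAtImInfty (fun τ => slash κ δ L f τ l) := by
  simp only [slash_apply_apply]
  refine isBoundedAtImInfty_fun_sum _ _ fun k _ => ?_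
  exact Filter.BoundedAtFilter.mul ((hf k).comp_tendsto (tendsto_act_atImInfty h))
    (isBounded_const_factor h _)

theorem slash_isZeroAtImInfty (h : δ.mat.1 1 0 = 0) (L : Module.End ℂ (A → ℂ))
    (hf : ∀ l, IsZeroAtImInfty (fun τ => f τ l)) (l : A) :
    IsZeroAtImInfty (fun τ => slash κ δ L f τ l) := by
  simp only [slash_apply_apply]
  have h0 : (0 : ℂ) = ∑ _k : A, 0 := by simp
  rw [IsZeroAtImInfty, Filter.ZeroAtFilter, h0]
  refine tendsto_finsetSum _ fun k _ => ?_
  have h1 : Filter.Tendsto (fun τ => f (δ.act τ) k) atImInfty (nhds 0) :=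
    Filter.Tendsto.comp (hf k) (tendsto_act_atImInfty h)
  have h2 := isBounded_const_factor (κ := κ) h (L (basisVec k) l)
  have h3 := (Asymptotics.isLittleO_one_iff ℝ).mpr h1
  have h4 := h3.mul_isBigO (h2 : _ =O[atImInfty] (1 : ℍ → ℝ))
  exact (Asymptotics.isLittleO_one_iff ℝ).mp (by simpa using h4)

variable {D : DiscriminantForm A} {m : ℕ+}

/-- The Hecke operator as a sum over upper triangular representatives. -/
theorem hecke_eq_sum_upper_triangular (m : ℕ+) :
    ∃ r : Quotient (QuotientGroup.rightRel Mp2Z) → MetaGL,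
    (∀ c ∈ leftCosets m, (r c).mat.1 1 0 = 0) ∧
    ∀ (D : DiscriminantForm A) (κ : ℤ), ∀ f ∈ modularForms D κ, hecke D κ m f = heckeConst κ m •
      ∑ c ∈ (leftCosets_finite m).toFinset, heckeTerm D κ m f (r c) := by
  have h : ∀ c : Quotient (QuotientGroup.rightRel Mp2Z), ∃ δ : MetaGL, c ∈ leftCosets m →
      leftClass δ = c ∧ δ.mat.1 1 0 = 0 := by
    intro c
    by_cases hc : c ∈ leftCosets m
    · obtain ⟨g, hg⟩ := exists_upper_triangular (out_mem hc)
      exact ⟨g.1 * c.out, fun _ => ⟨(leftClass_mul g _).trans (Quotient.out_eq c), hg⟩⟩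
    · exact ⟨1, fun h => absurd h hc⟩
  choose r hr using h
  refine ⟨r, fun c hc => (hr c hc).2, fun D κ f hf => ?_⟩
  rw [hecke_eq_sum, sum_out_eq_sum _ (heckeTerm_mul_left hf) r (fun c hc => (hr c hc).1)]

theorem hecke_apply_apply {s : Finset (Quotient (QuotientGroup.rightRel Mp2Z))}
    {r : Quotient (QuotientGroup.rightRel Mp2Z) → MetaGL}
    (h : hecke D κ m f = heckeConst κ m • ∑ c ∈ s, heckeTerm D κ m f (r c)) (l : A) :
    (fun τ => hecke D κ m f τ l) =
      fun τ => heckeConst κ m * ∑ c ∈ s, heckeTerm D κ m f (r c) τ l := by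
  funext τ
  rw [h, Pi.smul_apply, Finset.sum_apply, Pi.smul_apply, Finset.sum_apply]
  rfl

theorem hecke_mem_modularForms (hf : f ∈ modularForms D κ) : hecke D κ m f ∈ modularForms D κ := by
  refine ⟨hecke_mdifferentiable hf.1, hecke_transform hf, fun l => ?_⟩
  obtain ⟨r, hr, h⟩ := hecke_eq_sum_upper_triangular (A := A) m
  rw [hecke_apply_apply (h D κ f hf) l]
  refine Filter.BoundedAtFilter.mul (Filter.const_boundedAtFilter _ _) ?_
  refine isBoundedAtImInfty_fun_sum _ _ fun c hc => ?_
  exact slash_isBoundedAtImInfty (hr c ((Set.Finite.mem_toFinset _).mp hc)) _ hf.2.2 l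

theorem hecke_mem_cuspForms (hf : f ∈ cuspForms D κ) : hecke D κ m f ∈ cuspForms D κ := by
  refine ⟨hecke_mem_modularForms hf.1, fun l => ?_⟩
  obtain ⟨r, hr, h⟩ := hecke_eq_sum_upper_triangular (A := A) m
  rw [hecke_apply_apply (h D κ f hf.1) l, IsZeroAtImInfty, Filter.ZeroAtFilter,
    ← mul_zero (heckeConst κ m)]
  refine Filter.Tendsto.const_mul _ ?_
  rw [← Finset.sum_const_zero (s := (leftCosets_finite m).toFinset) (M := ℂ)]
  exact tendsto_finsetSum _ fun c hc =>
    slash_isZeroAtImInfty (hr c ((Set.Finite.mem_toFinset _).mp hc)) _ hf.2 l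

/-- The Hecke operator `T(m²)^*` as an endomorphism of the space of modular forms. -/
def heckeEnd (D : DiscriminantForm A) (κ : ℤ) (m : ℕ+) : Module.End ℂ (modularForms D κ) where
  toFun f := ⟨hecke D κ m f, hecke_mem_modularForms f.2⟩
  map_add' f g := Subtype.ext (hecke_add D κ m f g)
  map_smul' c f := Subtype.ext (hecke_smul D κ m c f)

end Cusp

/-! ### Multiplicativity -/

section Mult

variable {m n : ℕ+}

/-- For coprime `m`, `n` every element is the product of one that is upper triangular modulo `n²`
and one that is lower triangular modulo `m²`. -/
theorem exists_factorization (h : Nat.Coprime m n) (β : Mp2Z) : ∃ w' w : Mp2Z, β = w' * w ∧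
    (m : ℤ) ^ 2 ∣ Mp2Z.sl w 0 1 ∧ (n : ℤ) ^ 2 ∣ Mp2Z.sl w' 1 0 := by
  by_cases hn : n = 1
  · exact ⟨β, 1, by simp, by simp, by simp [hn]⟩
  have hN1 : ¬IsUnit ((n : ℤ) ^ 2) := by
    rw [isUnit_pow_iff two_ne_zero, Int.isUnit_iff_natAbs_eq, Int.natAbs_natCast]
    exact fun h => hn (PNat.coe_eq_one_iff.mp h)
  obtain ⟨u, v, huv⟩ : IsCoprime ((m : ℤ) ^ 2) ((n : ℤ) ^ 2) :=
    (Nat.isCoprime_iff_coprime.mpr h).pow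
  have hdet := Mp2Z.sl_det β
  generalize hM : (m : ℤ) ^ 2 = M at *
  generalize hN : (n : ℤ) ^ 2 = N at *
  set a := Mp2Z.sl β 0 0
  set b := Mp2Z.sl β 0 1
  set c := Mp2Z.sl β 1 0
  set d := Mp2Z.sl β 1 1
  -- the first column of `w⁻¹`, up to a common factor prime to `n`
  set X := d * u * M + v * N
  set Y := -c * u * M
  have hN0 : N ≠ 0 := by rw [← hN]; exact pow_ne_zero _ (by exact_mod_cast n.pos.ne')
  have hXY : c * X + d * Y = c * v * N := by simp only [X, Y]; ring
  have habN : a * X + b * Y = 1 + (a - 1) * v * N := by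
    simp only [X, Y]; linear_combination u * M * hdet + huv
  have hXM : IsCoprime X M := ⟨1, -(d - 1) * u, by simp only [X]; linear_combination huv⟩
  obtain ⟨x, hx⟩ := Int.gcd_dvd_left (a := X) (b := Y)
  obtain ⟨y, hy⟩ := Int.gcd_dvd_right (a := X) (b := Y)
  have hb := Int.gcd_eq_gcd_ab X Y
  generalize Int.gcdA X Y = r at hb
  generalize Int.gcdB X Y = s at hb
  generalize (Int.gcd X Y : ℤ) = g at hx hy hb
  have hgN : IsCoprime g N := ⟨a * x + b * y, -(a - 1) * v, by
    linear_combination habN - a * hx - b * hy⟩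
  have hg0 : g ≠ 0 := by
    rintro rfl
    exact hN1 (hgN.isUnit_of_dvd' (dvd_zero _) dvd_rfl)
  have hxy : x * r + y * s = 1 := mul_left_cancel₀ hg0 (by linear_combination -hb - r * hx - s * hy)
  have hxM : IsCoprime x M := IsCoprime.of_mul_left_right (hx ▸ hXM)
  obtain ⟨p, q, hpq⟩ := hxM
  -- the second column, made divisible by `m²` in its first entry
  let W : SL(2, ℤ) := ⟨!![x, -s + (s * p) * x; y, r + (s * p) * y], by
    rw [Matrix.det_fin_two_of]; linear_combination hxy⟩
  obtain ⟨w, hw⟩ := Mp2Z.exists_sl_eq W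
  have w00 : Mp2Z.sl w 0 0 = x := by rw [hw]; rfl
  have w01 : Mp2Z.sl w 0 1 = -s + (s * p) * x := by rw [hw]; rfl
  have w10 : Mp2Z.sl w 1 0 = y := by rw [hw]; rfl
  refine ⟨β * w, w⁻¹, by simp, ?_, ?_⟩
  · rw [map_inv, Matrix.SpecialLinearGroup.coe_inv, Matrix.adjugate_fin_two]
    simp only [Matrix.of_apply, Matrix.cons_val', Matrix.cons_val_zero, Matrix.cons_val_one,
      Matrix.cons_val_fin_one, w01]
    exact ⟨s * q, by linear_combination -s * hpq⟩
  · rw [Mp2Z.sl_mul_apply, w00, w10]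
    refine hgN.symm.dvd_of_dvd_mul_left (Dvd.intro_left (c * v) ?_)
    rw [← hXY]; linear_combination c * hx + d * hy

theorem alpha_mul_alpha (m n : ℕ+) : alpha n * alpha m = alpha (m * n) := by
  ext1
  · apply Units.ext
    rw [MetaGL.mul_mat, Units.val_mul, alpha_mat_val, alpha_mat_val, alpha_mat_val]
    ext i j
    fin_cases i <;> fin_cases j <;> simp [Matrix.mul_apply, Fin.sum_univ_two]
    ring
  · funext τ
    rw [MetaGL.mul_phi_act, alpha_phi, alpha_phi, alpha_phi, one_mul]

theorem exists_mul_eq (h : Nat.Coprime m n) (β : Mp2Z) : ∃ w w' v v' : Mp2Z, β = w' * v ∧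
    AlphaRel n w w' ∧ AlphaRel m v v' ∧ alpha n * β.1 * alpha m = w.1 * alpha (m * n) * v'.1 := by
  obtain ⟨w', v, hβ, hv, hw⟩ := exists_factorization h β
  obtain ⟨w, hw⟩ := exists_alphaRel_of_dvd n w' hw
  obtain ⟨v', hv⟩ := AlphaRel.exists_of_dvd m v hv
  refine ⟨w, w', v, v', hβ, hw, hv, ?_⟩
  rw [AlphaRel] at hw hv
  rw [hβ, Subgroup.coe_mul, ← mul_assoc, ← hw, mul_assoc, hv, ← mul_assoc, mul_assoc w.1,
    alpha_mul_alpha]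

variable {A : Type*} [AddCommGroup A] [Fintype A] (D : DiscriminantForm A)

theorem alphaAct_mul (m n : ℕ+) :
    (alphaAct m : Module.End ℂ (A → ℂ)) ∘ₗ alphaAct n = alphaAct (m * n) :=
  end_ext fun l => by
    rw [LinearMap.comp_apply, alphaAct_basisVec, alphaAct_basisVec, alphaAct_basisVec, PNat.mul_coe,
      mul_smul]

/-- For coprime `m`, `n` the double cosets multiply, and so do the actions on `ℂ[A]`: the element
between the two factors `α` can be split so that one part moves past either of them. -/
theorem mul_mem_doubleCoset_mul (h : Nat.Coprime m n) {δ ε : MetaGL} (hδ : δ ∈ doubleCoset n)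
    (hε : ε ∈ doubleCoset m) : δ * ε ∈ doubleCoset (m * n) ∧
      cosetAct D (m * n) (δ * ε) = cosetAct D m ε ∘ₗ cosetAct D n δ := by
  obtain ⟨γ₁, γ₁', rfl⟩ := hδ
  obtain ⟨γ₂, γ₂', rfl⟩ := hε
  obtain ⟨w, w', v, v', hβ, hw, hv, he⟩ := exists_mul_eq h (γ₁' * γ₂)
  have e1 : γ₁.1 * alpha n * γ₁'.1 * (γ₂.1 * alpha m * γ₂'.1) =
      (γ₁ * w).1 * alpha (m * n) * (v' * γ₂').1 := by
    have : γ₁.1 * alpha n * γ₁'.1 * (γ₂.1 * alpha m * γ₂'.1) =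
        γ₁.1 * (alpha n * (γ₁' * γ₂).1 * alpha m) * γ₂'.1 := by
      rw [Subgroup.coe_mul]; simp only [mul_assoc]
    rw [this, he, Subgroup.coe_mul, Subgroup.coe_mul]
    simp only [mul_assoc]
  refine ⟨⟨_, _, e1⟩, ?_⟩
  rw [e1, cosetAct_eq, cosetAct_eq, cosetAct_eq]
  ext1 x
  simp only [tripleAct, LinearMap.comp_apply, mul_inv_rev, map_mul, Module.End.mul_apply]
  rw [← alphaAct_mul, LinearMap.comp_apply,
    ← D.intertwines_of_alphaRel hw.inv, D.intertwines_of_alphaRel hv.inv,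
    ← Module.End.mul_apply (weilRep D v⁻¹), ← map_mul, ← mul_inv_rev, ← hβ, mul_inv_rev, map_mul,
    Module.End.mul_apply]

theorem mem_Mp2Z_of_int_entries {δ : MetaGL} (hdet : δ.det = 1) {N : Matrix (Fin 2) (Fin 2) ℤ}
    (hN : δ.mat.1 = N.map (Int.cast)) : δ ∈ Mp2Z := by
  have h1 : N.det = 1 := by
    have h2 : δ.mat.1.det = 1 := hdet
    rw [hN] at h2
    have := (Int.castRingHom ℝ).map_det N
    have h3 : ((N.det : ℤ) : ℝ) = 1 := this.trans h2
    exact_mod_cast h3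
  obtain ⟨M, hM⟩ : ∃ M : SL(2, ℤ), M.1 = N := ⟨⟨N, h1⟩, rfl⟩
  refine ⟨M, Units.ext ?_⟩
  rw [Matrix.SpecialLinearGroup.mapGL_coe_matrix]
  change _ = δ.mat.1
  rw [hN, ← hM]
  rfl

theorem det_of_mem_doubleCoset {δ : MetaGL} (hδ : δ ∈ doubleCoset m) : δ.det = (m : ℝ) ^ 2 := by
  obtain ⟨γ, γ', rfl⟩ := hδ
  rw [MetaGL.det_mul, MetaGL.det_mul, Mp2Z.det_eq_one, Mp2Z.det_eq_one, one_mul, mul_one]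
  change (alpha m).mat.1.det = _
  rw [alpha_mat_val, Matrix.det_fin_two_of]
  ring

theorem MetaGL.det_inv (g : MetaGL) : g⁻¹.det = g.det⁻¹ := by
  refine eq_inv_of_mul_eq_one_left ?_
  rw [← MetaGL.det_mul, inv_mul_cancel]
  simp [MetaGL.det]

/-- A quotient of elements of the double cosets for `m` which is also one for `n` is integral if `m`
and `n` are coprime. -/
theorem mem_Mp2Z_of_coprime (h : Nat.Coprime m n) {δ₁ δ₂ ε₁ ε₂ : MetaGL} (h1 : δ₁ ∈ doubleCoset m)
    (h2 : δ₂ ∈ doubleCoset m) (h3 : ε₁ ∈ doubleCoset n) (h4 : ε₂ ∈ doubleCoset n)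
    (he : δ₁ * δ₂⁻¹ = ε₁⁻¹ * ε₂) : δ₁ * δ₂⁻¹ ∈ Mp2Z := by
  obtain ⟨u, v, huv⟩ : IsCoprime ((m : ℤ) ^ 2) ((n : ℤ) ^ 2) :=
    (Nat.isCoprime_iff_coprime.mpr h).pow
  obtain ⟨N₁, hN₁⟩ := exists_int_entries h1
  obtain ⟨N₂, hN₂⟩ := exists_int_entries_inv h2
  obtain ⟨N₃, hN₃⟩ := exists_int_entries_inv h3
  obtain ⟨N₄, hN₄⟩ := exists_int_entries h4
  have hm : (m : ℝ) ^ 2 • (δ₁ * δ₂⁻¹).mat.1 = (N₁ * N₂).map (Int.cast) := by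
    rw [MetaGL.mul_mat, Units.val_mul, ← Matrix.mul_smul, hN₁, hN₂]
    exact (Matrix.map_mul (f := Int.castRingHom ℝ)).symm
  have hn : (n : ℝ) ^ 2 • (δ₁ * δ₂⁻¹).mat.1 = (N₃ * N₄).map (Int.cast) := by
    rw [he, MetaGL.mul_mat, Units.val_mul, ← Matrix.smul_mul, hN₃, hN₄]
    exact (Matrix.map_mul (f := Int.castRingHom ℝ)).symm
  have hdet : (δ₁ * δ₂⁻¹).det = 1 := by
    rw [MetaGL.det_mul, MetaGL.det_inv, det_of_mem_doubleCoset h1, det_of_mem_doubleCoset h2]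
    exact mul_inv_cancel₀ (by positivity)
  refine mem_Mp2Z_of_int_entries hdet (N := u • (N₁ * N₂) + v • (N₃ * N₄)) ?_
  have huv' : (u : ℝ) * (m : ℝ) ^ 2 + v * (n : ℝ) ^ 2 = 1 := by exact_mod_cast huv
  ext i j
  have hm' := congrFun (congrFun hm i) j
  have hn' := congrFun (congrFun hn i) j
  simp only [Matrix.smul_apply, smul_eq_mul, Matrix.map_apply, Matrix.add_apply] at hm' hn' ⊢
  push_cast
  rw [← hm', ← hn']
  linear_combination (-(δ₁ * δ₂⁻¹).mat.1 i j) * huv'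

theorem heckeConst_mul (κ : ℤ) (m n : ℕ+) :
    heckeConst κ m * heckeConst κ n = heckeConst κ (m * n) := by
  rw [heckeConst, heckeConst, heckeConst, PNat.mul_coe, Nat.cast_mul,
    Real.mul_rpow (Nat.cast_nonneg _) (Nat.cast_nonneg _), Complex.ofReal_mul]

/-- The products of representatives for `n` and for `m` represent the left cosets for `mn`. -/
theorem existsUnique_mul_out (h : Nat.Coprime m n) : ∀ δ ∈ doubleCoset (m * n),
    ∃! p : Quotient (QuotientGroup.rightRel Mp2Z) × Quotient (QuotientGroup.rightRel Mp2Z),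
      p ∈ (leftCosets_finite m).toFinset ×ˢ (leftCosets_finite n).toFinset ∧
        ∃ g : Mp2Z, δ = g.1 * (p.2.out * p.1.out) := by
  have hin {k : ℕ+} {c : Quotient (QuotientGroup.rightRel Mp2Z)}
      (hc : c ∈ (leftCosets_finite k).toFinset) : c.out ∈ doubleCoset k :=
    out_mem ((Set.Finite.mem_toFinset _).mp hc)
  rintro _ ⟨γ, γ', rfl⟩
  have hmem1 : alpha m * γ'.1 ∈ doubleCoset m := doubleCoset_mul_mem (alpha_mem_doubleCoset m) _
  obtain ⟨g, hg⟩ := exists_out_eq (alpha m * γ'.1)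
  have hmem2 : γ.1 * alpha n * g⁻¹.1 ∈ doubleCoset n :=
    doubleCoset_mul_mem (mul_mem_doubleCoset (alpha_mem_doubleCoset n) _) _
  obtain ⟨g2, hg2⟩ := exists_out_eq (γ.1 * alpha n * g⁻¹.1)
  refine ⟨(leftClass (alpha m * γ'.1), leftClass (γ.1 * alpha n * g⁻¹.1)), ⟨?_, g2⁻¹, ?_⟩, ?_⟩
  · rw [Finset.mem_product]
    exact ⟨(Set.Finite.mem_toFinset _).mpr (leftClass_mem hmem1),
      (Set.Finite.mem_toFinset _).mpr (leftClass_mem hmem2)⟩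
  · rw [hg, hg2, ← alpha_mul_alpha]
    simp [mul_assoc]
  · rintro ⟨c, d⟩ ⟨hcd, g3, hg3⟩
    rw [Finset.mem_product] at hcd
    have key : (γ.1 * alpha n * g⁻¹.1) * (g.1 * (alpha m * γ'.1)) = g3.1 * (d.out * c.out) := by
      rw [← hg3, ← alpha_mul_alpha]
      simp [mul_assoc]
    have hq : (g.1 * (alpha m * γ'.1)) * c.out⁻¹ =
        (γ.1 * alpha n * g⁻¹.1)⁻¹ * (g3.1 * d.out) := by
      rw [mul_inv_eq_iff_eq_mul, mul_assoc, eq_inv_mul_iff_mul_eq, key, mul_assoc]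
    -- two factorizations differ by an element of the integral group
    have hq2 := mem_Mp2Z_of_coprime h (mul_mem_doubleCoset hmem1 g) (hin hcd.1) hmem2
      (mul_mem_doubleCoset (hin hcd.2) g3) hq
    have hc : leftClass (alpha m * γ'.1) = c := by
      rw [← Quotient.out_eq c]
      refine (leftClass_eq_iff.mpr ⟨g⁻¹ * ⟨_, hq2⟩, ?_⟩).symm
      simp [mul_assoc]
    rw [← hc, hg] at key
    have hd : leftClass (γ.1 * alpha n * g⁻¹.1) = d := by
      rw [← Quotient.out_eq d]
      refine (leftClass_eq_iff.mpr ⟨g3, ?_⟩).symm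
      rw [← mul_assoc g3.1] at key
      exact mul_right_cancel key
    rw [hc, hd]

variable {D} {κ : ℤ} {f : ℍ → A → ℂ}

theorem hecke_hecke (h : Nat.Coprime m n) (hf : f ∈ modularForms D κ) :
    hecke D κ m (hecke D κ n f) = hecke D κ (m * n) f := by
  have hin {k : ℕ+} {c : Quotient (QuotientGroup.rightRel Mp2Z)}
      (hc : c ∈ (leftCosets_finite k).toFinset) : c.out ∈ doubleCoset k :=
    out_mem ((Set.Finite.mem_toFinset _).mp hc)
  have hsum := finsum_leftCosets (heckeTerm D κ (m * n) f) (heckeTerm_mul_left hf)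
    ((leftCosets_finite m).toFinset ×ˢ (leftCosets_finite n).toFinset)
    (fun p => p.2.out * p.1.out) (fun p hp => by
      rw [Finset.mem_product] at hp
      exact (mul_mem_doubleCoset_mul D h (hin hp.2) (hin hp.1)).1) (existsUnique_mul_out h)
  rw [hecke_eq_sum D κ (m * n), ← finsum_leftCosets_out, hsum, Finset.sum_product,
    hecke_eq_sum D κ m, hecke_eq_sum D κ n, ← heckeConst_mul, mul_smul]
  simp only [Finset.smul_sum]
  refine Finset.sum_congr rfl fun c hc => ?_
  rw [heckeTerm, slash_sum, Finset.smul_sum]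
  refine Finset.sum_congr rfl fun d hd => ?_
  rw [slash_smul, heckeTerm, slash_slash,
    ← (mul_mem_doubleCoset_mul D h (hin hd) (hin hc)).2, heckeTerm]

end Mult

/-! ### The fundamental domain of the integral metaplectic group -/

section Fundamental

instance : Countable Mp2Z := by
  choose lift hlift using Mp2Z.exists_sl_eq
  have h : Function.Surjective (fun p : SL(2, ℤ) × Bool =>
      lift p.1 * if p.2 then Mp2Z.mpZ ^ 2 else 1) := by
    intro g
    have hg : Mp2Z.sl ((lift (Mp2Z.sl g))⁻¹ * g) = 1 := by
      rw [map_mul, map_inv, hlift, inv_mul_cancel]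
    rcases Mp2Z.eq_one_or_of_sl_eq_one hg with h1 | h1
    · exact ⟨(Mp2Z.sl g, false), by simpa using inv_mul_eq_one.mp h1⟩
    · exact ⟨(Mp2Z.sl g, true), by
        change lift (Mp2Z.sl g) * Mp2Z.mpZ ^ 2 = g
        rw [← h1, mul_inv_cancel_left]⟩
  have : Countable (Matrix (Fin 2) (Fin 2) ℤ) := inferInstanceAs (Countable (Fin 2 → Fin 2 → ℤ))
  have : Countable SL(2, ℤ) := Subtype.countable
  exact h.countable

theorem measurableSet_fd : MeasurableSet ModularGroup.fd := by
  have h : ModularGroup.fd = UpperHalfPlane.coe ⁻¹' (UpperHalfPlane.coe '' ModularGroup.fd) :=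
    (Set.preimage_image_eq _ UpperHalfPlane.coe_injective).symm
  rw [h]
  exact measurable_coe ModularGroup.isClosed_coe_fd.measurableSet

/-- The boundary of the fundamental domain is a null set. -/
theorem volume_fd_sdiff_fdo : volume (ModularGroup.fd \ ModularGroup.fdo) = 0 := by
  rw [volume_eq_lintegral]
  refine setLIntegral_measure_zero _ _ ?_
  have hsub : UpperHalfPlane.coe '' (ModularGroup.fd \ ModularGroup.fdo) ⊆
      Metric.sphere 0 1 ∪
        (frontier {z : ℂ | z.re ≤ 1 / 2} ∪ frontier {z : ℂ | z.re ≤ -(1 / 2)}) := by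
    rintro _ ⟨τ, ⟨h1, h2⟩, rfl⟩
    rw [Complex.frontier_setOfPred_re_le, Complex.frontier_setOfPred_re_le]
    have h3 : 1 ≤ ‖(τ : ℂ)‖ := Complex.one_le_normSq_iff.mp h1.1
    by_cases h4 : ‖(τ : ℂ)‖ = 1
    · left; simpa using h4
    · right
      have h5 : 1 < Complex.normSq τ :=
        Complex.one_lt_normSq_iff.mpr (lt_of_le_of_ne h3 (Ne.symm h4))
      have h6 : ¬|τ.re| < 1 / 2 := fun h => h2 ⟨h5, h⟩
      have h7 : |τ.re| = 1 / 2 := le_antisymm h1.2 (not_lt.mp h6)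
      rcases (abs_eq (by norm_num)).mp h7 with h | h
      · exact Or.inl h
      · exact Or.inr h
  have hconv (c : ℝ) : Convex ℝ {z : ℂ | z.re ≤ c} := convex_halfSpace_re_le c
  refine measure_mono_null hsub (measure_union_null (Measure.addHaar_sphere _ _ _)
    (measure_union_null ((hconv _).addHaar_frontier _) ((hconv _).addHaar_frontier _)))

/-- The translates in the fundamental domain of almost every point lie in its interior. -/
theorem ae_interior (δ : MetaGL) : ∀ᵐ τ : ℍ, ∀ g : Mp2Z,
    g.1.act (δ.act τ) ∈ ModularGroup.fd → g.1.act (δ.act τ) ∈ ModularGroup.fdo := by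
  rw [ae_all_iff]
  intro g
  rw [ae_iff]
  have h : {τ : ℍ | ¬(g.1.act (δ.act τ) ∈ ModularGroup.fd → g.1.act (δ.act τ) ∈ ModularGroup.fdo)} =
      (fun τ : ℍ => (g.1 * δ).mat • τ) ⁻¹' (ModularGroup.fd \ ModularGroup.fdo) := by
    ext τ
    rw [Set.mem_preimage]
    change ¬(_ → _) ↔ (g.1 * δ).act τ ∈ _
    rw [MetaGL.mul_act, Classical.not_imp]
    rfl
  rw [h, measure_preimage_smul, volume_fd_sdiff_fdo]

/-- A point without translates on the boundary of the fundamental domain has exactly one translate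
under `SL₂(ℤ)/±1` in it, and hence four metaplectic ones. -/
theorem hasSum_translates {E : Type*} [AddCommMonoid E] [TopologicalSpace E] {τ : ℍ}
    (h : ∀ g : Mp2Z, g.1.act τ ∈ ModularGroup.fd → g.1.act τ ∈ ModularGroup.fdo) (x : E) :
    HasSum (fun g : Mp2Z => Set.indicator ModularGroup.fd (fun _ => x) (g.1.act τ)) (4 • x) := by
  classical
  obtain ⟨M, hM⟩ := ModularGroup.exists_smul_mem_fd τ
  obtain ⟨g₀, rfl⟩ := Mp2Z.exists_sl_eq M
  rw [← Mp2Z.act_eq] at hM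
  have hZ (g : Mp2Z) : g.1.act τ ∈ ModularGroup.fd ↔
      Mp2Z.sl (g * g₀⁻¹) = 1 ∨ Mp2Z.sl (g * g₀⁻¹) = -1 := by
    have e1 : g.1.act τ = Mp2Z.sl (g * g₀⁻¹) • g₀.1.act τ := by
      rw [← Mp2Z.act_eq, ← MetaGL.mul_act, ← Subgroup.coe_mul, inv_mul_cancel_right]
    constructor
    · intro hg
      rw [e1] at hg
      exact ModularGroup.eq_one_or_neg_one_of_mem_fdo_mem_fd (h _ hM) hg
    · rintro (h1 | h1)
      · rw [e1, h1, one_smul]; exact hM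
      · rw [e1, h1, ModularGroup.SL_neg_smul, one_smul]; exact hM
  have hone (u : Mp2Z) : Mp2Z.sl u = 1 ∨ Mp2Z.sl u = -1 ↔
      u = 1 ∨ u = Mp2Z.mpZ ∨ u = Mp2Z.mpZ ^ 2 ∨ u = Mp2Z.mpZ ^ 3 := by
    constructor
    · rintro (h1 | h1)
      · rcases Mp2Z.eq_one_or_of_sl_eq_one h1 with h2 | h2 <;> simp [h2]
      · have h3 : Mp2Z.sl (u * Mp2Z.mpZ⁻¹) = 1 := by
          rw [map_mul, map_inv, h1, Mp2Z.sl_mpZ, mul_inv_cancel]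
        rcases Mp2Z.eq_one_or_of_sl_eq_one h3 with h2 | h2 <;> rw [mul_inv_eq_iff_eq_mul] at h2
        · right; left; simpa using h2
        · right; right; right; rw [h2, ← pow_succ]
    · rintro (rfl | rfl | rfl | rfl)
      · left; simp
      · right; simp
      · left; rw [Mp2Z.sl_mpZ_sq]
      · right; rw [pow_succ, map_mul, Mp2Z.sl_mpZ_sq, Mp2Z.sl_mpZ, one_mul]
  have hsupp : ∀ g ∉ Finset.image (fun k : Fin 4 => Mp2Z.mpZ ^ (k : ℕ) * g₀) Finset.univ,
      Set.indicator ModularGroup.fd (fun _ => x) (g.1.act τ) = 0 := by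
    intro g hg
    refine Set.indicator_of_notMem (fun hmem => hg ?_) _
    rw [hZ, hone] at hmem
    rw [Finset.mem_image]
    rcases hmem with h1 | h1 | h1 | h1 <;> rw [mul_inv_eq_iff_eq_mul] at h1
    · exact ⟨0, Finset.mem_univ _, by simp [h1]⟩
    · exact ⟨1, Finset.mem_univ _, by simp [h1]⟩
    · exact ⟨2, Finset.mem_univ _, by simp [h1]⟩
    · exact ⟨3, Finset.mem_univ _, by simp [h1]⟩
  have hinj : Function.Injective (fun k : Fin 4 => Mp2Z.mpZ ^ (k : ℕ) * g₀) := by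
    intro a b hab
    have hab' : Mp2Z.mpZ ^ (a : ℕ) = Mp2Z.mpZ ^ (b : ℕ) := mul_right_cancel hab
    have hord : orderOf Mp2Z.mpZ = 4 := by
      have := orderOf_eq_prime_pow (p := 2) (n := 1) (x := Mp2Z.mpZ)
        (by simpa using Mp2Z.mpZ_sq_ne_one) (by simpa using Mp2Z.mpZ_pow_four)
      simpa using this
    exact Fin.ext (pow_injOn_Iio_orderOf (by rw [hord]; exact a.2) (by rw [hord]; exact b.2) hab')
  have hsum := hasSum_sum_of_ne_finset_zero (L := SummationFilter.unconditional _) hsupp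
  rw [Finset.sum_image (fun a _ b _ hab => hinj hab), Finset.sum_congr rfl (fun k _ =>
    Set.indicator_of_mem ((hZ _).mpr ((hone _).mpr (by
      fin_cases k <;> simp))) _)] at hsum
  simpa using hsum

/-- The fundamental domain has finite volume. -/
theorem volume_fd_lt_top : volume ModularGroup.fd < ⊤ := by
  rw [volume_eq_lintegral]
  have hsub : UpperHalfPlane.coe '' ModularGroup.fd ⊆ Complex.measurableEquivRealProd ⁻¹'
      (Set.Icc (-(1 / 2)) (1 / 2) ×ˢ Set.Ioi (1 / 2)) := by
    rintro _ ⟨τ, h, rfl⟩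
    refine ⟨abs_le.mp h.2, ?_⟩
    have h3 := ModularGroup.three_le_four_mul_im_sq_of_mem_fd h
    have h4 := τ.im_pos
    change 1 / 2 < τ.im
    nlinarith
  refine lt_of_le_of_lt (lintegral_mono_set hsub) ?_
  have hmp := Complex.volume_preserving_equiv_real_prod
  have e1 : ∫⁻ z in Complex.measurableEquivRealProd ⁻¹'
        (Set.Icc (-(1 / 2)) (1 / 2) ×ˢ Set.Ioi (1 / 2)), ((1 / ‖z.im‖₊) ^ 2 : NNReal) =
      ∫⁻ p in Set.Icc (-(1 / 2) : ℝ) (1 / 2) ×ˢ Set.Ioi (1 / 2 : ℝ), ((1 / ‖p.2‖₊) ^ 2 : NNReal) :=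
    hmp.setLIntegral_comp_preimage_emb Complex.measurableEquivRealProd.measurableEmbedding
      (fun p => (((1 / ‖p.2‖₊) ^ 2 : NNReal) : ENNReal)) _
  rw [e1, Measure.volume_eq_prod, ← Measure.prod_restrict]
  have hmeas : AEMeasurable (fun y : ℝ => (((1 / ‖y‖₊) ^ 2 : NNReal) : ENNReal))
      (volume.restrict (Set.Ioi (1 / 2))) := by fun_prop
  have e2 := lintegral_prod_mul (μ := volume.restrict (Set.Icc (-(1 / 2) : ℝ) (1 / 2)))
    (ν := volume.restrict (Set.Ioi (1 / 2 : ℝ))) (f := fun _ => 1)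
    (g := fun y : ℝ => (((1 / ‖y‖₊) ^ 2 : NNReal) : ENNReal)) aemeasurable_const hmeas
  simp only [one_mul] at e2
  rw [e2]
  refine ENNReal.mul_lt_top (by simp) ?_
  have hint := integrableOn_Ioi_rpow_of_lt (a := -2) (by norm_num) (c := 1 / 2) (by norm_num)
  have h5 := hint.2
  refine lt_of_le_of_lt (le_of_eq ?_) h5
  refine setLIntegral_congr_fun measurableSet_Ioi fun y hy => ?_
  have hy0 : (0 : ℝ) < y := lt_trans (by norm_num) hy
  change _ = ((‖y ^ (-2 : ℝ)‖₊ : NNReal) : ENNReal)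
  congr 1
  ext
  push_cast
  rw [Real.norm_of_nonneg (Real.rpow_nonneg hy0.le _), Real.norm_of_nonneg hy0.le,
    Real.rpow_neg hy0.le, one_div, inv_pow]
  norm_cast

end Fundamental

/-! ### The adjoint of an element of the double coset -/

/-- The central element `((m², 0; 0, m²), m)`. -/
def scalarElt (m : ℕ+) : MetaGL where
  mat := Matrix.GeneralLinearGroup.mkOfDetNeZero !![(m : ℝ) ^ 2, 0; 0, (m : ℝ) ^ 2] (by simp)
  det_pos := by
    have : (0 : ℝ) < (m : ℕ) := by positivity
    simp [Matrix.GeneralLinearGroup.mkOfDetNeZero]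
  phi := fun _ => m
  holo := mdifferentiable_const
  sq := fun τ => by simp [denom, Matrix.GeneralLinearGroup.mkOfDetNeZero]

section Star
variable {m : ℕ+}

theorem scalarElt_mat (m : ℕ+) : (scalarElt m).mat.1 = !![(m : ℝ) ^ 2, 0; 0, (m : ℝ) ^ 2] := rfl

theorem scalarElt_phi (m : ℕ+) (τ : ℍ) : (scalarElt m).phi τ = m := rfl

theorem scalarElt_act (m : ℕ+) (τ : ℍ) : (scalarElt m).act τ = τ := by
  have hm : ((m : ℕ) : ℂ) ≠ 0 := by exact_mod_cast m.pos.ne'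
  ext
  rw [MetaGL.act, coe_smul_of_det_pos (scalarElt m).det_pos, num, denom, scalarElt_mat]
  simp [hm]

theorem scalarElt_det (m : ℕ+) : (scalarElt m).det = (m : ℝ) ^ 4 := by
  change (scalarElt m).mat.1.det = _
  rw [scalarElt_mat, Matrix.det_fin_two_of]
  ring

theorem scalarElt_comm (m : ℕ+) (g : MetaGL) : scalarElt m * g = g * scalarElt m := by
  ext1
  · apply Units.ext
    rw [MetaGL.mul_mat, MetaGL.mul_mat, Units.val_mul, Units.val_mul, scalarElt_mat]
    ext i j
    fin_cases i <;> fin_cases j <;> simp [Matrix.mul_apply, Fin.sum_univ_two, mul_comm]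
  · funext τ
    rw [MetaGL.mul_phi_act, MetaGL.mul_phi_act, scalarElt_phi, scalarElt_phi, scalarElt_act,
      mul_comm]

theorem autFactor_scalarElt (κ : ℤ) (m : ℕ+) (τ : ℍ) : autFactor κ (scalarElt m) τ = 1 := by
  have hm : (0 : ℝ) < (m : ℕ) := by positivity
  have h1 : ((m : ℝ) ^ 4) ^ ((κ : ℝ) / 4) = (m : ℝ) ^ κ := by
    rw [← Real.rpow_natCast, ← Real.rpow_mul hm.le, ← Real.rpow_intCast]
    congr 1
    push_cast
    ring
  rw [autFactor, scalarElt_det, scalarElt_phi, h1]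
  push_cast
  rw [← zpow_add₀ (by exact_mod_cast m.pos.ne'), add_neg_cancel, zpow_zero]

/-- `((m², 0; 0, m²), m) = S α S⁻¹ α`. -/
theorem scalarElt_eq (m : ℕ+) : scalarElt m = mpS.1 * alpha m * mpS⁻¹.1 * alpha m := by
  refine MetaGL.ext_of_phi_eq ?_ UpperHalfPlane.I ?_
  · have h : mpS.1.mat * (alpha m).mat * mpS.1.mat⁻¹ =
        Matrix.GeneralLinearGroup.mkOfDetNeZero !![1, 0; 0, (m : ℝ) ^ 2] (by simp) := by
      rw [mul_inv_eq_iff_eq_mul]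
      apply Units.ext
      change ((Matrix.SpecialLinearGroup.mapGL ℝ ModularGroup.S).1 * _ : Matrix (Fin 2) (Fin 2) ℝ) =
        _ * (Matrix.SpecialLinearGroup.mapGL ℝ ModularGroup.S).1
      rw [Matrix.SpecialLinearGroup.mapGL_coe_matrix]
      ext i j
      fin_cases i <;> fin_cases j <;>
        simp [Matrix.mul_apply, Fin.sum_univ_two, ModularGroup.coe_S, alpha,
          Matrix.GeneralLinearGroup.mkOfDetNeZero]
    rw [Subgroup.coe_inv, MetaGL.mul_mat, MetaGL.mul_mat, MetaGL.mul_mat, MetaGL.inv_mat, h]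
    apply Units.ext
    ext i j
    fin_cases i <;> fin_cases j <;>
      simp [Matrix.mul_apply, Fin.sum_univ_two, alpha, scalarElt,
        Matrix.GeneralLinearGroup.mkOfDetNeZero]
  · set τ := UpperHalfPlane.I
    rw [MetaGL.mul_phi_act, MetaGL.mul_phi_act, MetaGL.mul_phi_act, alpha_phi, alpha_phi,
      scalarElt_phi, mul_one, mul_one]
    set w := mpS⁻¹.1.act ((alpha m).act τ) with hw
    have h1 : mpS⁻¹.1.phi ((alpha m).act τ) * csqrt w = 1 := by
      have h2 : (mpS * mpS⁻¹).1.phi ((alpha m).act τ) = 1 := by rw [mul_inv_cancel]; rfl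
      rw [Subgroup.coe_mul, MetaGL.mul_phi_act, ← hw, Mp2Z.mpS_phi] at h2
      rw [mul_comm]; exact h2
    rw [Mp2Z.mpS_phi, coe_alpha_act, csqrt_sq_mul m w.im_pos, mul_assoc, mul_comm (csqrt _), h1,
      mul_one]

/-- The adjoint `δ* = ((m², 0; 0, m²), m) δ⁻¹` of an element of the double coset. -/
def star (m : ℕ+) (δ : MetaGL) : MetaGL := scalarElt m * δ⁻¹

theorem star_mul_self (δ : MetaGL) : star m δ * δ = scalarElt m := inv_mul_cancel_right _ _

theorem star_star (δ : MetaGL) : star m (star m δ) = δ := by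
  rw [star, star, mul_inv_rev, inv_inv, ← mul_assoc, scalarElt_comm, mul_inv_cancel_right]

theorem star_act_act (δ : MetaGL) (τ : ℍ) : (star m δ).act (δ.act τ) = τ := by
  rw [← MetaGL.mul_act, star_mul_self, scalarElt_act]

theorem star_eq (γ γ' : Mp2Z) : star m (γ.1 * alpha m * γ'.1) =
    (γ'⁻¹ * mpS).1 * alpha m * (mpS⁻¹ * γ⁻¹).1 := by
  have h : scalarElt m * (alpha m)⁻¹ = mpS.1 * alpha m * mpS⁻¹.1 := by
    rw [scalarElt_eq, mul_inv_cancel_right]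
  rw [star, mul_inv_rev, mul_inv_rev, ← mul_assoc, scalarElt_comm, mul_assoc,
    ← mul_assoc _ (alpha m)⁻¹, h, Subgroup.coe_mul, Subgroup.coe_mul]
  simp only [Subgroup.coe_inv, mul_assoc]

theorem star_mem {δ : MetaGL} (h : δ ∈ doubleCoset m) : star m δ ∈ doubleCoset m := by
  obtain ⟨γ, γ', rfl⟩ := h
  exact ⟨_, _, star_eq γ γ'⟩

/-- The involution `δ ↦ δ*` of the double coset. -/
def starEquiv (m : ℕ+) : doubleCoset m ≃ doubleCoset m where
  toFun δ := ⟨star m δ, star_mem δ.2⟩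
  invFun δ := ⟨star m δ, star_mem δ.2⟩
  left_inv _ := Subtype.ext (star_star _)
  right_inv _ := Subtype.ext (star_star _)

section ScalarProd
variable {A : Type*} [Fintype A]

theorem scalarProd_smul_left (c : ℂ) (v w : A → ℂ) :
    scalarProd (c • v) w = c * scalarProd v w := by
  simp [scalarProd, Finset.mul_sum, mul_assoc]

theorem scalarProd_smul_right (c : ℂ) (v w : A → ℂ) :
    scalarProd v (c • w) = conj c * scalarProd v w := by
  simp [scalarProd, Finset.mul_sum, mul_left_comm]

theorem scalarProd_sum_left {ι : Type*} (s : Finset ι) (v : ι → A → ℂ) (w : A → ℂ) :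
    scalarProd (∑ i ∈ s, v i) w = ∑ i ∈ s, scalarProd (v i) w := by
  simp only [scalarProd, Finset.sum_apply, Finset.sum_mul]
  exact Finset.sum_comm

theorem scalarProd_sum_right {ι : Type*} (s : Finset ι) (v : A → ℂ) (w : ι → A → ℂ) :
    scalarProd v (∑ i ∈ s, w i) = ∑ i ∈ s, scalarProd v (w i) := by
  simp only [scalarProd, Finset.sum_apply, map_sum, Finset.mul_sum]
  exact Finset.sum_comm

end ScalarProd

variable {A : Type*} [AddCommGroup A] [Fintype A] (D : DiscriminantForm A)

theorem scalarProd_weilRep_left (g : Mp2Z) (v w : A → ℂ) :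
    scalarProd (weilRep D g v) w = scalarProd v (weilRep D g⁻¹ w) := by
  rw [← D.scalarProd_weilRep g v, DiscriminantForm.weilRep_apply_inv]

/-- The adjoint of `𝔢_λ ↦ 𝔢_{mλ}` is its conjugate by `ρ(S)`. -/
theorem scalarProd_alphaAct (v w : A → ℂ) : scalarProd (alphaAct m v) w =
    scalarProd v (weilRep D mpS (alphaAct m (weilRep D mpS⁻¹ w))) := by
  classical
  have h1 (u : A → ℂ) (x : A) : weilRep D mpS (alphaAct m u) x =
      weilRep D mpS u ((m : ℕ) • x) := by
    rw [D.weilRep_mpS, D.sOp_apply_eq_fourier, D.sOp_apply_eq_fourier, D.fourier_alphaAct, smul_neg]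
  simp only [scalarProd, h1, DiscriminantForm.weilRep_apply_inv, alphaAct_apply, Finset.sum_mul]
  rw [Finset.sum_comm]
  refine Finset.sum_congr rfl fun l _ => ?_
  simp [ite_mul]

theorem scalarProd_cosetAct {δ : MetaGL} (h : δ ∈ doubleCoset m) (v w : A → ℂ) :
    scalarProd (cosetAct D m δ v) w = scalarProd v (cosetAct D m (star m δ) w) := by
  obtain ⟨γ, γ', rfl⟩ := h
  rw [star_eq, cosetAct_eq, cosetAct_eq]
  simp only [tripleAct, LinearMap.comp_apply]
  rw [scalarProd_weilRep_left, scalarProd_alphaAct D, scalarProd_weilRep_left]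
  simp only [mul_inv_rev, inv_inv, map_mul, Module.End.mul_apply]

theorem im_act (δ : MetaGL) (τ : ℍ) : (δ.act τ).im = δ.det * τ.im / ‖δ.phi τ‖ ^ 4 := by
  rw [MetaGL.act, im_smul_eq_div_normSq, ← δ.sq, Complex.normSq_eq_norm_sq, norm_pow,
    abs_of_pos δ.det_pos, ← pow_mul]
  rfl

/-- The scalar factor is compatible with the factor `y^k` of the Petersson product. -/
theorem normSq_autFactor_mul (κ : ℤ) (δ : MetaGL) (τ : ℍ) :
    Complex.normSq (autFactor κ δ τ) * τ.im ^ ((κ : ℝ) / 2) = (δ.act τ).im ^ ((κ : ℝ) / 2) := by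
  have hd : 0 < δ.det := δ.det_pos
  have hφ : 0 < ‖δ.phi τ‖ := norm_pos_iff.mpr (δ.phi_ne_zero τ)
  have h1 : (‖δ.phi τ‖ ^ 4) ^ ((κ : ℝ) / 2) = (‖δ.phi τ‖ ^ κ) ^ 2 := by
    rw [← Real.rpow_natCast, ← Real.rpow_mul hφ.le, ← Real.rpow_intCast, ← Real.rpow_natCast,
      ← Real.rpow_mul hφ.le]
    congr 1
    push_cast
    ring
  have h2 : δ.det ^ ((κ : ℝ) / 2) = (δ.det ^ ((κ : ℝ) / 4)) ^ 2 := by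
    rw [← Real.rpow_natCast, ← Real.rpow_mul hd.le]
    congr 1
    push_cast
    ring
  rw [im_act, Real.div_rpow (mul_pos hd τ.im_pos).le (by positivity),
    Real.mul_rpow hd.le τ.im_pos.le, h1, h2, Complex.normSq_eq_norm_sq, autFactor, norm_mul,
    Complex.norm_real, norm_zpow, Real.norm_of_nonneg (Real.rpow_nonneg hd.le _), mul_pow, zpow_neg,
    inv_pow]
  field_simp

/-- The terms of the Hecke operator for `δ` and `δ*` are adjoint to each other, pointwise. -/
theorem peterssonIntegrand_heckeTerm {κ : ℤ} (f g : ℍ → A → ℂ) {δ : MetaGL}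
    (h : δ ∈ doubleCoset m) (τ : ℍ) : peterssonIntegrand κ (heckeTerm D κ m f δ) g τ =
      peterssonIntegrand κ f (heckeTerm D κ m g (star m δ)) (δ.act τ) := by
  have ha : autFactor κ (star m δ) (δ.act τ) * autFactor κ δ τ = 1 := by
    rw [← autFactor_mul, star_mul_self, autFactor_scalarElt]
  have hn : autFactor κ δ τ * ((τ.im ^ ((κ : ℝ) / 2) : ℝ) : ℂ) =
      conj (autFactor κ (star m δ) (δ.act τ)) * (((δ.act τ).im ^ ((κ : ℝ) / 2) : ℝ) : ℂ) := by
    rw [← normSq_autFactor_mul κ δ τ, Complex.ofReal_mul, Complex.normSq_eq_conj_mul_self,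
      ← mul_assoc, ← mul_assoc, ← map_mul, ha, map_one, one_mul]
  rw [peterssonIntegrand, peterssonIntegrand, heckeTerm, heckeTerm, slash_apply, slash_apply,
    star_act_act, scalarProd_smul_left, scalarProd_smul_right, scalarProd_cosetAct D h]
  linear_combination (scalarProd (f (δ.act τ)) (cosetAct D m (star m δ) (g τ))) * hn

end Star

/-! ### Convergence of the Petersson scalar product -/

section Convergence
variable {A : Type*} [Fintype A]

/-- Uniform exponential decay of the components of a vector-valued function at the cusp `∞`. -/
def IsExpSmall (f : ℍ → A → ℂ) : Prop :=
  ∃ c : ℝ, 0 < c ∧ ∀ l, (fun τ => f τ l) =O[atImInfty] fun τ => Real.exp (-c * τ.im)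

theorem isBoundedAtImInfty_mul_rpow {u v : ℍ → ℂ} {c : ℝ} (hc : 0 < c) (s : ℝ)
    (hu : u =O[atImInfty] fun τ => Real.exp (-c * τ.im)) (hv : IsBoundedAtImInfty v) :
    IsBoundedAtImInfty (fun τ => u τ * v τ * ((τ.im ^ s : ℝ) : ℂ)) := by
  have h1 : (fun τ : ℍ => ((τ.im ^ s : ℝ) : ℂ)) =O[atImInfty] fun τ => Real.exp (c * τ.im) := by
    have h2 := (isLittleO_rpow_exp_pos_mul_atTop s hc).isBigO.comp_tendsto
      (Filter.tendsto_comap : Filter.Tendsto UpperHalfPlane.im atImInfty Filter.atTop)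
    refine Asymptotics.IsBigO.trans (Asymptotics.isBigO_of_le _ fun τ => ?_) h2
    rw [Complex.norm_real]; rfl
  refine ((hu.mul hv).mul h1).trans (Asymptotics.isBigO_of_le _ fun τ => ?_)
  simp only [Pi.one_apply, mul_one]
  rw [← Real.exp_add]
  simp

theorem peterssonIntegrand_eq_sum (κ : ℤ) (u v : ℍ → A → ℂ) (τ : ℍ) :
    peterssonIntegrand κ u v τ =
      ∑ l, u τ l * conj (v τ l) * ((τ.im ^ ((κ : ℝ) / 2) : ℝ) : ℂ) := by
  rw [peterssonIntegrand, scalarProd, Finset.sum_mul]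

theorem isBoundedAtImInfty_conj {v : ℍ → ℂ} (hv : IsBoundedAtImInfty v) :
    IsBoundedAtImInfty (fun τ => conj (v τ)) :=
  Asymptotics.IsBigO.trans (Asymptotics.isBigO_of_le _ fun τ => by simp) hv

theorem isBoundedAtImInfty_peterssonIntegrand (κ : ℤ) {u v : ℍ → A → ℂ}
    (hu : ∀ l, IsBoundedAtImInfty (fun τ => u τ l)) (hv : ∀ l, IsBoundedAtImInfty (fun τ => v τ l))
    (h : IsExpSmall u ∨ IsExpSmall v) : IsBoundedAtImInfty (peterssonIntegrand κ u v) := by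
  rw [show peterssonIntegrand κ u v = _ from funext (peterssonIntegrand_eq_sum κ u v)]
  refine isBoundedAtImInfty_fun_sum _ _ fun l _ => ?_
  rcases h with ⟨c, hc, h⟩ | ⟨c, hc, h⟩
  · exact isBoundedAtImInfty_mul_rpow hc _ (h l) (isBoundedAtImInfty_conj (hv l))
  · have h1 : (fun τ => conj (v τ l)) =O[atImInfty] fun τ => Real.exp (-c * τ.im) :=
      Asymptotics.IsBigO.trans (Asymptotics.isBigO_of_le _ fun τ => by simp) (h l)
    have := isBoundedAtImInfty_mul_rpow hc ((κ : ℝ) / 2) h1 (hu l)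
    simpa only [mul_comm (conj _)] using this

theorem continuous_peterssonIntegrand (κ : ℤ) {u v : ℍ → A → ℂ}
    (hu : ∀ l, Continuous (fun τ => u τ l)) (hv : ∀ l, Continuous (fun τ => v τ l)) :
    Continuous (peterssonIntegrand κ u v) := by
  rw [show peterssonIntegrand κ u v = _ from funext (peterssonIntegrand_eq_sum κ u v)]
  refine continuous_finsetSum _ fun l _ => ((hu l).mul (Complex.continuous_conj.comp (hv l))).mul ?_
  exact Complex.continuous_ofReal.comp
    (UpperHalfPlane.continuous_im.rpow_const fun τ => Or.inl τ.im_ne_zero)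

/-- The integrand is bounded on the fundamental domain, which has finite volume. -/
theorem peterssonConverges_of_isExpSmall (κ : ℤ) {u v : ℍ → A → ℂ}
    (hu : ∀ l, Continuous (fun τ => u τ l)) (hv : ∀ l, Continuous (fun τ => v τ l))
    (hu' : ∀ l, IsBoundedAtImInfty (fun τ => u τ l))
    (hv' : ∀ l, IsBoundedAtImInfty (fun τ => v τ l))
    (h : IsExpSmall u ∨ IsExpSmall v) : PeterssonConverges κ u v := by
  have hcont := continuous_peterssonIntegrand κ hu hv
  obtain ⟨M, B, hM⟩ :=
    isBoundedAtImInfty_iff.mp (isBoundedAtImInfty_peterssonIntegrand κ hu' hv' h)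
  obtain ⟨C, hC⟩ :=
    (ModularGroup.isCompact_truncatedFundamentalDomain B).exists_bound_of_continuousOn
    hcont.continuousOn
  refine Measure.integrableOn_of_bounded (M := max M C) volume_fd_lt_top.ne
    hcont.aestronglyMeasurable ?_
  refine (ae_restrict_iff' measurableSet_fd).mpr (Filter.Eventually.of_forall fun τ hτ => ?_)
  by_cases hB : B ≤ τ.im
  · exact (hM τ hB).trans (le_max_left _ _)
  · exact (hC τ ⟨hτ, (not_le.mp hB).le⟩).trans (le_max_right _ _)

end Convergence

section Decay
variable {A : Type*} [AddCommGroup A] [Fintype A] {D : DiscriminantForm A} {κ : ℤ}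
  {f : ℍ → A → ℂ} {m : ℕ+} {δ : MetaGL}

/-- The components of modular forms have period `|A|²`. -/
theorem periodic_component (hf : f ∈ modularForms D κ) (l : A) :
    Function.Periodic ((fun τ => f τ l) ∘ ofComplex) ((((Fintype.card A : ℝ) ^ 2 : ℝ)) : ℂ) := by
  intro w
  by_cases hw : 0 < w.im
  · have h1 : 0 < (w + (((Fintype.card A : ℝ) ^ 2 : ℝ) : ℂ)).im := by
      rwa [Complex.add_im, Complex.ofReal_im, add_zero]
    rw [Function.comp_apply, Function.comp_apply, ofComplex_apply_of_im_pos h1,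
      ofComplex_apply_of_im_pos hw]
    have h2 := hf.2.1 (mpT ^ ((Fintype.card A : ℤ) ^ 2)) ⟨w, hw⟩
    rw [Mp2Z.mpT_zpow_phi, one_zpow, one_smul, D.weilRep_mpT_zpow] at h2
    have h3 : (mpT ^ ((Fintype.card A : ℤ) ^ 2)).1.act ⟨w, hw⟩ = ⟨_, h1⟩ := by
      ext
      rw [Mp2Z.coe_mpT_zpow_act]
      push_cast
      rfl
    rw [h3] at h2
    have h4 := congrFun h2 l
    rwa [DiscriminantForm.tOp_apply, D.card_sq_zsmul_q, e_zero, one_mul] at h4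
  · have h1 : (w + (((Fintype.card A : ℝ) ^ 2 : ℝ) : ℂ)).im ≤ 0 := by
      rw [Complex.add_im, Complex.ofReal_im, add_zero]
      exact not_lt.mp hw
    rw [Function.comp_apply, Function.comp_apply, ofComplex_apply_of_im_nonpos h1,
      ofComplex_apply_of_im_nonpos (not_lt.mp hw)]

theorem isExpSmall_of_mem_cuspForms (hf : f ∈ cuspForms D κ) : IsExpSmall f := by
  have hN : (0 : ℝ) < (Fintype.card A : ℝ) ^ 2 := by
    have : 0 < Fintype.card A := Fintype.card_pos
    positivity
  refine ⟨2 * Real.pi / (Fintype.card A : ℝ) ^ 2, by positivity, fun l => ?_⟩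
  have h := IsZeroAtImInfty.exp_decay_atImInfty (hf.2 l) hN (periodic_component hf.1 l)
    (hf.1.1 l) (hf.1.2.2 l)
  refine h.congr_right fun τ => ?_
  congr 1
  ring

theorem isExpSmall_slash (h : δ.mat.1 1 0 = 0) (L : Module.End ℂ (A → ℂ)) (hf : IsExpSmall f) :
    IsExpSmall (slash κ δ L f) := by
  obtain ⟨c, hc, hf⟩ := hf
  have hne := δ.det_pos
  have hd : (δ.mat.1 1 1 : ℂ) ≠ 0 := by
    rw [← denom_of_upper_triangular h UpperHalfPlane.I]
    exact denom_ne_zero _ _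
  set K := |δ.mat.det.val| / Complex.normSq (δ.mat.1 1 1 : ℂ) with hK
  have hK0 : 0 < K := div_pos (abs_pos.mpr hne.ne') (Complex.normSq_pos.mpr hd)
  have him (τ : ℍ) : (δ.act τ).im = K * τ.im := by
    rw [MetaGL.act, im_smul_eq_div_normSq, denom_of_upper_triangular h, hK]
    ring
  refine ⟨c * K, mul_pos hc hK0, fun l => ?_⟩
  simp only [slash_apply_apply]
  refine Asymptotics.IsBigO.fun_sum fun k _ => ?_
  have h1 := (hf k).comp_tendsto (tendsto_act_atImInfty h)
  have h2 := h1.mul (isBounded_const_factor (κ := κ) h (L (basisVec k) l))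
  refine h2.congr_right fun τ => ?_
  simp only [Function.comp_apply, him, Pi.one_apply, mul_one]
  ring_nf

theorem heckeTerm_isBoundedAtImInfty (hf : f ∈ modularForms D κ) (h : δ ∈ doubleCoset m) (l : A) :
    IsBoundedAtImInfty (fun τ => heckeTerm D κ m f δ τ l) := by
  obtain ⟨g, hg⟩ := exists_upper_triangular h
  rw [← heckeTerm_mul_left hf g δ h]
  exact slash_isBoundedAtImInfty hg _ hf.2.2 l

theorem heckeTerm_isExpSmall (hf : f ∈ cuspForms D κ) (h : δ ∈ doubleCoset m) :
    IsExpSmall (heckeTerm D κ m f δ) := by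
  obtain ⟨g, hg⟩ := exists_upper_triangular h
  rw [← heckeTerm_mul_left hf.1 g δ h]
  exact isExpSmall_slash hg _ (isExpSmall_of_mem_cuspForms hf)

theorem continuous_component (hf : f ∈ modularForms D κ) (l : A) : Continuous (fun τ => f τ l) :=
  (hf.1 l).continuous

theorem continuous_heckeTerm (hf : f ∈ modularForms D κ) (δ : MetaGL) (l : A) :
    Continuous (fun τ => heckeTerm D κ m f δ τ l) :=
  (slash_mdifferentiable (κ := κ) hf.1 δ (cosetAct D m δ) l).continuous

variable {g : ℍ → A → ℂ}

theorem peterssonConverges (hf : f ∈ modularForms D κ) (hg : g ∈ modularForms D κ)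
    (h : f ∈ cuspForms D κ ∨ g ∈ cuspForms D κ) : PeterssonConverges κ f g :=
  peterssonConverges_of_isExpSmall κ (continuous_component hf) (continuous_component hg) hf.2.2
    hg.2.2 (h.imp isExpSmall_of_mem_cuspForms isExpSmall_of_mem_cuspForms)

theorem peterssonConverges_heckeTerm_left (hf : f ∈ modularForms D κ) (hg : g ∈ modularForms D κ)
    (h : f ∈ cuspForms D κ ∨ g ∈ cuspForms D κ) (hδ : δ ∈ doubleCoset m) :
    PeterssonConverges κ (heckeTerm D κ m f δ) g :=
  peterssonConverges_of_isExpSmall κ (continuous_heckeTerm hf δ) (continuous_component hg)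
    (heckeTerm_isBoundedAtImInfty hf hδ) hg.2.2
    (h.imp (heckeTerm_isExpSmall · hδ) isExpSmall_of_mem_cuspForms)

theorem peterssonConverges_heckeTerm_right (hf : f ∈ modularForms D κ) (hg : g ∈ modularForms D κ)
    (h : f ∈ cuspForms D κ ∨ g ∈ cuspForms D κ) (hδ : δ ∈ doubleCoset m) :
    PeterssonConverges κ f (heckeTerm D κ m g δ) :=
  peterssonConverges_of_isExpSmall κ (continuous_component hf) (continuous_heckeTerm hg δ)
    hf.2.2 (heckeTerm_isBoundedAtImInfty hg hδ)
    (h.imp isExpSmall_of_mem_cuspForms (heckeTerm_isExpSmall · hδ))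

end Decay

/-! ### Unfolding and self-adjointness -/

section Unfolding

theorem measurableSet_preimage_fd (δ : MetaGL) : MeasurableSet (δ.act ⁻¹' ModularGroup.fd) :=
  (measurable_const_smul δ.mat) measurableSet_fd

/-- For almost every `τ`, the point `δτ` has exactly four metaplectic translates in the fundamental
domain. Hence the regions of the fundamental domain mapped into it by the elements of a left coset
cover it four times. -/
theorem hasSum_integral_coset (δ : MetaGL) {K : ℍ → ℂ} (hK : IntegrableOn K ModularGroup.fd) :
    HasSum (fun γ : Mp2Z => ∫ τ in ModularGroup.fd,
      (MetaGL.act (γ.1 * δ) ⁻¹' ModularGroup.fd).indicator K τ)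
      (4 • ∫ τ in ModularGroup.fd, K τ) := by
  have key {E : Type} [AddCommMonoid E] [TopologicalSpace E] (K : ℍ → E) :
      ∀ᵐ τ ∂(volume.restrict ModularGroup.fd), HasSum (fun γ : Mp2Z =>
        (MetaGL.act (γ.1 * δ) ⁻¹' ModularGroup.fd).indicator K τ) (4 • K τ) := by
    refine ae_restrict_of_ae ((ae_interior δ).mono fun τ h => ?_)
    refine (hasSum_translates h (K τ)).congr_fun fun γ => ?_
    rw [← MetaGL.mul_act]
    rfl
  have h4 : 4 • ∫ τ in ModularGroup.fd, K τ = ∫ τ in ModularGroup.fd, 4 • K τ := by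
    simp only [nsmul_eq_mul]
    rw [integral_const_mul]
  rw [h4]
  refine hasSum_integral_of_dominated_convergence
    (fun γ τ => (MetaGL.act (γ.1 * δ) ⁻¹' ModularGroup.fd).indicator (fun τ => ‖K τ‖) τ)
    (fun γ => hK.aestronglyMeasurable.indicator (measurableSet_preimage_fd _))
    (fun γ => Filter.Eventually.of_forall fun τ => (norm_indicator_eq_indicator_norm _ _).le)
    ((key fun τ => ‖K τ‖).mono fun τ h => h.summable) ?_ (key K)
  refine (hK.norm.const_mul 4).congr ((key fun τ => ‖K τ‖).mono fun τ h => ?_)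
  change 4 * ‖K τ‖ = ∑' γ : Mp2Z, _
  rw [h.tsum_eq, nsmul_eq_mul, Nat.cast_ofNat]

theorem hasSum_prod_of_fintype {ι β E : Type*} [Fintype ι] [AddCommMonoid E] [TopologicalSpace E]
    [ContinuousAdd E] {F : ι × β → E} {a : ι → E} (h : ∀ i, HasSum (fun b => F (i, b)) (a i)) :
    HasSum F (∑ i, a i) := by
  classical
  have h1 (i : ι) : HasSum (fun p : ι × β => if p.1 = i then F p else 0) (a i) := by
    rw [← (Prod.mk_right_injective i).hasSum_iff]
    · simpa [Function.comp_def] using h i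
    · rintro ⟨j, b⟩ hj
      exact if_neg fun hji => hj ⟨b, by rw [← hji]⟩
  refine (hasSum_sum fun i _ => h1 i).congr_fun fun p => ?_
  simp

/-- The double coset is the disjoint union of its left cosets. -/
def leftCosetsEquiv (m : ℕ+) : leftCosets m × Mp2Z ≃ doubleCoset m :=
  Equiv.ofBijective (fun p => ⟨p.2.1 * p.1.1.out, mul_mem_doubleCoset (out_mem p.1.2) p.2⟩) (by
    constructor
    · rintro ⟨⟨c, hc⟩, γ⟩ ⟨⟨c', hc'⟩, γ'⟩ h
      have h1 : γ.1 * c.out = γ'.1 * c'.out := congrArg Subtype.val h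
      have h2 : c = c' := by
        have := congrArg leftClass h1
        rwa [leftClass_mul, leftClass_mul, leftClass, leftClass, Quotient.out_eq,
          Quotient.out_eq] at this
      subst h2
      rw [Subtype.ext (mul_right_cancel h1)]
    · rintro ⟨δ, hδ⟩
      obtain ⟨g, hg⟩ := exists_out_eq δ
      refine ⟨⟨⟨leftClass δ, leftClass_mem hδ⟩, g⁻¹⟩, Subtype.ext ?_⟩
      change g⁻¹.1 * (leftClass δ).out = δ
      rw [hg, Subgroup.coe_inv, inv_mul_cancel_left])

/-- A sum over the double coset of integrals over the parts of the fundamental domain mapped into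
it unfolds to a sum over left cosets of integrals over the whole fundamental domain. -/
theorem hasSum_doubleCoset {m : ℕ+} {G : MetaGL → ℍ → ℂ}
    (hG : ∀ (g : Mp2Z), ∀ δ ∈ doubleCoset m, G (g.1 * δ) = G δ)
    (hint : ∀ δ ∈ doubleCoset m, IntegrableOn (G δ) ModularGroup.fd) :
    HasSum (fun δ : doubleCoset m => ∫ τ in ModularGroup.fd,
      (δ.1.act ⁻¹' ModularGroup.fd).indicator (G δ) τ)
      (4 • ∑ c ∈ (leftCosets_finite m).toFinset, ∫ τ in ModularGroup.fd, G c.out τ) := by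
  have : Fintype (leftCosets m) := (leftCosets_finite m).fintype
  rw [← (leftCosetsEquiv m).hasSum_iff]
  have h0 (c : leftCosets m) := hasSum_integral_coset c.1.out (hint c.1.out (out_mem c.2))
  have h1 := hasSum_prod_of_fintype (F := fun p : leftCosets m × Mp2Z => ∫ τ in ModularGroup.fd,
      (MetaGL.act (p.2.1 * p.1.1.out) ⁻¹' ModularGroup.fd).indicator (G p.1.1.out) τ)
    (a := fun c => 4 • ∫ τ in ModularGroup.fd, G c.1.out τ) h0
  rw [← Finset.smul_sum] at h1
  have h2 : ∑ c ∈ (leftCosets_finite m).toFinset, ∫ τ in ModularGroup.fd, G c.out τ =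
      ∑ c : leftCosets m, ∫ τ in ModularGroup.fd, G c.1.out τ :=
    (Finset.sum_subtype _ (fun c => Set.Finite.mem_toFinset _)
      fun c : Quotient (QuotientGroup.rightRel Mp2Z) => ∫ τ in ModularGroup.fd, G c.out τ)
  rw [h2]
  refine h1.congr_fun fun p => ?_
  change ∫ τ in ModularGroup.fd, (MetaGL.act (p.2.1 * p.1.1.out) ⁻¹' ModularGroup.fd).indicator
    (G (p.2.1 * p.1.1.out)) τ = _
  rw [hG _ _ (out_mem p.1.2)]

end Unfolding

section Linearity
variable {A : Type*} [Fintype A] {κ : ℤ}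

theorem peterssonProd_smul_sum_left (c : ℂ) {ι : Type*} (s : Finset ι) (F : ι → ℍ → A → ℂ)
    (g : ℍ → A → ℂ) (h : ∀ i ∈ s, PeterssonConverges κ (F i) g) :
    peterssonProd κ (c • ∑ i ∈ s, F i) g = c * ∑ i ∈ s, peterssonProd κ (F i) g := by
  simp only [peterssonProd]
  rw [← integral_finsetSum s h, ← integral_const_mul]
  congr 1
  funext τ
  simp only [peterssonIntegrand]
  rw [Pi.smul_apply, Finset.sum_apply, scalarProd_smul_left, scalarProd_sum_left, mul_assoc,
    Finset.sum_mul]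

theorem peterssonProd_smul_sum_right (c : ℂ) {ι : Type*} (s : Finset ι) (f : ℍ → A → ℂ)
    (F : ι → ℍ → A → ℂ) (h : ∀ i ∈ s, PeterssonConverges κ f (F i)) :
    peterssonProd κ f (c • ∑ i ∈ s, F i) = conj c * ∑ i ∈ s, peterssonProd κ f (F i) := by
  simp only [peterssonProd]
  rw [← integral_finsetSum s h, ← integral_const_mul]
  congr 1
  funext τ
  simp only [peterssonIntegrand]
  rw [Pi.smul_apply, Finset.sum_apply, scalarProd_smul_right, scalarProd_sum_right, mul_assoc,
    Finset.sum_mul]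

end Linearity

section Adjoint
variable {A : Type*} [AddCommGroup A] [Fintype A] {D : DiscriminantForm A} {κ : ℤ}
  {f g : ℍ → A → ℂ} {m : ℕ+}

/-- The substitution `τ ↦ δτ` exchanges the contributions of `δ` and `δ*`. -/
theorem integral_heckeTerm_eq (f g : ℍ → A → ℂ) {δ : MetaGL} (h : δ ∈ doubleCoset m) :
    ∫ τ in ModularGroup.fd, (δ.act ⁻¹' ModularGroup.fd).indicator
        (peterssonIntegrand κ (heckeTerm D κ m f δ) g) τ =
      ∫ τ in ModularGroup.fd, ((star m δ).act ⁻¹' ModularGroup.fd).indicator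
        (peterssonIntegrand κ f (heckeTerm D κ m g (star m δ))) τ := by
  rw [← integral_indicator measurableSet_fd, ← integral_indicator measurableSet_fd,
    ← integral_smul_eq_self (μ := volume) (f := ModularGroup.fd.indicator
      (((star m δ).act ⁻¹' ModularGroup.fd).indicator _)) (g := δ.mat)]
  congr 1
  funext τ
  change _ = ModularGroup.fd.indicator _ (δ.act τ)
  have h1 : δ.act τ ∈ (star m δ).act ⁻¹' ModularGroup.fd ↔ τ ∈ ModularGroup.fd := by
    rw [Set.mem_preimage, star_act_act]
  by_cases h2 : τ ∈ ModularGroup.fd <;> by_cases h3 : δ.act τ ∈ ModularGroup.fd <;>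
    simp [Set.indicator, h1, h2, h3, peterssonIntegrand_heckeTerm D f g h]

/-- Both sides are, up to the same factor, sums over the whole double coset, and these are matched
by the involution `δ ↦ δ*`. -/
theorem peterssonProd_hecke (hf : f ∈ modularForms D κ) (hg : g ∈ modularForms D κ)
    (h : f ∈ cuspForms D κ ∨ g ∈ cuspForms D κ) :
    peterssonProd κ (hecke D κ m f) g = peterssonProd κ f (hecke D κ m g) := by
  have h1 := hasSum_doubleCoset (m := m)
    (G := fun δ => peterssonIntegrand κ (heckeTerm D κ m f δ) g)
    (fun γ δ hδ => by rw [heckeTerm_mul_left hf γ δ hδ])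
    (fun δ hδ => peterssonConverges_heckeTerm_left hf hg h hδ)
  have h2 := hasSum_doubleCoset (m := m)
    (G := fun δ => peterssonIntegrand κ f (heckeTerm D κ m g δ))
    (fun γ δ hδ => by rw [heckeTerm_mul_left hg γ δ hδ])
    (fun δ hδ => peterssonConverges_heckeTerm_right hf hg h hδ)
  rw [← (starEquiv m).hasSum_iff] at h2
  -- the involution permutes the double coset, so both series have the same terms
  have h3 := h1.unique (h2.congr_fun fun δ => integral_heckeTerm_eq f g δ.2)
  rw [hecke_eq_sum, hecke_eq_sum, peterssonProd_smul_sum_left, peterssonProd_smul_sum_right,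
    heckeConst, Complex.conj_ofReal]
  · congr 1
    exact smul_right_injective ℂ (four_ne_zero : (4 : ℕ) ≠ 0) h3
  · exact fun c hc => peterssonConverges_heckeTerm_right hf hg h
      (out_mem ((Set.Finite.mem_toFinset _).mp hc))
  · exact fun c hc => peterssonConverges_heckeTerm_left hf hg h
      (out_mem ((Set.Finite.mem_toFinset _).mp hc))

end Adjoint

end WeilHecke

end

theorem theorem4 {A : Type*} [AddCommGroup A] [Fintype A] (D : DiscriminantForm A) (κ : ℤ) :
    -- the operators are well defined: the sum is finite and does not depend on the choices
    (∀ m : ℕ+, (leftCosets m).Finite ∧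
      (∀ γ γ' : Mp2Z, cosetAct D m (γ.1 * alpha m * γ'.1) = tripleAct D m γ γ') ∧
      ∀ R : Finset (Mp2Z × Mp2Z), IsCosetSystem m R → ∀ f ∈ modularForms D κ,
        hecke D κ m f = (((m : ℝ) ^ ((κ : ℝ) / 2 - 2) : ℝ) : ℂ) •
          ∑ p ∈ R, slash κ (p.1.1 * alpha m * p.2.1) (tripleAct D m p.1 p.2) f) ∧
    -- they are linear endomorphisms of the space of modular forms
    ∃ T : ℕ+ → Module.End ℂ (modularForms D κ),
      (∀ (m : ℕ+) (f : modularForms D κ), (T m f : ℍ → A → ℂ) = hecke D κ m f) ∧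
      -- they preserve cusp forms
      (∀ (m : ℕ+) (f : modularForms D κ),
        (f : ℍ → A → ℂ) ∈ cuspForms D κ → (T m f : ℍ → A → ℂ) ∈ cuspForms D κ) ∧
      -- they are self-adjoint for the Petersson scalar product
      (∀ (m : ℕ+) (f g : modularForms D κ),
        ((f : ℍ → A → ℂ) ∈ cuspForms D κ ∨ (g : ℍ → A → ℂ) ∈ cuspForms D κ) →
          PeterssonConverges κ (T m f : ℍ → A → ℂ) (g : ℍ → A → ℂ) ∧
          PeterssonConverges κ (f : ℍ → A → ℂ) (T m g : ℍ → A → ℂ) ∧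
          peterssonProd κ (T m f : ℍ → A → ℂ) (g : ℍ → A → ℂ) =
            peterssonProd κ (f : ℍ → A → ℂ) (T m g : ℍ → A → ℂ)) ∧
      -- they are multiplicative
      (∀ m n : ℕ+, Nat.Coprime m n → T m * T n = T (m * n)) := by
  refine ⟨fun m => ⟨leftCosets_finite m, cosetAct_eq D m,
    fun R hR f hf => hecke_eq_sum_of_isCosetSystem hR hf⟩, heckeEnd D κ, fun m f => rfl,
    fun m f hf => hecke_mem_cuspForms hf, fun m f g h => ⟨?_, ?_, ?_⟩,
    fun m n h => LinearMap.ext fun f => Subtype.ext ?_⟩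
  · exact peterssonConverges (hecke_mem_modularForms f.2) g.2 (h.imp_left hecke_mem_cuspForms)
  · exact peterssonConverges f.2 (hecke_mem_modularForms g.2) (h.imp_right hecke_mem_cuspForms)
  · exact peterssonProd_hecke f.2 g.2 h
  · exact hecke_hecke h f.2
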